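/- **Setting.** Let $\kappa$ be the horizon, $x_{k+1}=Ax_k+Bu_k+w_k$ for $k=1,\dots,\kappa$, with $A\in\mathbb R^{m\times m}$, $B\in\mathbb R^{m\times r}$, $x_1\sim\mathcal N(0,\Sigma_1)$, $w_k\sim\mathcal N(0,\Sigma_w)$, where $x_1,w_1,\dots,w_\kappa$ are independent. Let $\Omega$ be a finite set of attacker types, $\Omega^o=\Omega\cup\{\omega_o\}$ with $\omega_o\notin\Omega$ the controller of the system, and $Q^\omega\succeq O$, $R^\omega\succ O$ for $\omega\in\Omega^o$. The sensor observes the states perfectly and chooses a linear-plus-noise rule $\eta\in\Upsilon$, that is $$s_k=\sum_{j\le k}L_{k,j}'x_j+\vartheta_k\in\mathbb R^m,\qquad \vartheta_k\sim\mathcal N(0,\Theta_k),$$ with arbitrary $L_{k,j}\in\mathbb R^{m\times m}$ and $\Theta_k\succeq O$, the $\vartheta_k$ independent of each other and of $x_1,w_1,\dots,w_\kappa$. The follower uses $u_k=\gamma_k(s_1,\dots,s_k)$ with Borel measurable $\gamma_k$. Write $\|v\|_W^2=v'Wv$, and let $x^\omega,u^\omega$ be the closed-loop state and input under $\gamma^\omega$.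 A follower of type $\omega$ minimizes $U_C^\omega(\eta,\gamma)=\sum_{k=1}^\kappa \mathbb E\|x_{k+1}\|_{Q^\omega}^2+\mathbb E\|u_k\|_{R^\omega}^2$ over $\gamma$, and the objective of the sensor is $$U_S(\eta,\{\gamma^\omega\})=\max_{p\in\Delta(\Omega^o)}\Big\{\sum_{\omega\in\Omega}p_\omega\sum_{k=1}^\kappa\mathbb E\|x^\omega_{k+1}\|^2_{Q^{\omega_o}}+p_{\omega_o}\,U_C^{\omega_o}(\eta,\gamma^{\omega_o})\Big\}.$$ The problem of the sensor is to minimize $U_S(\eta,\{\gamma^\omega(\eta)\})$ over $\eta\in\Upsilon$, where $\gamma^\omega(\eta)\in\arg\min_\gamma U_C^\omega(\eta,\gamma)$ for all $\omega$ and $\eta$. A minimizing $\eta$ together with such a reaction is a Stackelberg equilibrium. **Parameters.** Let $x_1^o=x_1$, $x^o_{k+1}=Ax^o_k+w_k$, $\Sigma^o_k=\mathbb E\{x_k^o(x_k^o)'\}$ and $H_k=\mathrm{cov}\{\mathbb E\{x_k^o\mid s_1,\dots,s_k\}\}$. Let $\tilde Q^\omega_{\kappa+1}=Q^\omega$ and,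 for $k=\kappa,\dots,1$, $\Delta_k^\omega=B'\tilde Q_{k+1}^\omega B+R^\omega$, $K_k^\omega=(\Delta_k^\omega)^{-1}B'\tilde Q_{k+1}^\omega A$, $\tilde Q_k^\omega=Q^\omega+A'(\tilde Q_{k+1}^\omega-\tilde Q_{k+1}^\omega B(\Delta_k^\omega)^{-1}B'\tilde Q_{k+1}^\omega)A$. Let $\delta_0^\omega=\mathrm{Tr}\{(\tilde Q_1^\omega-Q^\omega)\Sigma_1\}+\sum_{k=1}^\kappa\mathrm{Tr}\{\tilde Q_{k+1}^\omega\Sigma_w\}$. Over the whole horizon, with blocks indexed by $k,l\in\{1,\dots,\kappa\}$, let $K^\omega,\Delta^\omega$ be block diagonal with blocks $K^\omega_k,\Delta_k^\omega$; let $\Phi^\omega$ have blocks $I$ for $l=k$, $K_k^\omega A^{k-l-1}B$ for $l<k$, $O$ for $l>k$; let $Z$ have blocks $A^{k-l}B$ for $l\le k$, $O$ for $l>k$; let $T^\omega=Z(\Phi^\omega)^{-1}K^\omega$, $\bar A=I_\kappa\otimes A$, $\bar Q=I_\kappa\otimes Q^{\omega_o}$, and let $\Sigma^o$ have blocks $\mathbb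 E\{x_k^o(x_l^o)'\}$. Let $V^{\omega_o}=-(K^{\omega_o})'\Delta^{\omega_o}K^{\omega_o}$, $\xi^{\omega_o}=\delta_0^{\omega_o}-\mathrm{Tr}\{\Sigma^oV^{\omega_o}\}$, and for $\omega\in\Omega$ let $V^\omega=(T^\omega)'\bar QT^\omega-(T^\omega)'\bar Q\bar A-\bar A'\bar QT^\omega$, $\xi^\omega=\mathrm{Tr}\{\Sigma^o\bar A'\bar Q\bar A\}+\kappa\,\mathrm{Tr}\{\Sigma_wQ^{\omega_o}\}$. Finally $\Xi_k^\omega=V_{k,k}^\omega+\sum_{l>k}\big(V_{k,l}^\omega A^{l-k}+(A^{l-k})'V_{l,k}^\omega\big)$. **Program.** Let $\varphi(S)=\max_{p\in\Delta(\Omega^o)}\sum_{\omega\in\Omega^o}p_\omega\big(\xi^\omega+\sum_{k=1}^\kappa\mathrm{Tr}\{S_k\Xi_k^\omega\}\big)$ and let $\Psi$ be the set of all $S=(S_1,\dots,S_\kappa)$ with $S_k\succeq O$, $\Sigma^o_1\succeq S_1\succeq O$ and $\Sigma^o_k\succeq S_k\succeq AS_{k-1}A'$ for $k>1$. **Construction.**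 For $S\in\Psi$ put $S_0=O$, $D_k=\Sigma_1^o$ for $k=1$ and $D_k=\Sigma^o_k-AS_{k-1}A'$ for $k>1$. Take, for every $k$, an eigen-decomposition $D_k=\bar U_k\begin{bmatrix}\bar\Lambda_k&O\\O&O\end{bmatrix}\bar U_k'$ with $\bar\Lambda_k\succ O$ diagonal of size $t_k=\mathrm{rank}\,D_k$, an eigen-decomposition $T_k=U_k\Lambda_kU_k'$, $\Lambda_k=\mathrm{diag}(\lambda_{k,1},\dots,\lambda_{k,t_k})$, of $T_k=\begin{bmatrix}\bar\Lambda_k^{-1/2}&O\end{bmatrix}\bar U_k'(S_k-AS_{k-1}A')\bar U_k\begin{bmatrix}\bar\Lambda_k^{-1/2}\\O\end{bmatrix}$, and real numbers with $\frac{(\lambda^o_{k,i})^2}{(\lambda^o_{k,i})^2+\theta_{k,i}^2}=\lambda_{k,i}$ for all $i$. The rule associated with $S$ is $s_k=L_{k,k}'x_k+\vartheta_k$ with $L_{k,k}=\bar U_k\begin{bmatrix}\bar\Lambda_k^{-1/2}U_k\Lambda_k^o&O\\O&O\end{bmatrix}$, $\Lambda_k^o=\mathrm{diag}(\lambda_{k,1}^o,\dots,\lambda^o_{k,t_k})$,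 and $\Theta_k=\mathrm{diag}(\theta_{k,1}^2,\dots,\theta_{k,t_k}^2,0,\dots,0)$. **Statement.** Best responses $\gamma^\omega(\eta)$ exist for all $\eta\in\Upsilon$ and $\omega\in\Omega^o$. For every choice of them, the problem $\min_{\eta\in\Upsilon}U_S(\eta,\{\gamma^\omega(\eta)\})$ of the sensor is equivalent to $\min_{S\in\Psi}\varphi(S)$, in the following sense. (i) For every $\eta\in\Upsilon$ and every control policy, $H=(H_1,\dots,H_\kappa)\in\Psi$ and $U_S(\eta,\{\gamma^\omega(\eta)\})=\varphi(H)$. (ii) For every $S\in\Psi$ there are rules associated with $S$, and all of them have $H=S$, whatever the control policy. (iii) Both minima are attained and they are equal. (iv) $\eta$ solves the problem of the sensor if and only if its $H$ solves $\min_{S\in\Psi}\varphi(S)$. (v) Given a solution $S$ of $\min_{S\in\Psi}\varphi(S)$, every rule associated with $S$ by the construction is optimal for the sensor. -/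

import Mathlib

open MeasureTheory ProbabilityTheory
open scoped Matrix ENNReal

noncomputable section

namespace RobustSensor

/-- Real vectors and square matrices. -/
abbrev Vec (n : ℕ) : Type := Fin n → ℝ

abbrev Mat (n : ℕ) : Type := Matrix (Fin n) (Fin n) ℝ

/-- The data of the problem: state dimension `m`, input dimension `r`, horizon `κ`, and a set `Ω` of
attacker types. The extended type set is `Option Ω`: `none` is the controller of the system
(its weights are the weights of the system) and `some ω` is the attacker of type `ω`.
Time is counted from `0`, so that stage `k : Fin κ` stands for the stage `k + 1` of `1, …, κ`. -/
structure Model (m r κ : ℕ) (Ω : Type*) where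
  A : Mat m
  B : Matrix (Fin m) (Fin r) ℝ
  /-- covariance of the initial state -/
  covInit : Mat m
  /-- covariance of the state noise -/
  covNoise : Mat m
  Q : Option Ω → Mat m
  R : Option Ω → Mat r
  covInit_posSemidef : covInit.PosSemidef
  covNoise_posSemidef : covNoise.PosSemidef
  Q_posSemidef : ∀ ω, (Q ω).PosSemidef
  R_posDef : ∀ ω, (R ω).PosDef

/-- A linear-plus-noise signaling rule under perfect measurements,
`s_k = ∑_{j ≤ k} L_{k,j}ᵀ x_j + ϑ_k` with `ϑ_k ∼ N(0, Θ_k)`: the gains `L_{k,j}`, `j ≤ k`,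
are arbitrary and the covariances `Θ_k` are arbitrary positive semi-definite matrices. -/
structure SignalRule (m κ : ℕ) where
  gain : (k : Fin κ) → Fin (k.val + 1) → Mat m
  noiseCov : Fin κ → Mat m
  noiseCov_posSemidef : ∀ k, (noiseCov k).PosSemidef

/-- A control policy: `u_k = γ_k(s_1, …, s_k)` with `γ_k` any Borel measurable function. -/
structure ControlPolicy (m r κ : ℕ) where
  act : (k : Fin κ) → (Fin (k.val + 1) → Vec m) → Vec r
  measurable_act : ∀ k, Measurable (act k)

/-- `N(0, S)` on column vectors. -/
def gaussian {m : ℕ} (S : Mat m) : Measure (Vec m) :=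
  (multivariateGaussian (0 : EuclideanSpace ℝ (Fin m)) S).map (WithLp.ofLp : _ → Vec m)

/-- Realizations of the initial state and of the state noise `(x_1, (w_k)_k)`. -/
abbrev Base (m κ : ℕ) : Type := Vec m × (Fin κ → Vec m)

/-- Realizations of all the randomness: `((x_1, (w_k)_k), (ϑ_k)_k)`. -/
abbrev Sample (m κ : ℕ) : Type := Base m κ × (Fin κ → Vec m)

section process

variable {m r κ : ℕ} {Ω : Type*} (M : Model m r κ Ω)

/-- Law of `(x_1, w)`: all components are independent, `x_1 ∼ N(0, Σ_1)`, `w_k ∼ N(0, Σ_w)`. -/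
def baseLaw : Measure (Base m κ) :=
  (gaussian M.covInit).prod (Measure.pi fun _ => gaussian M.covNoise)

/-- Law of all the randomness under a signaling rule: the `ϑ_k ∼ N(0, Θ_k)` are independent of
each other and of `(x_1, w)`. -/
def law (η : SignalRule m κ) : Measure (Sample m κ) :=
  (baseLaw M).prod (Measure.pi fun k => gaussian (η.noiseCov k))

/-- The signal of stage `k`, given the states `x_j`, `j ≤ k`, and the noise `ϑ_k`. -/
def encode (η : SignalRule m κ) (k : Fin κ) (x : Fin (k.val + 1) → Vec m) (th : Vec m) : Vec m :=
  (∑ j, (η.gain k j)ᵀ *ᵥ x j) + th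

/-- The closed-loop state `x_{k+1} = A x_k + B u_k + w_k`, `u_k = γ_k(s_1, …, s_k)`,
for the times `0, …, κ` (which stand for `1, …, κ + 1`). -/
def state (η : SignalRule m κ) (γ : ControlPolicy m r κ) (z : Sample m κ) :
    (k : ℕ) → k ≤ κ → Vec m
  | 0, _ => z.1.1
  | k + 1, hk =>
      M.A *ᵥ state η γ z k (Nat.le_of_succ_le hk)
      + M.B *ᵥ γ.act ⟨k, hk⟩ (fun j : Fin (k + 1) =>
          encode η ⟨j.val, lt_of_le_of_lt (Nat.le_of_lt_succ j.isLt) hk⟩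
            (fun i => state η γ z i.val
              ((Nat.le_of_lt_succ i.isLt).trans
                ((Nat.le_of_lt_succ j.isLt).trans (Nat.le_of_succ_le hk))))
            (z.2 ⟨j.val, lt_of_le_of_lt (Nat.le_of_lt_succ j.isLt) hk⟩))
      + z.1.2 ⟨k, hk⟩
  termination_by k => k
  decreasing_by
    · exact Nat.lt_succ_self k
    · exact lt_of_le_of_lt (Nat.le_of_lt_succ i.isLt) j.isLt

/-- The closed-loop signal `s_k`. -/
def signal (η : SignalRule m κ) (γ : ControlPolicy m r κ) (z : Sample m κ) (k : Fin κ) : Vec m :=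
  encode η k
    (fun i => state M η γ z i.val ((Nat.le_of_lt_succ i.isLt).trans k.isLt.le)) (z.2 k)

/-- The signals `s_1, …, s_k`. -/
def signalHistory (η : SignalRule m κ) (γ : ControlPolicy m r κ) (k : Fin κ) (z : Sample m κ) :
    Fin (k.val + 1) → Vec m :=
  fun j => signal M η γ z ⟨j.val, lt_of_le_of_lt (Nat.le_of_lt_succ j.isLt) k.isLt⟩

/-- The closed-loop control input `u_k = γ_k(s_1, …, s_k)`. -/
def controlInput (η : SignalRule m κ) (γ : ControlPolicy m r κ) (z : Sample m κ) (k : Fin κ) : Vec r :=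
  γ.act k (signalHistory M η γ k z)

/-- The state after stage `k`, that is `x_{k+1}`. -/
def nextState (η : SignalRule m κ) (γ : ControlPolicy m r κ) (z : Sample m κ) (k : Fin κ) :
    Vec m :=
  state M η γ z (k.val + 1) k.isLt

/-- The control-free state: `x^o_1 = x_1` and `x^o_{k+1} = A x^o_k + w_k`. -/
def freeStateAux (b : Base m κ) : (k : ℕ) → k < κ → Vec m
  | 0, _ => b.1
  | k + 1, hk =>
      M.A *ᵥ freeStateAux b k (Nat.lt_of_succ_lt hk) + b.2 ⟨k, Nat.lt_of_succ_lt hk⟩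

def freeState (b : Base m κ) (k : Fin κ) : Vec m := freeStateAux M b k.val k.isLt

/-- The posterior `E{x^o_k | s_1, …, s_k}`, coordinate by coordinate. -/
def posterior (η : SignalRule m κ) (γ : ControlPolicy m r κ) (k : Fin κ) (i : Fin m) :
    Sample m κ → ℝ :=
  (law M η)[fun z => freeState M z.1 k i |
    MeasurableSpace.comap (signalHistory M η γ k) inferInstance]

/-- `H_k = cov{E{x^o_k | s_1, …, s_k}}`. -/
def posteriorCov (η : SignalRule m κ) (γ : ControlPolicy m r κ) (k : Fin κ) : Mat m :=
  Matrix.of fun i j => cov[posterior M η γ k i, posterior M η γ k j; law M η]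

end process

section game

variable {m r κ : ℕ} {Ω : Type*} (M : Model m r κ Ω)

/-- `E‖X‖²_W` as an extended nonnegative real; it is used for positive semi-definite `W` only,
and it is `∞` exactly if `‖X‖²_W` is not integrable. -/
def meanQuad {S : Type*} [MeasurableSpace S] {n : ℕ} (P : Measure S) (W : Mat n) (X : S → Vec n) :
    ℝ≥0∞ :=
  ∫⁻ z, ENNReal.ofReal (X z ⬝ᵥ W *ᵥ X z) ∂P

/-- The objective of the player C of type `ω`. -/
def followerCost (ω : Option Ω) (η : SignalRule m κ) (γ : ControlPolicy m r κ) : ℝ≥0∞ :=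
  ∑ k : Fin κ, (meanQuad (law M η) (M.Q ω) (fun z => nextState M η γ z k)
    + meanQuad (law M η) (M.R ω) (fun z => controlInput M η γ z k))

/-- The cost that the sensor incurs when a player C of the given type uses the policy `γ`:
the full objective of the system for the controller, its state part for an attacker. -/
def sensorTypeCost (η : SignalRule m κ) (γ : ControlPolicy m r κ) : Option Ω → ℝ≥0∞
  | none => followerCost M none η γ
  | some _ => ∑ k : Fin κ, meanQuad (law M η) (M.Q none) (fun z => nextState M η γ z k)

/-- The objective of the sensor: the worst case over all distributions `p` on the extended
type set (which is finite, so that the supremum is a maximum). -/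
def sensorCost [Fintype Ω] (η : SignalRule m κ) (γ : Option Ω → ControlPolicy m r κ) : ℝ≥0∞ :=
  ⨆ p : stdSimplex ℝ (Option Ω), ∑ ω, ENNReal.ofReal (p.1 ω) * sensorTypeCost M η (γ ω) ω

/-- `γ` is a best response of the type `ω` to the signaling rule `η`. -/
def IsBestResponse (ω : Option Ω) (η : SignalRule m κ) (γ : ControlPolicy m r κ) : Prop :=
  ∀ γ' : ControlPolicy m r κ, followerCost M ω η γ ≤ followerCost M ω η γ'

/-- A reaction of the follower: every type answers every signaling rule by a best response. -/
def IsReaction (g : SignalRule m κ → Option Ω → ControlPolicy m r κ) : Prop :=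
  ∀ η ω, IsBestResponse M ω η (g η ω)

/-- Stackelberg equilibrium of the robust sensor design game, the sensor being the leader. -/
def IsEquilibrium [Fintype Ω] (η : SignalRule m κ)
    (g : SignalRule m κ → Option Ω → ControlPolicy m r κ) : Prop :=
  IsReaction M g ∧ ∀ η', sensorCost M η (g η) ≤ sensorCost M η' (g η')

end game

section parameters

variable {m r κ : ℕ} {Ω : Type*} (M : Model m r κ Ω)

/-- The Riccati recursion, run backwards from the final time. -/
def riccatiAux (ω : Option Ω) : ℕ → Mat m
  | 0 => M.Q ω
  | j + 1 =>
      let P := riccatiAux ω j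
      M.Q ω + M.Aᵀ * (P - P * M.B * (M.Bᵀ * P * M.B + M.R ω)⁻¹ * M.Bᵀ * P) * M.A

/-- `riccati M ω k`, `k = 0, …, κ`, stands for `Q̃_{k+1}^ω`; the last one is `Q^ω`. -/
def riccati (ω : Option Ω) (k : ℕ) : Mat m := riccatiAux M ω (κ - k)

/-- `Δ_k^ω`. -/
def delta (ω : Option Ω) (k : Fin κ) : Mat r :=
  M.Bᵀ * riccati M ω (k.val + 1) * M.B + M.R ω

/-- `K_k^ω`. -/
def feedback (ω : Option Ω) (k : Fin κ) : Matrix (Fin r) (Fin m) ℝ :=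
  (delta M ω k)⁻¹ * M.Bᵀ * riccati M ω (k.val + 1) * M.A

/-- `δ_0^ω = Tr{(Q̃_1 - Q)Σ_1} + ∑_k Tr{Q̃_{k+1}Σ_w}`, the minimal cost of the type `ω` when it
observes the state. -/
def delta0 (ω : Option Ω) : ℝ :=
  ((riccati M ω 0 - M.Q ω) * M.covInit).trace
    + ∑ k : Fin κ, (riccati M ω (k.val + 1) * M.covNoise).trace

/-! Matrices that act on the augmented vectors of the whole horizon; the blocks are indexed by
the stages `k : Fin κ` themselves. -/

/-- `Φ^ω`, with blocks `I` for `k = l`, `K_k A^{k-l-1} B` for `l < k`. -/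
def bigPhi (ω : Option Ω) : Matrix (Fin κ × Fin r) (Fin κ × Fin r) ℝ :=
  Matrix.of fun a b =>
    if a.1 = b.1 then (1 : Mat r) a.2 b.2
    else if b.1 < a.1 then
      (feedback M ω a.1 * M.A ^ (a.1.val - b.1.val - 1) * M.B) a.2 b.2
    else 0

/-- The block diagonal matrix of the `K_k^ω`. -/
def bigK (ω : Option Ω) : Matrix (Fin κ × Fin r) (Fin κ × Fin m) ℝ :=
  Matrix.of fun a b => if a.1 = b.1 then feedback M ω a.1 a.2 b.2 else 0

/-- The block diagonal matrix of the `Δ_k^ω`. -/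
def bigDelta (ω : Option Ω) : Matrix (Fin κ × Fin r) (Fin κ × Fin r) ℝ :=
  Matrix.of fun a b => if a.1 = b.1 then delta M ω a.1 a.2 b.2 else 0

/-- `Z`, with blocks `A^{k-l} B` for `l ≤ k`. -/
def bigZ : Matrix (Fin κ × Fin m) (Fin κ × Fin r) ℝ :=
  Matrix.of fun a b =>
    if b.1 ≤ a.1 then (M.A ^ (a.1.val - b.1.val) * M.B) a.2 b.2 else 0

/-- `I_κ ⊗ X`. -/
def bigDiag (X : Mat m) : Matrix (Fin κ × Fin m) (Fin κ × Fin m) ℝ :=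
  Matrix.kroneckerMap (· * ·) (1 : Mat κ) X

/-- `T^ω = Z (Φ^ω)⁻¹ K^ω`. -/
def bigT (ω : Option Ω) : Matrix (Fin κ × Fin m) (Fin κ × Fin m) ℝ :=
  bigZ M * (bigPhi M ω)⁻¹ * bigK M ω

/-- `Σ^o = E{x^o (x^o)ᵀ}` for the augmented control-free state. -/
def bigSigma : Matrix (Fin κ × Fin m) (Fin κ × Fin m) ℝ :=
  Matrix.of fun a b =>
    ∫ z, freeState M z a.1 a.2 * freeState M z b.1 b.2 ∂(baseLaw M)

/-- `Σ^o_k = E{x^o_k (x^o_k)ᵀ}`. -/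
def freeCov (k : Fin κ) : Mat m :=
  Matrix.of fun i j => ∫ z, freeState M z k i * freeState M z k j ∂(baseLaw M)

/-- `V^ω`. -/
def bigV : Option Ω → Matrix (Fin κ × Fin m) (Fin κ × Fin m) ℝ
  | none => -((bigK M none)ᵀ * bigDelta M none * bigK M none)
  | some ω =>
      (bigT M (some ω))ᵀ * bigDiag (M.Q none) * bigT M (some ω)
        - (bigT M (some ω))ᵀ * bigDiag (M.Q none) * bigDiag M.A
        - (bigDiag M.A)ᵀ * bigDiag (M.Q none) * bigT M (some ω)

/-- The block `V^ω_{k,l}`. -/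
def blockV (ω : Option Ω) (k l : Fin κ) : Mat m :=
  Matrix.of fun i j => bigV M ω (k, i) (l, j)

/-- `Ξ^ω_k = V^ω_{k,k} + ∑_{l > k} (V^ω_{k,l} A^{l-k} + (A^{l-k})ᵀ V^ω_{l,k})`. -/
def Xi (ω : Option Ω) (k : Fin κ) : Mat m :=
  blockV M ω k k + ∑ l ∈ Finset.Ioi k,
    (blockV M ω k l * M.A ^ (l.val - k.val) + (M.A ^ (l.val - k.val))ᵀ * blockV M ω l k)

/-- The scalar `ξ^ω`. -/
def xi : Option Ω → ℝ
  | none => delta0 M none - (bigSigma M * bigV M none).trace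
  | some _ =>
      (bigSigma M * (bigDiag M.A)ᵀ * bigDiag (M.Q none) * bigDiag M.A).trace
        + (κ : ℝ) * (M.covNoise * M.Q none).trace

end parameters

section program

variable {m r κ : ℕ} {Ω : Type*} (M : Model m r κ Ω)

/-- `A S_{k-1} Aᵀ`, and `O` at the first stage. -/
def predicted (S : Fin κ → Mat m) (k : Fin κ) : Mat m :=
  if k.val = 0 then 0
  else M.A * S ⟨k.val - 1, lt_of_le_of_lt (Nat.sub_le _ _) k.isLt⟩ * M.Aᵀ

/-- The constraints: `S_k ⪰ O`, `Σ^o_1 ⪰ S_1 ⪰ O` and `Σ^o_k ⪰ S_k ⪰ A S_{k-1} Aᵀ`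
for the later stages. -/
def Feasible : Set (Fin κ → Mat m) :=
  {S | ∀ k, (S k).PosSemidef ∧ (freeCov M k - S k).PosSemidef
    ∧ (S k - predicted M S k).PosSemidef}

/-- `max_p ∑_ω p_ω (ξ^ω + ∑_k Tr{S_k Ξ_k^ω})`, a maximum since the type set is finite. -/
def programValue [Fintype Ω] (S : Fin κ → Mat m) : ℝ :=
  ⨆ p : stdSimplex ℝ (Option Ω), ∑ ω, p.1 ω * (xi M ω + ∑ k, (S k * Xi M ω k).trace)

/-- `S` is a solution of the minimization of `programValue` over the feasible set. -/
def IsSolution [Fintype Ω] (S : Fin κ → Mat m) : Prop :=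
  S ∈ Feasible M ∧ ∀ S' ∈ Feasible M, programValue M S ≤ programValue M S'

/-- The index set of an `m × m` matrix, split after the first `t` indices. -/
def splitIndex {t q m : ℕ} (h : t + q = m) : Fin t ⊕ Fin q ≃ Fin m :=
  finSumFinEquiv.trans (finCongr h)

/-- The `m × m` matrix `[X O; O O]`. -/
def pad {t q m : ℕ} (h : t + q = m) (X : Mat t) : Mat m :=
  Matrix.reindex (splitIndex h) (splitIndex h) (Matrix.fromBlocks X 0 0 0)

/-- The upper left `t × t` block of an `m × m` matrix. -/
def topLeft {t q m : ℕ} (h : t + q = m) (X : Mat m) : Mat t :=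
  (Matrix.reindex (splitIndex h).symm (splitIndex h).symm X).toBlocks₁₁

/-- The pair `L_{k,k}`, `Θ_k` is obtained from `D = Σ^o_k - A S_{k-1} Aᵀ` and
`E = S_k - A S_{k-1} Aᵀ` by the explicit construction: with eigen-decompositions
`D = Ū [Λ̄ O; O O] Ūᵀ`, `Λ̄` positive of size `t = rank D`, and `T = U Λ Uᵀ` for
`T = [Λ̄^{-1/2} O] Ūᵀ E Ū [Λ̄^{-1/2}; O]`, and numbers `λ^o_i`, `θ_i` with
`(λ^o_i)² / ((λ^o_i)² + θ_i²) = λ_i`, one has `L_{k,k} = Ū [Λ̄^{-1/2} U Λ^o O; O O]` and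
`Θ_k = diag(θ_1², …, θ_t², 0, …, 0)`. -/
def IsStageSignal (D E L Th : Mat m) : Prop :=
  ∃ (t q : ℕ) (h : t + q = m)
    (Ubar : Mat m) (lamBar : Fin t → ℝ) (U : Mat t) (lam lamO θ : Fin t → ℝ),
    t = D.rank ∧
    Ubar ∈ Matrix.orthogonalGroup (Fin m) ℝ ∧
    (∀ i, 0 < lamBar i) ∧
    D = Ubar * pad h (Matrix.diagonal lamBar) * Ubarᵀ ∧
    U ∈ Matrix.orthogonalGroup (Fin t) ℝ ∧
    Matrix.diagonal (fun i => (√(lamBar i))⁻¹) * topLeft h (Ubarᵀ * E * Ubar)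
        * Matrix.diagonal (fun i => (√(lamBar i))⁻¹)
      = U * Matrix.diagonal lam * Uᵀ ∧
    (∀ i, lamO i ^ 2 + θ i ^ 2 ≠ 0 ∧ lamO i ^ 2 / (lamO i ^ 2 + θ i ^ 2) = lam i) ∧
    L = Ubar * pad h (Matrix.diagonal (fun i => (√(lamBar i))⁻¹) * U * Matrix.diagonal lamO) ∧
    Th = pad h (Matrix.diagonal fun i => θ i ^ 2)

/-- The signaling rule `η` is `s_k = L_{k,k}ᵀ x_k + ϑ_k`, with `L_{k,k}` and the covariance of
`ϑ_k` obtained from `S` by the explicit construction. -/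
def IsAssociatedRule (S : Fin κ → Mat m) (η : SignalRule m κ) : Prop :=
  ∀ k : Fin κ,
    (∀ j : Fin (k.val + 1), j ≠ Fin.last k.val → η.gain k j = 0) ∧
    IsStageSignal (freeCov M k - predicted M S k) (S k - predicted M S k)
      (η.gain k (Fin.last k.val)) (η.noiseCov k)

end program

end RobustSensor

end

open MeasureTheory ProbabilityTheory
open scoped Matrix ENNReal

noncomputable section

/-! Three facts carry the theorem.

The control does not affect the information. By superposition (`stateAt_eq`) the state is the
control-free state plus a linear function of past inputs, and past inputs are functions of past
signals. The contribution of the control to a signal can therefore be computed from earlier signals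
and subtracted, so the signals generate the same σ-algebras as those of the uncontrolled system
(`comap_signalHistory`). The posterior and its covariances H depend on the signaling rule only.

Costs are affine in H. Completing the square along the Riccati recursion writes the cost of a
follower as a constant of the rule plus nonnegative penalties on the deviation from
certainty-equivalent feedback (`FiniteEnergy.sum_cost`). The estimation error splits off because it
is orthogonal to everything observable. Zero deviation is attainable by a measurable policy, and Δ
is positive definite, so every best response has almost surely zero deviation. This is why the
choice of best response is irrelevant. Solving the resulting linear relation over the horizon gives
u = -Φ⁻¹K x̂ and the input part -T x̂ of the next state, where x̂ is the posterior. All costs become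
quadratic in x̂, and E x̂_l x̂_k' = A^{l-k} H_k for l ≥ k reduces them to the diagonal blocks H_k
with the weights Ξ_k (`sensorTypeCost_eq`).

Feasible points are exactly the attainable H. Necessity is orthogonality: the two matrix
inequalities say that the second moments of the estimation error and of the innovation are positive
semidefinite (`posteriorCov_mem_feasible`). For sufficiency, the construction is followed through a
Kalman filter: in coordinates whitening the prediction error, each eigen-direction is measured with
the signal-to-noise ratio that reduces its variance by the prescribed fraction
(`IsStageSignal.exists_gain`, `filter_step`). Joint Gaussianity enters here, where uncorrelated must
imply independent.

Elsewhere independence is used through reflections: changing the sign of one noise preserves the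
law, so this noise is uncorrelated with whatever the reflection leaves fixed. Existence of a minimum
follows from compactness of the feasible set and lower semicontinuity of a supremum of affine
functions. -/

namespace RobustSensor

/-! ### Second moments of random vectors and orthogonality of conditional expectations -/

section moments

variable {S : Type*} {G : MeasurableSpace S} [mS : MeasurableSpace S] {P : Measure S}
  {ι ι' ι'' : Type*}

/-- A random vector with square integrable coordinates. -/
def SquareIntegrable (P : Measure S) (X : S → ι → ℝ) : Prop :=
  ∀ i, MemLp (fun z => X z i) 2 P

/-- The matrix `E{X Yᵀ}`. -/
def crossMoment (P : Measure S) (X : S → ι → ℝ) (Y : S → ι' → ℝ) : Matrix ι ι' ℝ :=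
  Matrix.of fun i j => ∫ z, X z i * Y z j ∂P

lemma crossMoment_apply (X : S → ι → ℝ) (Y : S → ι' → ℝ) (i : ι) (j : ι') :
    crossMoment P X Y i j = ∫ z, X z i * Y z j ∂P := rfl

namespace SquareIntegrable

lemma add {X Y : S → ι → ℝ} (hX : SquareIntegrable P X) (hY : SquareIntegrable P Y) :
    SquareIntegrable P (fun z => X z + Y z) := fun i => (hX i).add (hY i)

lemma sub {X Y : S → ι → ℝ} (hX : SquareIntegrable P X) (hY : SquareIntegrable P Y) :
    SquareIntegrable P (fun z => X z - Y z) := fun i => (hX i).sub (hY i)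

lemma neg {X : S → ι → ℝ} (hX : SquareIntegrable P X) :
    SquareIntegrable P (fun z => - X z) := fun i => (hX i).neg

lemma mulVec [Fintype ι] {X : S → ι → ℝ} (hX : SquareIntegrable P X) (A : Matrix ι' ι ℝ) :
    SquareIntegrable P (fun z => A *ᵥ X z) := fun i => by
  simp only [Matrix.mulVec, dotProduct]
  exact memLp_finsetSum _ fun j _ => (hX j).const_mul _

lemma sum {α : Type*} {s : Finset α} {X : α → S → ι → ℝ}
    (hX : ∀ a ∈ s, SquareIntegrable P (X a)) :
    SquareIntegrable P (fun z => ∑ a ∈ s, X a z) := fun i => by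
  simp only [Finset.sum_apply]
  exact memLp_finsetSum _ fun a ha => hX a ha i

lemma integrable_mul {X : S → ι → ℝ} {Y : S → ι' → ℝ} (hX : SquareIntegrable P X)
    (hY : SquareIntegrable P Y) (i : ι) (j : ι') : Integrable (fun z => X z i * Y z j) P :=
  (hX i).integrable_mul (hY j)

end SquareIntegrable

lemma crossMoment_transpose (X : S → ι → ℝ) (Y : S → ι' → ℝ) :
    (crossMoment P X Y)ᵀ = crossMoment P Y X := by
  ext i j
  simp [crossMoment, mul_comm]

lemma crossMoment_congr {X X' : S → ι → ℝ} {Y Y' : S → ι' → ℝ} (hX : X =ᵐ[P] X')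
    (hY : Y =ᵐ[P] Y') : crossMoment P X Y = crossMoment P X' Y' := by
  ext i j
  refine integral_congr_ae ?_
  filter_upwards [hX, hY] with z h1 h2
  rw [h1, h2]

lemma crossMoment_add_left {X X' : S → ι → ℝ} {Y : S → ι' → ℝ} (hX : SquareIntegrable P X)
    (hX' : SquareIntegrable P X') (hY : SquareIntegrable P Y) :
    crossMoment P (fun z => X z + X' z) Y = crossMoment P X Y + crossMoment P X' Y := by
  ext i j
  simp only [crossMoment_apply, Matrix.add_apply, Pi.add_apply, add_mul]
  exact integral_add (hX.integrable_mul hY i j) (hX'.integrable_mul hY i j)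

lemma crossMoment_neg_left (X : S → ι → ℝ) (Y : S → ι' → ℝ) :
    crossMoment P (fun z => - X z) Y = - crossMoment P X Y := by
  ext i j
  simp [crossMoment_apply, integral_neg]

lemma crossMoment_mulVec_left [Fintype ι] {X : S → ι → ℝ} {Y : S → ι' → ℝ}
    (hX : SquareIntegrable P X) (hY : SquareIntegrable P Y) (A : Matrix ι'' ι ℝ) :
    crossMoment P (fun z => A *ᵥ X z) Y = A * crossMoment P X Y := by
  ext i j
  simp only [crossMoment_apply, Matrix.mul_apply, Matrix.mulVec, dotProduct, Finset.sum_mul]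
  rw [integral_finsetSum]
  · simp only [mul_assoc, integral_const_mul]
  · intro a _
    simp only [mul_assoc]
    exact (hX.integrable_mul hY a j).const_mul _

lemma crossMoment_sub_left {X X' : S → ι → ℝ} {Y : S → ι' → ℝ} (hX : SquareIntegrable P X)
    (hX' : SquareIntegrable P X') (hY : SquareIntegrable P Y) :
    crossMoment P (fun z => X z - X' z) Y = crossMoment P X Y - crossMoment P X' Y := by
  simp only [sub_eq_add_neg]
  rw [crossMoment_add_left hX hX'.neg hY, crossMoment_neg_left]

lemma crossMoment_add_right {X : S → ι → ℝ} {Y Y' : S → ι' → ℝ} (hX : SquareIntegrable P X)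
    (hY : SquareIntegrable P Y) (hY' : SquareIntegrable P Y') :
    crossMoment P X (fun z => Y z + Y' z) = crossMoment P X Y + crossMoment P X Y' := by
  rw [← crossMoment_transpose, crossMoment_add_left hY hY' hX, Matrix.transpose_add]
  simp only [crossMoment_transpose]

lemma crossMoment_sub_right {X : S → ι → ℝ} {Y Y' : S → ι' → ℝ} (hX : SquareIntegrable P X)
    (hY : SquareIntegrable P Y) (hY' : SquareIntegrable P Y') :
    crossMoment P X (fun z => Y z - Y' z) = crossMoment P X Y - crossMoment P X Y' := by
  rw [← crossMoment_transpose, crossMoment_sub_left hY hY' hX, Matrix.transpose_sub]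
  simp only [crossMoment_transpose]

lemma crossMoment_mulVec_right [Fintype ι'] {X : S → ι → ℝ} {Y : S → ι' → ℝ}
    (hX : SquareIntegrable P X) (hY : SquareIntegrable P Y) (A : Matrix ι'' ι' ℝ) :
    crossMoment P X (fun z => A *ᵥ Y z) = crossMoment P X Y * Aᵀ := by
  rw [← crossMoment_transpose, crossMoment_mulVec_left hY hX, Matrix.transpose_mul,
    crossMoment_transpose]

lemma crossMoment_mulVec_self [Fintype ι] {X : S → ι → ℝ} (hX : SquareIntegrable P X)
    (A : Matrix ι' ι ℝ) :
    crossMoment P (fun z => A *ᵥ X z) (fun z => A *ᵥ X z) = A * crossMoment P X X * Aᵀ := by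
  rw [crossMoment_mulVec_left hX (hX.mulVec A), crossMoment_mulVec_right hX hX, Matrix.mul_assoc]

lemma integrable_quad [Fintype ι] [Fintype ι'] {X : S → ι → ℝ} {Y : S → ι' → ℝ}
    (hX : SquareIntegrable P X) (hY : SquareIntegrable P Y) (W : Matrix ι ι' ℝ) :
    Integrable (fun z => X z ⬝ᵥ W *ᵥ Y z) P := by
  simp only [dotProduct]
  exact integrable_finsetSum _ fun i _ => hX.integrable_mul (hY.mulVec W) i i

lemma integral_quad [Fintype ι] [Fintype ι'] {X : S → ι → ℝ} {Y : S → ι' → ℝ}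
    (hX : SquareIntegrable P X) (hY : SquareIntegrable P Y) (W : Matrix ι ι' ℝ) :
    ∫ z, X z ⬝ᵥ W *ᵥ Y z ∂P = (W * crossMoment P Y X).trace := by
  rw [← crossMoment_mulVec_left hY hX]
  simp only [dotProduct, Matrix.trace, Matrix.diag_apply, crossMoment_apply]
  rw [integral_finsetSum _ fun i _ => hX.integrable_mul (hY.mulVec W) i i]
  simp only [mul_comm]

lemma crossMoment_self_posSemidef [Fintype ι] {X : S → ι → ℝ} (hX : SquareIntegrable P X) :
    (crossMoment P X X).PosSemidef := by
  refine Matrix.PosSemidef.of_dotProduct_mulVec_nonneg ?_ fun v => ?_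
  · rw [Matrix.IsHermitian, Matrix.conjTranspose_eq_transpose_of_trivial, crossMoment_transpose]
  -- With v as a one-row matrix, the quadratic form at v becomes the second moment of the scalar
  -- v'X.
  · have h := crossMoment_mulVec_self hX (Matrix.of fun (_ : Unit) i => v i)
    have h2 : star v ⬝ᵥ crossMoment P X X *ᵥ v
        = crossMoment P (fun z => (Matrix.of fun (_ : Unit) i => v i) *ᵥ X z)
          (fun z => (Matrix.of fun (_ : Unit) i => v i) *ᵥ X z) () () := by
      rw [h]
      simp only [star_trivial, Matrix.mul_apply, dotProduct, Matrix.mulVec,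
        Matrix.of_apply, Matrix.transpose_apply, Finset.mul_sum, Finset.sum_mul]
      rw [Finset.sum_comm]
      simp only [mul_assoc]
    rw [h2]
    exact integral_nonneg fun z => mul_self_nonneg _

open scoped MatrixOrder in
lemma PosSemidef.exists_eq_transpose_mul_self [Fintype ι] {W : Matrix ι ι ℝ}
    (hW : W.PosSemidef) : ∃ C : Matrix ι ι ℝ, W = Cᵀ * C := by
  classical
  obtain ⟨C, hC⟩ := CStarAlgebra.nonneg_iff_eq_star_mul_self.mp hW.nonneg
  refine ⟨C, ?_⟩
  rwa [Matrix.star_eq_conjTranspose, Matrix.conjTranspose_eq_transpose_of_trivial] at hC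

lemma PosSemidef.trace_mul_nonneg [Fintype ι] {W M : Matrix ι ι ℝ} (hW : W.PosSemidef)
    (hM : M.PosSemidef) : 0 ≤ (W * M).trace := by
  obtain ⟨C, rfl⟩ := PosSemidef.exists_eq_transpose_mul_self hW
  rw [Matrix.mul_assoc, Matrix.trace_mul_comm, ← Matrix.conjTranspose_eq_transpose_of_trivial]
  exact (hM.mul_mul_conjTranspose_same C).trace_nonneg

/-- The integrand is nonnegative and integrable, so its lower integral is the Bochner integral. This
is the passage from costs in `ℝ≥0∞` to traces. -/
lemma meanQuad_eq {n : ℕ} {W : Mat n} (hW : W.PosSemidef) {X : S → Vec n}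
    (hX : SquareIntegrable P X) :
    meanQuad P W X = ENNReal.ofReal (W * crossMoment P X X).trace := by
  rw [meanQuad, ← integral_quad hX hX W,
    ofReal_integral_eq_lintegral_ofReal (integrable_quad hX hX W)]
  exact Filter.Eventually.of_forall fun z => by
    simpa using hW.dotProduct_mulVec_nonneg (X z)

/-- With W = C'C and C invertible, each coordinate of x is a row of C⁻¹ applied to Cx, and
Cauchy–Schwarz bounds it by |Cx|² = x'Wx. -/
lemma PosDef.exists_coercive {n : ℕ} {W : Mat n} (hW : W.PosDef) :
    ∃ c > 0, ∀ (x : Vec n) (i : Fin n), c * x i ^ 2 ≤ x ⬝ᵥ W *ᵥ x := by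
  classical
  obtain ⟨C, hC, hWC⟩ : ∃ C : Mat n, IsUnit C ∧ W = Cᵀ * C := by
    obtain ⟨C, hC⟩ := PosSemidef.exists_eq_transpose_mul_self hW.posSemidef
    refine ⟨C, ?_, hC⟩
    rw [Matrix.isUnit_iff_isUnit_det, isUnit_iff_ne_zero]
    intro h0
    have := hW.det_pos
    rw [hC, Matrix.det_mul, h0, mul_zero] at this
    exact lt_irrefl _ this
  set D : Mat n := C⁻¹
  have hD : D * C = 1 := Matrix.nonsing_inv_mul C ((Matrix.isUnit_iff_isUnit_det C).mp hC)
  -- The sum over all entries of C⁻¹ dominates every row at once; the summand 1 keeps b positive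
  -- without a case distinction.
  set b : ℝ := 1 + ∑ i, ∑ j, D i j ^ 2
  have hb : 0 < b := by positivity
  refine ⟨b⁻¹, by positivity, fun x i => ?_⟩
  have h1 : x ⬝ᵥ W *ᵥ x = ∑ j, (C *ᵥ x) j ^ 2 := by
    rw [hWC, ← Matrix.mulVec_mulVec, Matrix.dotProduct_mulVec, Matrix.vecMul_transpose]
    simp [dotProduct, sq]
  have h2 : x i = ∑ j, D i j * (C *ᵥ x) j := by
    have : x = D *ᵥ (C *ᵥ x) := by rw [Matrix.mulVec_mulVec, hD, Matrix.one_mulVec]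
    conv_lhs => rw [this]
    rfl
  have h3 : x i ^ 2 ≤ (∑ j, D i j ^ 2) * ∑ j, (C *ᵥ x) j ^ 2 := by
    rw [h2]; exact Finset.sum_mul_sq_le_sq_mul_sq _ _ _
  have h4 : (∑ j, D i j ^ 2) ≤ b := by
    have := Finset.single_le_sum (f := fun i => ∑ j, D i j ^ 2)
      (fun i _ => by positivity) (Finset.mem_univ i)
    simp only [b]; linarith
  rw [h1, inv_mul_le_iff₀ hb]
  exact h3.trans (mul_le_mul_of_nonneg_right h4 (by positivity))

lemma SquareIntegrable.of_meanQuad_ne_top {n : ℕ} {W : Mat n} (hW : W.PosDef) {X : S → Vec n}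
    (hX : Measurable X) (h : meanQuad P W X ≠ ⊤) : SquareIntegrable P X := by
  obtain ⟨c, hc, hcx⟩ := PosDef.exists_coercive hW
  intro i
  have hXi : Measurable fun z => X z i := (measurable_pi_apply i).comp hX
  rw [memLp_two_iff_integrable_sq hXi.aestronglyMeasurable]
  have h1 : Integrable (fun z => c * X z i ^ 2) P := by
    refine ⟨(hXi.pow_const 2 |>.const_mul c).aestronglyMeasurable, ?_⟩
    rw [hasFiniteIntegral_iff_ofReal
      (Filter.Eventually.of_forall fun z => by positivity)]
    exact lt_of_le_of_lt (lintegral_mono fun z => ENNReal.ofReal_le_ofReal (hcx _ i))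
      (lt_top_iff_ne_top.mpr h)
  have h2 := h1.const_mul c⁻¹
  simpa [← mul_assoc, inv_mul_cancel₀ hc.ne'] using h2

lemma ae_eq_zero_of_trace_eq_zero {n : ℕ} {W : Mat n} (hW : W.PosDef) {X : S → Vec n}
    (hX : SquareIntegrable P X) (h : (W * crossMoment P X X).trace = 0) :
    X =ᵐ[P] fun _ => 0 := by
  obtain ⟨c, hc, hcx⟩ := PosDef.exists_coercive hW
  rw [← integral_quad hX hX W, integral_eq_zero_iff_of_nonneg
    (fun z => by simpa using hW.posSemidef.dotProduct_mulVec_nonneg (X z))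
    (integrable_quad hX hX W)] at h
  filter_upwards [h] with z hz
  ext i
  have := hcx (X z) i
  simp only [Pi.zero_apply] at hz ⊢
  rw [hz] at this
  have h5 : X z i ^ 2 ≤ 0 := by
    by_contra h6
    push Not at h6
    nlinarith
  exact pow_eq_zero_iff two_ne_zero |>.mp (le_antisymm h5 (sq_nonneg _))

/-- Conditional expectation, coordinate by coordinate. -/
def condVec {S : Type*} [mS : MeasurableSpace S] (P : Measure S) (G : MeasurableSpace S)
    (X : S → ι → ℝ) (z : S) (i : ι) : ℝ :=
  (P[fun z => X z i | G]) z

variable (G) in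
lemma squareIntegrable_condVec {X : S → ι → ℝ} (hX : SquareIntegrable P X) :
    SquareIntegrable P (condVec P G X) := fun i =>
  (hX i).condExp (by norm_num)

variable (G) in
lemma measurable_condVec (X : S → ι → ℝ) :
    Measurable[G] (condVec P G X) := by
  refine @measurable_pi_iff _ _ _ G _ _ |>.mpr fun i => ?_
  exact stronglyMeasurable_condExp.measurable

/-- Y is pulled out of the conditional expectation, whose integral is then the plain integral. -/
lemma crossMoment_condVec_left [IsProbabilityMeasure P]
    (hG : G ≤ mS) {X : S → ι → ℝ} {Y : S → ι' → ℝ} (hX : SquareIntegrable P X)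
    (hY : SquareIntegrable P Y) (hYG : Measurable[G] Y) :
    crossMoment P (condVec P G X) Y = crossMoment P X Y := by
  ext i j
  simp only [crossMoment_apply]
  have hm : StronglyMeasurable[G] (fun z => Y z j) :=
    (@measurable_pi_iff _ _ _ G _ _ |>.mp hYG j).stronglyMeasurable
  have h := condExp_mul_of_stronglyMeasurable_right (μ := P) (f := fun z => X z i) hm
    (hX.integrable_mul hY i j) ((hX i).integrable (by norm_num))
  rw [← integral_condExp hG (f := fun z => X z i * Y z j)]
  exact (integral_congr_ae h).symm

lemma crossMoment_sub_condVec [IsProbabilityMeasure P]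
    (hG : G ≤ mS) {X : S → ι → ℝ} {Y : S → ι' → ℝ} (hX : SquareIntegrable P X)
    (hY : SquareIntegrable P Y) (hYG : Measurable[G] Y) :
    crossMoment P (fun z => X z - condVec P G X z) Y = 0 := by
  rw [crossMoment_sub_left hX (squareIntegrable_condVec G hX) hY,
    crossMoment_condVec_left hG hX hY hYG, sub_self]

/-- A random vector that changes its sign under a measure preserving map which does not change
another one is uncorrelated with the latter. -/
lemma crossMoment_eq_zero_of_flip {τ : S → S} (hτ : MeasurePreserving τ P P)
    {X : S → ι → ℝ} {Y : S → ι' → ℝ} (hX : SquareIntegrable P X) (hY : SquareIntegrable P Y)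
    (h1 : ∀ z, X (τ z) = - X z) (h2 : ∀ z, Y (τ z) = Y z) : crossMoment P X Y = 0 := by
  ext i j
  -- Change of variables by τ shows that the moment equals its own negative.
  have h := integral_map (μ := P) (φ := τ) hτ.measurable.aemeasurable
    (f := fun z => X z i * Y z j)
    (by rw [hτ.map_eq]; exact (hX.integrable_mul hY i j).aestronglyMeasurable)
  rw [hτ.map_eq] at h
  simp only [h1, h2, Pi.neg_apply, neg_mul, integral_neg] at h
  simp only [crossMoment_apply, Matrix.zero_apply]
  linarith

end moments

/-! ### Symmetry and moments of the centered Gaussian -/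

section gaussian

variable {m : ℕ}

instance (S : Mat m) : IsProbabilityMeasure (gaussian S) :=
  Measure.isProbabilityMeasure_map (by fun_prop)

instance (S : Mat m) : IsGaussian (gaussian S) := by
  have : gaussian S = (multivariateGaussian (0 : EuclideanSpace ℝ (Fin m)) S).map
      (PiLp.continuousLinearEquiv 2 ℝ (fun _ : Fin m => ℝ)) := rfl
  rw [this]
  infer_instance

/-- N(0, S) is a linear image of the standard Gaussian, which is invariant under the isometry x ↦
-x. -/
lemma measurePreserving_neg_gaussian (S : Mat m) :
    MeasurePreserving (fun x : Vec m => -x) (gaussian S) (gaussian S) := by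
  refine ⟨measurable_neg, ?_⟩
  have h : (stdGaussian (EuclideanSpace ℝ (Fin m))).map (fun x => -x)
      = stdGaussian (EuclideanSpace ℝ (Fin m)) :=
    stdGaussian_map (LinearIsometryEquiv.neg ℝ)
  simp only [gaussian, multivariateGaussian, zero_add]
  rw [Measure.map_map (by fun_prop) (by fun_prop), Measure.map_map (by fun_prop) (by fun_prop)]
  conv_rhs => rw [← h]
  rw [Measure.map_map (by fun_prop) (by fun_prop), Measure.map_map (by fun_prop) (by fun_prop)]
  congr 1
  ext x i
  simp

lemma squareIntegrable_gaussian (S : Mat m) : SquareIntegrable (gaussian S) (fun x => x) :=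
  fun i => IsGaussian.memLp_dual (gaussian S) (ContinuousLinearMap.proj i) 2 (by simp)

lemma crossMoment_gaussian {S : Mat m} (hS : S.PosSemidef) :
    crossMoment (gaussian S) (fun x => x) (fun x => x) = S := by
  have hμ : IsGaussian (multivariateGaussian (0 : EuclideanSpace ℝ (Fin m)) S) := inferInstance
  have hL : ∀ i, MemLp (fun x : EuclideanSpace ℝ (Fin m) => x i) 2 (multivariateGaussian 0 S) :=
    fun i => IsGaussian.memLp_dual _ (EuclideanSpace.proj i) 2 (by simp)
  have h0 : ∀ i, ∫ x : EuclideanSpace ℝ (Fin m), x i ∂(multivariateGaussian 0 S) = 0 := by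
    intro i
    have := (EuclideanSpace.proj (𝕜 := ℝ) i).integral_comp_id_comm
      (μ := multivariateGaussian (0 : EuclideanSpace ℝ (Fin m)) S) IsGaussian.integrable_id
    rw [integral_id_multivariateGaussian] at this
    simpa using this
  ext i j
  rw [crossMoment_apply, gaussian, integral_map (by fun_prop) (by fun_prop),
    ← covariance_eval_multivariateGaussian (μ := 0) hS, covariance_eq_sub (hL i) (hL j), h0, h0]
  simp

end gaussian

/-! ### Superposition, policy-independence of the information, and sign symmetries -/

section process

variable {m r κ : ℕ} {Ω : Type*} (M : Model m r κ Ω) (η : SignalRule m κ)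
  (γ : ControlPolicy m r κ)

instance : IsProbabilityMeasure (baseLaw M) := by unfold baseLaw; infer_instance

instance : IsProbabilityMeasure (law M η) := by unfold law; infer_instance

/-- The closed-loop state at the beginning of a stage. -/
def stateAt (k : Fin κ) (z : Sample m κ) : Vec m := state M η γ z k.val k.isLt.le

lemma nextState_eq (z : Sample m κ) (k : Fin κ) :
    nextState M η γ z k
      = M.A *ᵥ stateAt M η γ k z + M.B *ᵥ controlInput M η γ z k + z.1.2 k := by
  rw [nextState, state]
  rfl

lemma stateAt_zero (h : 0 < κ) (z : Sample m κ) : stateAt M η γ ⟨0, h⟩ z = z.1.1 := by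
  rw [stateAt, state]

lemma freeState_zero (h : 0 < κ) (b : Base m κ) : freeState M b ⟨0, h⟩ = b.1 := by
  rw [freeState, freeStateAux]

lemma freeState_succ {k : ℕ} (h : k + 1 < κ) (b : Base m κ) :
    freeState M b ⟨k + 1, h⟩
      = M.A *ᵥ freeState M b ⟨k, Nat.lt_of_succ_lt h⟩ + b.2 ⟨k, Nat.lt_of_succ_lt h⟩ := by
  rw [freeState, freeStateAux]
  rfl

/-- The part of the state that is caused by the inputs of the earlier stages. -/
def forcedState (u : Fin κ → Vec r) (k : Fin κ) : Vec m :=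
  ∑ l ∈ Finset.Iio k, (M.A ^ (k.val - l.val - 1) * M.B) *ᵥ u l

lemma forcedState_zero (h : 0 < κ) (u : Fin κ → Vec r) : forcedState M u ⟨0, h⟩ = 0 := by
  have : Finset.Iio (⟨0, h⟩ : Fin κ) = ∅ := by
    ext l
    simp [Fin.lt_def]
  rw [forcedState, this, Finset.sum_empty]

lemma Iio_fin_succ {k : ℕ} (h : k + 1 < κ) :
    Finset.Iio (⟨k + 1, h⟩ : Fin κ)
      = insert ⟨k, Nat.lt_of_succ_lt h⟩ (Finset.Iio ⟨k, Nat.lt_of_succ_lt h⟩) := by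
  ext l
  simp only [Finset.mem_Iio, Finset.mem_insert, Fin.lt_def, Fin.ext_iff]
  omega

lemma forcedState_succ {k : ℕ} (h : k + 1 < κ) (u : Fin κ → Vec r) :
    forcedState M u ⟨k + 1, h⟩
      = M.A *ᵥ forcedState M u ⟨k, Nat.lt_of_succ_lt h⟩ + M.B *ᵥ u ⟨k, Nat.lt_of_succ_lt h⟩ := by
  rw [forcedState, Iio_fin_succ, Finset.sum_insert (by simp), add_comm, forcedState,
    Matrix.mulVec_sum]
  congr 1
  · refine Finset.sum_congr rfl fun l hl => ?_
    have hl' : l.val < k := by simpa [Fin.lt_def] using hl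
    rw [Matrix.mulVec_mulVec, ← Matrix.mul_assoc, ← pow_succ']
    congr 3
    simp only
    omega
  · simp

/-- Superposition for the linear dynamics: both sides obey the same recursion and agree at the
initial time. -/
lemma stateAt_eq (k : Fin κ) (z : Sample m κ) :
    stateAt M η γ k z = freeState M z.1 k + forcedState M (controlInput M η γ z) k := by
  obtain ⟨k, hk⟩ := k
  induction k with
  | zero => rw [stateAt_zero, freeState_zero, forcedState_zero, add_zero]
  | succ k ih =>
    have h := nextState_eq M η γ z ⟨k, Nat.lt_of_succ_lt hk⟩
    rw [ih] at h
    rw [freeState_succ, forcedState_succ, show stateAt M η γ ⟨k + 1, hk⟩ z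
      = nextState M η γ z ⟨k, Nat.lt_of_succ_lt hk⟩ from rfl, h, Matrix.mulVec_add]
    abel

lemma measurable_freeState (k : Fin κ) : Measurable (fun b => freeState M b k) := by
  obtain ⟨k, hk⟩ := k
  induction k with
  | zero => simp only [freeState_zero]; exact measurable_fst
  | succ k ih =>
    simp only [freeState_succ]
    refine Measurable.add ?_ ((measurable_pi_apply _).comp measurable_snd)
    exact (Continuous.matrix_mulVec continuous_const continuous_id).measurable.comp (ih _)

/-- The signal that is seen when the input vanishes. -/
def openSignal (k : Fin κ) (z : Sample m κ) : Vec m :=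
  encode η k (fun i => freeState M z.1 ⟨i.val, (Nat.le_of_lt_succ i.isLt).trans_lt k.isLt⟩) (z.2 k)

/-- The history of the signals that are seen when the input vanishes. -/
def openHistory (k : Fin κ) (z : Sample m κ) (j : Fin (k.val + 1)) : Vec m :=
  openSignal M η ⟨j.val, (Nat.le_of_lt_succ j.isLt).trans_lt k.isLt⟩ z

/-- The information that the signals carry up to a stage. -/
abbrev openAlg (k : Fin κ) : MeasurableSpace (Sample m κ) :=
  MeasurableSpace.comap (openHistory M η k) inferInstance

/-- The correction involves forced states up to stage k, hence only inputs of stages strictly before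
k. The inductions on the information rest on this strictness. -/
lemma signal_eq (k : Fin κ) (z : Sample m κ) :
    signal M η γ z k = openSignal M η k z + ∑ j : Fin (k.val + 1), (η.gain k j)ᵀ *ᵥ
      forcedState M (controlInput M η γ z) ⟨j.val, (Nat.le_of_lt_succ j.isLt).trans_lt k.isLt⟩ := by
  have h : ∀ i : Fin (k.val + 1), state M η γ z i.val
      ((Nat.le_of_lt_succ i.isLt).trans k.isLt.le)
      = stateAt M η γ ⟨i.val, (Nat.le_of_lt_succ i.isLt).trans_lt k.isLt⟩ z := fun _ => rfl
  simp only [signal, openSignal, encode, h, stateAt_eq, Matrix.mulVec_add, Finset.sum_add_distrib]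
  abel

lemma measurable_mulVec {n p : ℕ} (A : Matrix (Fin n) (Fin p) ℝ) {S : Type*}
    {G : MeasurableSpace S} {X : S → Vec p} (hX : Measurable[G] X) :
    Measurable[G] (fun z => A *ᵥ X z) :=
  (Continuous.matrix_mulVec continuous_const continuous_id).measurable.comp hX

lemma measurable_forcedState {S : Type*} {G : MeasurableSpace S} {u : S → Fin κ → Vec r}
    {k : Fin κ} (hu : ∀ l < k, Measurable[G] fun z => u z l) :
    Measurable[G] (fun z => forcedState M (u z) k) := by
  unfold forcedState
  exact Finset.measurable_sum _ fun l hl => measurable_mulVec _ (hu l (Finset.mem_Iio.mp hl))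

lemma measurable_openSignal_openAlg {j k : Fin κ} (hjk : j ≤ k) :
    Measurable[openAlg M η k] (openSignal M η j) := by
  have h : Measurable[openAlg M η k] (openHistory M η k) := comap_measurable _
  exact (measurable_pi_apply (⟨j.val, Nat.lt_succ_of_le hjk⟩ : Fin (k.val + 1))).comp h

lemma openAlg_mono {j k : Fin κ} (hjk : j ≤ k) : openAlg M η j ≤ openAlg M η k := by
  refine measurable_iff_comap_le.mp ?_
  refine @measurable_pi_iff _ _ _ (openAlg M η k) _ _ |>.mpr fun i => ?_
  exact measurable_openSignal_openAlg M η
    (show (⟨i.val, _⟩ : Fin κ) ≤ k from (Nat.le_of_lt_succ i.isLt).trans hjk)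

lemma measurable_openSignal (k : Fin κ) : Measurable (openSignal M η k) := by
  unfold openSignal encode
  refine Measurable.add (Finset.measurable_sum _ fun j _ => measurable_mulVec _ ?_)
    ((measurable_pi_apply _).comp measurable_snd)
  exact (measurable_freeState M _).comp measurable_fst

lemma openAlg_le (k : Fin κ) : openAlg M η k ≤ (inferInstance : MeasurableSpace (Sample m κ)) :=
  measurable_iff_comap_le.mp (measurable_pi_iff.mpr fun _ => measurable_openSignal M η _)

lemma measurable_controlInput_of_signal {G : MeasurableSpace (Sample m κ)} {k : Fin κ}
    (h : ∀ j ≤ k, Measurable[G] fun z => signal M η γ z j) :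
    Measurable[G] (fun z => controlInput M η γ z k) := by
  refine (γ.measurable_act k).comp ?_
  exact @measurable_pi_iff _ _ _ G _ _ |>.mpr fun i => h _ (Nat.le_of_lt_succ i.isLt)

/-- Strong induction: the correction in `signal_eq` is a function of earlier inputs, which are
functions of earlier signals. -/
lemma measurable_signal_openAlg {j k : Fin κ} (hjk : j ≤ k) :
    Measurable[openAlg M η k] (fun z => signal M η γ z j) := by
  induction j using WellFoundedLT.induction with
  | ind j ih =>
    simp only [signal_eq]
    refine (measurable_openSignal_openAlg M η hjk).add ?_
    refine Finset.measurable_sum _ fun i _ => measurable_mulVec _ (measurable_forcedState M ?_)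
    intro l hl
    have hlj : l < j := lt_of_lt_of_le hl (Nat.le_of_lt_succ i.isLt)
    exact measurable_controlInput_of_signal M η γ fun i hi =>
      ih i (hi.trans_lt hlj) ((hi.trans hlj.le).trans hjk)

lemma measurable_controlInput_openAlg {j k : Fin κ} (hjk : j ≤ k) :
    Measurable[openAlg M η k] (fun z => controlInput M η γ z j) :=
  measurable_controlInput_of_signal M η γ fun _ hi =>
    measurable_signal_openAlg M η γ (hi.trans hjk)

/-- No dual effect: the policy is known, so past inputs can be computed from the observed signals
and their contribution removed, and conversely added back. Whatever is conditioned on the signals is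
thereby independent of the policy. -/
lemma comap_signalHistory (k : Fin κ) :
    MeasurableSpace.comap (signalHistory M η γ k) inferInstance = openAlg M η k := by
  refine le_antisymm (measurable_iff_comap_le.mp ?_) (measurable_iff_comap_le.mp ?_)
  · exact @measurable_pi_iff _ _ _ (openAlg M η k) _ _ |>.mpr fun i =>
      measurable_signal_openAlg M η γ (Nat.le_of_lt_succ i.isLt)
  · set G := MeasurableSpace.comap (signalHistory M η γ k) inferInstance with hG
    have hs : ∀ j ≤ k, Measurable[G] fun z => signal M η γ z j := fun j hj =>
      (measurable_pi_apply (⟨j.val, Nat.lt_succ_of_le hj⟩ : Fin (k.val + 1))).comp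
        (comap_measurable (signalHistory M η γ k))
    have ho : ∀ j ≤ k, Measurable[G] (openSignal M η j) := by
      intro j hj
      have : openSignal M η j = fun z => signal M η γ z j - ∑ i : Fin (j.val + 1),
          (η.gain j i)ᵀ *ᵥ forcedState M (controlInput M η γ z)
            ⟨i.val, (Nat.le_of_lt_succ i.isLt).trans_lt j.isLt⟩ := by
        funext z
        rw [signal_eq, add_sub_cancel_right]
      rw [this]
      refine (hs j hj).sub ?_
      refine Finset.measurable_sum _ fun i _ => measurable_mulVec _ (measurable_forcedState M ?_)
      intro l hl
      have hlk : l ≤ k := (lt_of_lt_of_le hl (Nat.le_of_lt_succ i.isLt)).le.trans hj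
      exact measurable_controlInput_of_signal M η γ fun i hi => hs i (hi.trans hlk)
    exact @measurable_pi_iff _ _ _ G _ _ |>.mpr fun i => ho _ (Nat.le_of_lt_succ i.isLt)

/-- Change of the signs of the initial state and of the noises. -/
def changeSigns (a : ℝ) (b c : Fin κ → ℝ) (z : Sample m κ) : Sample m κ :=
  ((a • z.1.1, fun k => b k • z.1.2 k), fun k => c k • z.2 k)

/-- The law is a product of Gaussians, each of which is symmetric. -/
lemma measurePreserving_changeSigns {a : ℝ} {b c : Fin κ → ℝ} (ha : a = 1 ∨ a = -1)
    (hb : ∀ k, b k = 1 ∨ b k = -1) (hc : ∀ k, c k = 1 ∨ c k = -1) :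
    MeasurePreserving (changeSigns (m := m) a b c) (law M η) (law M η) := by
  have key : ∀ (S : Mat m) (a : ℝ), a = 1 ∨ a = -1 →
      MeasurePreserving (fun x : Vec m => a • x) (gaussian S) (gaussian S) := by
    rintro S a (rfl | rfl)
    · simp only [one_smul]
      exact MeasurePreserving.id (gaussian S)
    · simpa using measurePreserving_neg_gaussian S
  exact ((key _ a ha).prod (measurePreserving_pi _ _ fun k => key _ _ (hb k))).prod
    (measurePreserving_pi _ _ fun k => key _ _ (hc k))

lemma measurePreserving_base :
    MeasurePreserving (fun z : Sample m κ => z.1) (law M η) (baseLaw M) :=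
  measurePreserving_fst

lemma measurePreserving_initial :
    MeasurePreserving (fun z : Sample m κ => z.1.1) (law M η) (gaussian M.covInit) :=
  (measurePreserving_fst (μ := gaussian M.covInit)
    (ν := Measure.pi fun _ : Fin κ => gaussian M.covNoise)).comp (measurePreserving_base M η)

lemma measurePreserving_stateNoise (k : Fin κ) :
    MeasurePreserving (fun z : Sample m κ => z.1.2 k) (law M η) (gaussian M.covNoise) :=
  ((measurePreserving_eval (fun _ : Fin κ => gaussian M.covNoise) k).comp
    (measurePreserving_snd (μ := gaussian M.covInit))).comp (measurePreserving_base M η)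

lemma measurePreserving_signalNoise (k : Fin κ) :
    MeasurePreserving (fun z : Sample m κ => z.2 k) (law M η) (gaussian (η.noiseCov k)) :=
  (measurePreserving_eval (fun k : Fin κ => gaussian (η.noiseCov k)) k).comp
    (measurePreserving_snd (μ := baseLaw M))

end process

/-! ### Transport of second moments along measure preserving maps -/

section moments

variable {S T : Type*} [MeasurableSpace S] [MeasurableSpace T] {P : Measure S} {Q : Measure T}
  {ι ι' : Type*}

lemma SquareIntegrable.comp_measurePreserving {f : S → T} (hf : MeasurePreserving f P Q)
    {X : T → ι → ℝ} (hX : SquareIntegrable Q X) : SquareIntegrable P (fun z => X (f z)) :=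
  fun i => (hX i).comp_measurePreserving hf

lemma crossMoment_comp_measurePreserving {f : S → T} (hf : MeasurePreserving f P Q)
    {X : T → ι → ℝ} {Y : T → ι' → ℝ} (hX : SquareIntegrable Q X) (hY : SquareIntegrable Q Y) :
    crossMoment P (fun z => X (f z)) (fun z => Y (f z)) = crossMoment Q X Y := by
  ext i j
  simp only [crossMoment_apply]
  rw [← hf.map_eq, integral_map hf.measurable.aemeasurable]
  rw [hf.map_eq]
  exact (hX.integrable_mul hY i j).aestronglyMeasurable

end moments

/-! ### Second moments of states, noises and posteriors; feasibility of the posterior covariances -/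

section processMoments

variable {m r κ : ℕ} {Ω : Type*} (M : Model m r κ Ω) (η : SignalRule m κ)
  (γ : ControlPolicy m r κ)

lemma squareIntegrable_initial : SquareIntegrable (law M η) (fun z => z.1.1) :=
  (squareIntegrable_gaussian _).comp_measurePreserving (measurePreserving_initial M η)

lemma squareIntegrable_stateNoise (k : Fin κ) :
    SquareIntegrable (law M η) (fun z => z.1.2 k) :=
  (squareIntegrable_gaussian _).comp_measurePreserving (measurePreserving_stateNoise M η k)

lemma squareIntegrable_signalNoise (k : Fin κ) : SquareIntegrable (law M η) (fun z => z.2 k) :=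
  (squareIntegrable_gaussian _).comp_measurePreserving (measurePreserving_signalNoise M η k)

lemma crossMoment_initial :
    crossMoment (law M η) (fun z => z.1.1) (fun z => z.1.1) = M.covInit :=
  (crossMoment_comp_measurePreserving (measurePreserving_initial M η)
    (squareIntegrable_gaussian _) (squareIntegrable_gaussian _)).trans
    (crossMoment_gaussian M.covInit_posSemidef)

lemma crossMoment_stateNoise (k : Fin κ) :
    crossMoment (law M η) (fun z => z.1.2 k) (fun z => z.1.2 k) = M.covNoise :=
  (crossMoment_comp_measurePreserving (measurePreserving_stateNoise M η k)
    (squareIntegrable_gaussian _) (squareIntegrable_gaussian _)).trans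
    (crossMoment_gaussian M.covNoise_posSemidef)

lemma crossMoment_signalNoise (k : Fin κ) :
    crossMoment (law M η) (fun z => z.2 k) (fun z => z.2 k) = η.noiseCov k :=
  (crossMoment_comp_measurePreserving (measurePreserving_signalNoise M η k)
    (squareIntegrable_gaussian _) (squareIntegrable_gaussian _)).trans
    (crossMoment_gaussian (η.noiseCov_posSemidef k))

lemma squareIntegrable_freeState (k : Fin κ) :
    SquareIntegrable (law M η) (fun z => freeState M z.1 k) := by
  obtain ⟨k, hk⟩ := k
  induction k with
  | zero => simp only [freeState_zero]; exact squareIntegrable_initial M η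
  | succ k ih =>
    simp only [freeState_succ]
    exact ((ih _).mulVec M.A).add (squareIntegrable_stateNoise M η _)

lemma squareIntegrable_openSignal (k : Fin κ) :
    SquareIntegrable (law M η) (openSignal M η k) := by
  unfold openSignal encode
  exact (SquareIntegrable.sum fun j _ => (squareIntegrable_freeState M η _).mulVec _).add
    (squareIntegrable_signalNoise M η k)

lemma freeCov_eq (k : Fin κ) :
    freeCov M k = crossMoment (law M η) (fun z => freeState M z.1 k)
      (fun z => freeState M z.1 k) := by
  ext i j
  simp only [freeCov, Matrix.of_apply, crossMoment_apply]
  rw [← (measurePreserving_base M η).map_eq, integral_map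
    (measurePreserving_base M η).measurable.aemeasurable]
  have h := measurable_pi_iff.mp (measurable_freeState M k)
  exact ((h i).mul (h j)).aestronglyMeasurable

/-- The augmented control-free state. -/
def bigFree (z : Sample m κ) (a : Fin κ × Fin m) : ℝ := freeState M z.1 a.1 a.2

lemma bigSigma_eq :
    bigSigma M = crossMoment (law M η) (bigFree M) (bigFree M) := by
  ext a b
  simp only [bigSigma, Matrix.of_apply, crossMoment_apply, bigFree]
  rw [← (measurePreserving_base M η).map_eq, integral_map
    (measurePreserving_base M η).measurable.aemeasurable]
  have h := fun k => measurable_pi_iff.mp (measurable_freeState M k)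
  exact ((h a.1 a.2).mul (h b.1 b.2)).aestronglyMeasurable

/-- Reversal of the state noise of one stage. -/
def flipStateNoise (k : Fin κ) : Sample m κ → Sample m κ :=
  changeSigns 1 (fun j => if j = k then -1 else 1) 1

/-- Reversal of the signal noise of one stage. -/
def flipSignalNoise (k : Fin κ) : Sample m κ → Sample m κ :=
  changeSigns 1 1 (fun j => if j = k then -1 else 1)

lemma measurePreserving_flipStateNoise (k : Fin κ) :
    MeasurePreserving (flipStateNoise (m := m) k) (law M η) (law M η) :=
  measurePreserving_changeSigns M η (Or.inl rfl) (fun j => by split <;> simp) (fun _ => Or.inl rfl)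

lemma measurePreserving_flipSignalNoise (k : Fin κ) :
    MeasurePreserving (flipSignalNoise (m := m) k) (law M η) (law M η) :=
  measurePreserving_changeSigns M η (Or.inl rfl) (fun _ => Or.inl rfl) (fun j => by split <;> simp)

/-- The control-free state of stage j contains only state noises of stages before j, so j = k is
allowed. -/
lemma freeState_flipStateNoise {j k : Fin κ} (hjk : j ≤ k) (z : Sample m κ) :
    freeState M (flipStateNoise k z).1 j = freeState M z.1 j := by
  obtain ⟨j, hj⟩ := j
  induction j with
  | zero => simp [freeState_zero, flipStateNoise, changeSigns]
  | succ j ih =>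
    rw [freeState_succ, freeState_succ, ih (Nat.lt_of_succ_lt hj) ((Nat.le_succ j).trans hjk)]
    have : (⟨j, Nat.lt_of_succ_lt hj⟩ : Fin κ) ≠ k := fun h => by
      rw [← h] at hjk
      exact absurd (Fin.le_def.mp hjk) (by simp)
    simp [flipStateNoise, changeSigns, this]

lemma freeState_flipSignalNoise (j k : Fin κ) (z : Sample m κ) :
    freeState M (flipSignalNoise k z).1 j = freeState M z.1 j := by
  have : (flipSignalNoise k z).1 = z.1 := by simp [flipSignalNoise, changeSigns]
  rw [this]

lemma openSignal_flipStateNoise {j k : Fin κ} (hjk : j ≤ k) (z : Sample m κ) :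
    openSignal M η j (flipStateNoise k z) = openSignal M η j z := by
  unfold openSignal encode
  congr 1
  · refine Finset.sum_congr rfl fun i _ => ?_
    simp only
    rw [freeState_flipStateNoise]
    exact (show (⟨i.val, _⟩ : Fin κ) ≤ j from Nat.le_of_lt_succ i.isLt).trans hjk
  · simp [flipStateNoise, changeSigns]

/-- Here the inequality must be strict, since the signal of stage k contains the reflected noise
itself. -/
lemma openSignal_flipSignalNoise {j k : Fin κ} (hjk : j < k) (z : Sample m κ) :
    openSignal M η j (flipSignalNoise k z) = openSignal M η j z := by
  unfold openSignal encode
  congr 1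
  · exact Finset.sum_congr rfl fun i _ => by simp only [freeState_flipSignalNoise]
  · simp [flipSignalNoise, changeSigns, hjk.ne]

/-- A vector measurable for a pulled-back σ-algebra is constant on the fibers of the history.
Invariance of the signals under a reflection thus passes to every observable vector. -/
lemma eq_of_measurable_openAlg {k : Fin κ} {T : Type*} [MeasurableSpace T]
    [MeasurableSingletonClass T] {Y : Sample m κ → T} (hY : Measurable[openAlg M η k] Y)
    {z z' : Sample m κ} (h : ∀ j ≤ k, openSignal M η j z = openSignal M η j z') : Y z = Y z' :=
  hY.factorsThrough (funext fun i => h _ (Nat.le_of_lt_succ i.isLt))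

lemma stateNoise_flip (k : Fin κ) (z : Sample m κ) :
    (flipStateNoise k z).1.2 k = - z.1.2 k := by simp [flipStateNoise, changeSigns]

lemma signalNoise_flip (k : Fin κ) (z : Sample m κ) :
    (flipSignalNoise k z).2 k = - z.2 k := by simp [flipSignalNoise, changeSigns]

lemma crossMoment_stateNoise_freeState {j k : Fin κ} (hjk : j ≤ k) :
    crossMoment (law M η) (fun z => z.1.2 k) (fun z => freeState M z.1 j) = 0 :=
  crossMoment_eq_zero_of_flip (measurePreserving_flipStateNoise M η k)
    (squareIntegrable_stateNoise M η k) (squareIntegrable_freeState M η j) (stateNoise_flip k)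
    (freeState_flipStateNoise M hjk)

lemma crossMoment_stateNoise_openAlg {ι : Type*} [Countable ι] {k : Fin κ}
    {Y : Sample m κ → ι → ℝ}
    (hY : SquareIntegrable (law M η) Y) (hYm : Measurable[openAlg M η k] Y) :
    crossMoment (law M η) (fun z => z.1.2 k) Y = 0 :=
  crossMoment_eq_zero_of_flip (measurePreserving_flipStateNoise M η k)
    (squareIntegrable_stateNoise M η k) hY (stateNoise_flip k)
    fun z => eq_of_measurable_openAlg M η hYm fun _ hj => openSignal_flipStateNoise M η hj z

lemma crossMoment_signalNoise_freeState (j k : Fin κ) :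
    crossMoment (law M η) (fun z => z.2 k) (fun z => freeState M z.1 j) = 0 :=
  crossMoment_eq_zero_of_flip (measurePreserving_flipSignalNoise M η k)
    (squareIntegrable_signalNoise M η k) (squareIntegrable_freeState M η j) (signalNoise_flip k)
    (freeState_flipSignalNoise M j k)

lemma crossMoment_signalNoise_openAlg {ι : Type*} [Countable ι] {j k : Fin κ} (hjk : j < k)
    {Y : Sample m κ → ι → ℝ}
    (hY : SquareIntegrable (law M η) Y) (hYm : Measurable[openAlg M η j] Y) :
    crossMoment (law M η) (fun z => z.2 k) Y = 0 :=
  crossMoment_eq_zero_of_flip (measurePreserving_flipSignalNoise M η k)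
    (squareIntegrable_signalNoise M η k) hY (signalNoise_flip k)
    fun z => eq_of_measurable_openAlg M η hYm fun _ hi =>
      openSignal_flipSignalNoise M η (hi.trans_lt hjk) z

lemma freeState_neg (k : Fin κ) (b : Base m κ) : freeState M (-b) k = - freeState M b k := by
  obtain ⟨k, hk⟩ := k
  induction k with
  | zero => simp [freeState_zero]
  | succ k ih =>
    rw [freeState_succ, freeState_succ, ih, Matrix.mulVec_neg]
    simp [neg_add_rev, add_comm]

lemma integral_freeState (k : Fin κ) (i : Fin m) : ∫ z, freeState M z.1 k i ∂(law M η) = 0 := by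
  have hsq := squareIntegrable_freeState M η k
  -- The mean is the cross moment with the constant 1; all signs are reversed at once.
  have h := crossMoment_eq_zero_of_flip (P := law M η) (X := fun z => freeState M z.1 k)
    (Y := fun (_ : Sample m κ) (_ : Unit) => (1 : ℝ))
    (measurePreserving_changeSigns M η (a := -1) (b := -1) (c := -1) (Or.inr rfl)
      (fun _ => Or.inr rfl) (fun _ => Or.inr rfl))
    hsq (fun _ => memLp_const _)
    (fun z => by
      rw [← freeState_neg]
      congr 1
      ext <;> simp [changeSigns])
    (fun _ => rfl)
  have := congrFun (congrFun h i) ()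
  simpa [crossMoment_apply] using this

/-- The posterior of the control-free state. -/
def estimate (k : Fin κ) : Sample m κ → Vec m :=
  condVec (law M η) (openAlg M η k) (fun z => freeState M z.1 k)

lemma posterior_eq (k : Fin κ) (i : Fin m) :
    posterior M η γ k i = fun z => estimate M η k z i := by
  rw [posterior, comap_signalHistory]
  rfl

lemma squareIntegrable_estimate (k : Fin κ) : SquareIntegrable (law M η) (estimate M η k) :=
  squareIntegrable_condVec _ (squareIntegrable_freeState M η k)

lemma measurable_estimate {j k : Fin κ} (hjk : j ≤ k) :
    Measurable[openAlg M η k] (estimate M η j) :=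
  (measurable_condVec (openAlg M η j) _).mono (openAlg_mono M η hjk) le_rfl

lemma integral_estimate (k : Fin κ) (i : Fin m) : ∫ z, estimate M η k z i ∂(law M η) = 0 := by
  rw [← integral_freeState M η k i]
  exact integral_condExp (openAlg_le M η k)

lemma posteriorCov_eq (k : Fin κ) :
    posteriorCov M η γ k = crossMoment (law M η) (estimate M η k) (estimate M η k) := by
  ext i j
  have h := squareIntegrable_estimate M η k
  simp only [posteriorCov, Matrix.of_apply, posterior_eq, crossMoment_apply]
  rw [covariance_eq_sub (h i) (h j), integral_estimate]
  simp

/-- Observable random vectors are correlated with the control-free state in the same way as with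
its posterior. -/
lemma crossMoment_estimate_left {ι : Type*} {k : Fin κ} {Y : Sample m κ → ι → ℝ}
    (hY : SquareIntegrable (law M η) Y) (hYm : Measurable[openAlg M η k] Y) :
    crossMoment (law M η) (estimate M η k) Y
      = crossMoment (law M η) (fun z => freeState M z.1 k) Y :=
  crossMoment_condVec_left (openAlg_le M η k) (squareIntegrable_freeState M η k) hY hYm

/-- The error of the posterior is uncorrelated with every observable random vector. -/
lemma crossMoment_estimateError {ι : Type*} {k : Fin κ} {Y : Sample m κ → ι → ℝ}
    (hY : SquareIntegrable (law M η) Y) (hYm : Measurable[openAlg M η k] Y) :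
    crossMoment (law M η) (fun z => freeState M z.1 k - estimate M η k z) Y = 0 :=
  crossMoment_sub_condVec (openAlg_le M η k) (squareIntegrable_freeState M η k) hY hYm

/-- The prediction error of the next control-free state is uncorrelated with every random vector
that is observable at the present stage. -/
lemma crossMoment_freeState_succ {ι : Type*} [Countable ι] {k : ℕ} (hk : k + 1 < κ)
    {Y : Sample m κ → ι → ℝ} (hY : SquareIntegrable (law M η) Y)
    (hYm : Measurable[openAlg M η ⟨k, Nat.lt_of_succ_lt hk⟩] Y) :
    crossMoment (law M η) (fun z => freeState M z.1 ⟨k + 1, hk⟩) Y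
      = M.A * crossMoment (law M η) (estimate M η ⟨k, Nat.lt_of_succ_lt hk⟩) Y := by
  simp only [freeState_succ]
  rw [crossMoment_add_left ((squareIntegrable_freeState M η _).mulVec M.A)
    (squareIntegrable_stateNoise M η _) hY,
    crossMoment_stateNoise_openAlg M η hY hYm, add_zero,
    crossMoment_mulVec_left (squareIntegrable_freeState M η _) hY,
    crossMoment_estimate_left M η hY hYm]

/-- The posterior at l may be replaced by the control-free state, whose dynamics is then run back to
stage k; the noises entering in between are uncorrelated with what is observed up to k. All cross
covariances are thereby determined by the H_k. -/
lemma crossMoment_estimate_of_le {k l : Fin κ} (hkl : k ≤ l) :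
    crossMoment (law M η) (estimate M η l) (estimate M η k)
      = M.A ^ (l.val - k.val) * crossMoment (law M η) (estimate M η k) (estimate M η k) := by
  obtain ⟨l, hl⟩ := l
  have hk := squareIntegrable_estimate M η k
  induction l with
  | zero =>
    have : k = ⟨0, hl⟩ := le_antisymm hkl (Nat.zero_le _)
    subst this
    simp
  | succ l ih =>
    rcases eq_or_lt_of_le hkl with h | h
    · subst h
      simp
    · have hkl' : k ≤ ⟨l, Nat.lt_of_succ_lt hl⟩ := Nat.le_of_lt_succ h
      rw [crossMoment_estimate_left M η hk (measurable_estimate M η hkl),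
        crossMoment_freeState_succ M η hl hk (measurable_estimate M η hkl'), ih _ hkl',
        ← Matrix.mul_assoc, ← pow_succ']
      congr 2
      have : k.val ≤ l := hkl'
      simp only
      omega

/-- Each constraint exhibits a matrix as a second moment: of the posterior, of the estimation error,
and of the innovation x̂_k - A x̂_{k-1}, where orthogonality removes the mixed terms. -/
theorem posteriorCov_mem_feasible : posteriorCov M η γ ∈ Feasible M := by
  intro k
  have hx := squareIntegrable_freeState M η k
  have hk := squareIntegrable_estimate M η k
  have hxk := crossMoment_estimate_left M η hk (measurable_estimate M η le_rfl)
  have hxk' : crossMoment (law M η) (estimate M η k) (fun z => freeState M z.1 k)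
      = crossMoment (law M η) (estimate M η k) (estimate M η k) := by
    rw [← crossMoment_transpose (fun z : Sample m κ => freeState M z.1 k), ← hxk,
      crossMoment_transpose]
  refine ⟨?_, ?_, ?_⟩
  · rw [posteriorCov_eq]
    exact crossMoment_self_posSemidef hk
  · have h : freeCov M k - posteriorCov M η γ k
        = crossMoment (law M η) (fun z => freeState M z.1 k - estimate M η k z)
          (fun z => freeState M z.1 k - estimate M η k z) := by
      rw [crossMoment_sub_right (hx.sub hk) hx hk,
        crossMoment_estimateError M η hk (measurable_estimate M η le_rfl), sub_zero,
        crossMoment_sub_left hx hk hx, freeCov_eq M η, posteriorCov_eq, hxk']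
    rw [h]
    exact crossMoment_self_posSemidef (hx.sub hk)
  · rw [predicted]
    split_ifs with h0
    · rw [sub_zero, posteriorCov_eq]
      exact crossMoment_self_posSemidef hk
    · obtain ⟨k, hκ⟩ := k
      obtain ⟨k, rfl⟩ := Nat.exists_eq_succ_of_ne_zero h0
      set j : Fin κ := ⟨k, Nat.lt_of_succ_lt hκ⟩
      have hj := squareIntegrable_estimate M η j
      have hjk : j ≤ ⟨k + 1, hκ⟩ := Nat.le_succ k
      have h1 := crossMoment_estimate_of_le M η hjk
      have h2 : k + 1 - k = 1 := by omega
      simp only [j, h2, pow_one] at h1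
      have h : posteriorCov M η γ ⟨k + 1, hκ⟩ - M.A * posteriorCov M η γ j * M.Aᵀ
        = crossMoment (law M η) (fun z => estimate M η ⟨k + 1, hκ⟩ z - M.A *ᵥ estimate M η j z)
          (fun z => estimate M η ⟨k + 1, hκ⟩ z - M.A *ᵥ estimate M η j z) := by
        rw [crossMoment_sub_right (hk.sub (hj.mulVec _)) hk (hj.mulVec _),
          crossMoment_sub_left hk (hj.mulVec _) hk,
          crossMoment_sub_left hk (hj.mulVec _) (hj.mulVec _),
          crossMoment_mulVec_self hj, crossMoment_mulVec_right hk hj,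
          crossMoment_mulVec_left hj hk, h1, sub_self, sub_zero, posteriorCov_eq, posteriorCov_eq,
          ← crossMoment_transpose (estimate M η ⟨k + 1, hκ⟩) (estimate M η j), h1,
          Matrix.transpose_mul, crossMoment_transpose, Matrix.mul_assoc]
      simp only [Nat.succ_eq_add_one, Nat.add_sub_cancel]
      rw [h]
      exact crossMoment_self_posSemidef (hk.sub (hj.mulVec _))

end processMoments

/-! ### Riccati recursion and the algebra of completing the square -/

section riccati

variable {m r κ : ℕ} {Ω : Type*} (M : Model m r κ Ω) (ω : Option Ω)

lemma posDef_quad_add {n p : ℕ} {P : Mat n} (hP : P.PosSemidef) (B : Matrix (Fin n) (Fin p) ℝ)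
    {R : Mat p} (hR : R.PosDef) : (Bᵀ * P * B + R).PosDef := by
  have := hP.conjTranspose_mul_mul_same B
  rw [Matrix.conjTranspose_eq_transpose_of_trivial] at this
  exact Matrix.PosDef.posSemidef_add this hR

lemma PosSemidef.transpose_eq {n : ℕ} {P : Mat n} (hP : P.PosSemidef) : Pᵀ = P := by
  rw [← Matrix.conjTranspose_eq_transpose_of_trivial]
  exact hP.isHermitian

lemma PosDef.mul_inv_self {n : ℕ} {P : Mat n} (hP : P.PosDef) : P * P⁻¹ = 1 :=
  Matrix.mul_nonsing_inv P ((Matrix.isUnit_iff_isUnit_det P).mp hP.isUnit)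

/-- With the optimal gain F the expression equals (1 - BF)'P(1 - BF) + F'RF, a sum of congruences of
positive semidefinite matrices. -/
lemma posSemidef_riccati_step {n p : ℕ} {P : Mat n} (hP : P.PosSemidef)
    (B : Matrix (Fin n) (Fin p) ℝ) {R : Mat p} (hR : R.PosDef) :
    (P - P * B * (Bᵀ * P * B + R)⁻¹ * Bᵀ * P).PosSemidef := by
  set D := Bᵀ * P * B + R with hD
  have hDp : D.PosDef := posDef_quad_add hP B hR
  set F := D⁻¹ * Bᵀ * P with hF
  have hDF : D * F = Bᵀ * P := by
    rw [hF, ← Matrix.mul_assoc, ← Matrix.mul_assoc, PosDef.mul_inv_self hDp, Matrix.one_mul]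
  have key : P - P * B * D⁻¹ * Bᵀ * P = (1 - B * F)ᵀ * P * (1 - B * F) + Fᵀ * R * F := by
    have h1 : P * B * D⁻¹ * Bᵀ * P = P * B * F := by simp only [hF, Matrix.mul_assoc]
    have h2 : Fᵀ * (Bᵀ * P * B) * F + Fᵀ * R * F = Fᵀ * (Bᵀ * P) := by
      rw [← Matrix.add_mul, ← Matrix.mul_add, ← hD, Matrix.mul_assoc, hDF]
    have h3 : (1 - B * F)ᵀ * P * (1 - B * F)
        = P - P * B * F - Fᵀ * (Bᵀ * P) + Fᵀ * (Bᵀ * P * B) * F := by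
      rw [Matrix.transpose_sub, Matrix.transpose_one, Matrix.transpose_mul]
      simp only [Matrix.sub_mul, Matrix.mul_sub, Matrix.one_mul, Matrix.mul_one, Matrix.mul_assoc]
      abel
    rw [h1, h3, add_assoc, h2]
    abel
  rw [key]
  have h1 := hP.conjTranspose_mul_mul_same (1 - B * F)
  have h2 := hR.posSemidef.conjTranspose_mul_mul_same F
  rw [Matrix.conjTranspose_eq_transpose_of_trivial] at h1 h2
  exact h1.add h2

lemma posSemidef_riccatiAux (j : ℕ) : (riccatiAux M ω j).PosSemidef := by
  induction j with
  | zero => exact M.Q_posSemidef ω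
  | succ j ih =>
    rw [riccatiAux]
    have h := (posSemidef_riccati_step ih M.B (M.R_posDef ω)).conjTranspose_mul_mul_same M.A
    rw [Matrix.conjTranspose_eq_transpose_of_trivial] at h
    exact (M.Q_posSemidef ω).add h

lemma posSemidef_riccati (k : ℕ) : (riccati M ω k).PosSemidef := posSemidef_riccatiAux M ω _

lemma riccati_last : riccati M ω κ = M.Q ω := by
  rw [riccati, Nat.sub_self, riccatiAux]

lemma posDef_delta (k : Fin κ) : (delta M ω k).PosDef :=
  posDef_quad_add (posSemidef_riccati M ω _) M.B (M.R_posDef ω)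

lemma delta_mul_feedback (k : Fin κ) :
    delta M ω k * feedback M ω k = M.Bᵀ * riccati M ω (k.val + 1) * M.A := by
  rw [feedback]
  simp only [← Matrix.mul_assoc]
  rw [PosDef.mul_inv_self (posDef_delta M ω k), Matrix.one_mul]

/-- One Riccati step in the form that remains after the square u + Kx has been split off. -/
lemma riccati_sub (k : Fin κ) :
    riccati M ω k.val - M.Q ω = M.Aᵀ * riccati M ω (k.val + 1) * M.A
      - (feedback M ω k)ᵀ * delta M ω k * feedback M ω k := by
  -- The truncated subtraction is exact because k < κ; it exposes the successor case of the backward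
  -- recursion.
  have hk : κ - k.val = (κ - (k.val + 1)) + 1 := by omega
  have hPt := PosSemidef.transpose_eq (posSemidef_riccati M ω (k.val + 1))
  have hDt := PosSemidef.transpose_eq (posDef_delta M ω k).posSemidef
  have h1 : riccati M ω k.val = M.Q ω + M.Aᵀ * (riccati M ω (k.val + 1)
      - riccati M ω (k.val + 1) * M.B * (delta M ω k)⁻¹ * M.Bᵀ * riccati M ω (k.val + 1))
        * M.A := by
    rw [riccati, hk, riccatiAux]
    rfl
  rw [h1, Matrix.mul_assoc _ (delta M ω k), delta_mul_feedback, feedback]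
  simp only [Matrix.transpose_mul, Matrix.transpose_nonsing_inv, hPt, hDt,
    Matrix.transpose_transpose, Matrix.mul_sub, Matrix.sub_mul, Matrix.mul_assoc]
  abel

/-- This is ‖Ax + Bu‖²_P + ‖u‖²_R = ‖x‖² with weight A'PA - K'DK, plus ‖u + Kx‖²_D, at the level of
second moments: X, N, U play the roles of E xx', E xu', E uu'. -/
lemma trace_completion {n p : ℕ} {P : Mat n} (hP : Pᵀ = P) (A : Mat n)
    (B : Matrix (Fin n) (Fin p) ℝ) (R : Mat p) {D : Mat p} (hD : D = Bᵀ * P * B + R) (hDt : Dᵀ = D)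
    {K : Matrix (Fin p) (Fin n) ℝ} (hK : D * K = Bᵀ * P * A) (X : Mat n) (N : Matrix (Fin n) (Fin p) ℝ)
    (U : Mat p) :
    (P * (A * X * Aᵀ + A * N * Bᵀ + B * Nᵀ * Aᵀ + B * U * Bᵀ)).trace + (R * U).trace
      = ((Aᵀ * P * A - Kᵀ * D * K) * X).trace
        + (D * (U + Nᵀ * Kᵀ + K * N + K * X * Kᵀ)).trace := by
  have hKN : (P * (A * N * Bᵀ)).trace = (D * (K * N)).trace := by
    rw [← Matrix.mul_assoc D, hK, ← Matrix.mul_assoc P, Matrix.trace_mul_comm]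
    simp only [Matrix.mul_assoc]
  have hKN' : (D * (Nᵀ * Kᵀ)).trace = (D * (K * N)).trace := by
    rw [← Matrix.trace_transpose]
    simp only [Matrix.transpose_mul, Matrix.transpose_transpose, hDt]
    rw [Matrix.trace_mul_comm]
  have hPN : (P * (B * Nᵀ * Aᵀ)).trace = (P * (A * N * Bᵀ)).trace := by
    rw [← Matrix.trace_transpose]
    simp only [Matrix.transpose_mul, Matrix.transpose_transpose, hP]
    rw [Matrix.trace_mul_comm]
    simp only [Matrix.mul_assoc]
  have hX : (P * (A * X * Aᵀ)).trace = (Aᵀ * P * A * X).trace := by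
    rw [← Matrix.mul_assoc P, Matrix.trace_mul_comm]
    simp only [Matrix.mul_assoc]
  have hX' : (D * (K * X * Kᵀ)).trace = (Kᵀ * D * K * X).trace := by
    rw [← Matrix.mul_assoc D, Matrix.trace_mul_comm]
    simp only [Matrix.mul_assoc]
  have hU : (P * (B * U * Bᵀ)).trace + (R * U).trace = (D * U).trace := by
    rw [hD, Matrix.add_mul, Matrix.trace_add, ← Matrix.mul_assoc P, Matrix.trace_mul_comm]
    simp only [Matrix.mul_assoc]
  simp only [Matrix.mul_add, Matrix.sub_mul, Matrix.trace_add, Matrix.trace_sub, hX, hX', hPN, hKN,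
    hKN', ← hU]
  ring

end riccati

/-! ### Cost of a follower, and characterization of best responses -/

section cost

variable {m r κ : ℕ} {Ω : Type*} (M : Model m r κ Ω) (ω : Option Ω) (η : SignalRule m κ)
  (γ : ControlPolicy m r κ)

/-- All inputs are square integrable. -/
def FiniteEnergy : Prop :=
  ∀ k, SquareIntegrable (law M η) (fun z => controlInput M η γ z k)

/-- The estimation error of the control-free state. -/
def estimateError (k : Fin κ) (z : Sample m κ) : Vec m :=
  freeState M z.1 k - estimate M η k z

/-- The deviation of the input from the certainty-equivalent linear feedback. -/
def deviation (k : Fin κ) (z : Sample m κ) : Vec r :=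
  controlInput M η γ z k + feedback M ω k *ᵥ
    (estimate M η k z + forcedState M (controlInput M η γ z) k)

lemma measurable_forcedState_openAlg (k : Fin κ) :
    Measurable[openAlg M η k] (fun z => forcedState M (controlInput M η γ z) k) :=
  measurable_forcedState M fun _ hl => measurable_controlInput_openAlg M η γ hl.le

lemma measurable_deviation (k : Fin κ) : Measurable[openAlg M η k] (deviation M ω η γ k) :=
  (measurable_controlInput_openAlg M η γ le_rfl).add (measurable_mulVec _
    ((measurable_estimate M η le_rfl).add (measurable_forcedState_openAlg M η γ k)))

lemma squareIntegrable_estimateError (k : Fin κ) :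
    SquareIntegrable (law M η) (estimateError M η k) :=
  (squareIntegrable_freeState M η k).sub (squareIntegrable_estimate M η k)

variable {M η γ}

lemma FiniteEnergy.squareIntegrable_forcedState (h : FiniteEnergy M η γ) (k : Fin κ) :
    SquareIntegrable (law M η) (fun z => forcedState M (controlInput M η γ z) k) :=
  SquareIntegrable.sum fun l _ => (h l).mulVec _

lemma FiniteEnergy.squareIntegrable_stateAt (h : FiniteEnergy M η γ) (k : Fin κ) :
    SquareIntegrable (law M η) (stateAt M η γ k) := by
  rw [show stateAt M η γ k = _ from funext (stateAt_eq M η γ k)]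
  exact (squareIntegrable_freeState M η k).add (h.squareIntegrable_forcedState k)

lemma FiniteEnergy.squareIntegrable_deviation (h : FiniteEnergy M η γ) (k : Fin κ) :
    SquareIntegrable (law M η) (deviation M ω η γ k) :=
  (h k).add (((squareIntegrable_estimate M η k).add (h.squareIntegrable_forcedState k)).mulVec _)

lemma FiniteEnergy.squareIntegrable_nextState (h : FiniteEnergy M η γ) (k : Fin κ) :
    SquareIntegrable (law M η) (fun z => nextState M η γ z k) := by
  simp only [nextState_eq]
  exact (((h.squareIntegrable_stateAt k).mulVec _).add ((h k).mulVec _)).add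
    (squareIntegrable_stateNoise M η k)

lemma FiniteEnergy.crossMoment_stateNoise_stateAt (h : FiniteEnergy M η γ) (k : Fin κ) :
    crossMoment (law M η) (fun z => z.1.2 k) (stateAt M η γ k) = 0 := by
  rw [show stateAt M η γ k = _ from funext (stateAt_eq M η γ k),
    crossMoment_add_right (squareIntegrable_stateNoise M η k) (squareIntegrable_freeState M η k)
      (h.squareIntegrable_forcedState k),
    crossMoment_stateNoise_freeState M η le_rfl, crossMoment_stateNoise_openAlg M η
      (h.squareIntegrable_forcedState k) (measurable_forcedState_openAlg M η γ k), add_zero]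

lemma FiniteEnergy.crossMoment_nextState (h : FiniteEnergy M η γ) (k : Fin κ) :
    crossMoment (law M η) (fun z => nextState M η γ z k) (fun z => nextState M η γ z k)
      = crossMoment (law M η) (fun z => M.A *ᵥ stateAt M η γ k z + M.B *ᵥ controlInput M η γ z k)
          (fun z => M.A *ᵥ stateAt M η γ k z + M.B *ᵥ controlInput M η γ z k) + M.covNoise := by
  have hx := (h.squareIntegrable_stateAt k).mulVec M.A
  have hu := (h k).mulVec M.B
  have hw := squareIntegrable_stateNoise M η k
  have hwy : crossMoment (law M η) (fun z => z.1.2 k)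
      (fun z => M.A *ᵥ stateAt M η γ k z + M.B *ᵥ controlInput M η γ z k) = 0 := by
    rw [crossMoment_add_right hw hx hu, crossMoment_mulVec_right hw (h.squareIntegrable_stateAt k),
      crossMoment_mulVec_right hw (h k), h.crossMoment_stateNoise_stateAt,
      crossMoment_stateNoise_openAlg M η (h k) (measurable_controlInput_openAlg M η γ le_rfl)]
    simp
  simp only [nextState_eq]
  rw [crossMoment_add_left (hx.add hu) hw ((hx.add hu).add hw),
    crossMoment_add_right (hx.add hu) (hx.add hu) hw, crossMoment_add_right hw (hx.add hu) hw, hwy,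
    ← crossMoment_transpose (fun z : Sample m κ => z.1.2 k) (fun z => M.A *ᵥ stateAt M η γ k z
      + M.B *ᵥ controlInput M η γ z k), hwy, crossMoment_stateNoise]
  simp

/-- Dynamic programming for one stage: the fresh noise is uncorrelated with Ax + Bu, and the
remaining quadratic form is completed to a square. -/
lemma FiniteEnergy.stage_identity (h : FiniteEnergy M η γ) (k : Fin κ) :
    (riccati M ω (k.val + 1) * crossMoment (law M η) (fun z => nextState M η γ z k)
        (fun z => nextState M η γ z k)).trace
      + (M.R ω * crossMoment (law M η) (fun z => controlInput M η γ z k)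
        (fun z => controlInput M η γ z k)).trace
    = ((riccati M ω k.val - M.Q ω)
        * crossMoment (law M η) (stateAt M η γ k) (stateAt M η γ k)).trace
      + (delta M ω k * crossMoment (law M η)
          (fun z => controlInput M η γ z k + feedback M ω k *ᵥ stateAt M η γ k z)
          (fun z => controlInput M η γ z k + feedback M ω k *ᵥ stateAt M η γ k z)).trace
      + (riccati M ω (k.val + 1) * M.covNoise).trace := by
  have hx := h.squareIntegrable_stateAt k
  have hu := h k
  rw [h.crossMoment_nextState, Matrix.mul_add, Matrix.trace_add, add_right_comm]
  congr 1
  rw [riccati_sub, crossMoment_add_left (hx.mulVec _) (hu.mulVec _)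
      ((hx.mulVec _).add (hu.mulVec _)),
    crossMoment_add_right (hx.mulVec _) (hx.mulVec _) (hu.mulVec _),
    crossMoment_add_right (hu.mulVec _) (hx.mulVec _) (hu.mulVec _),
    crossMoment_add_left hu (hx.mulVec _) (hu.add (hx.mulVec _)),
    crossMoment_add_right hu hu (hx.mulVec _),
    crossMoment_add_right (hx.mulVec _) hu (hx.mulVec _)]
  simp only [crossMoment_mulVec_self hx, crossMoment_mulVec_self hu,
    crossMoment_mulVec_left hx (hu.mulVec _), crossMoment_mulVec_left hu (hx.mulVec _),
    crossMoment_mulVec_left hx hu, crossMoment_mulVec_right hx hu, crossMoment_mulVec_right hu hx]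
  have := trace_completion (PosSemidef.transpose_eq (posSemidef_riccati M ω (k.val + 1))) M.A M.B
    (M.R ω) (D := delta M ω k) rfl (PosSemidef.transpose_eq (posDef_delta M ω k).posSemidef)
    (delta_mul_feedback M ω k) (crossMoment (law M η) (stateAt M η γ k) (stateAt M η γ k))
    (crossMoment (law M η) (stateAt M η γ k) (fun z => controlInput M η γ z k))
    (crossMoment (law M η) (fun z => controlInput M η γ z k) (fun z => controlInput M η γ z k))
  rw [crossMoment_transpose] at this
  rw [← Matrix.mul_assoc M.A, ← Matrix.mul_assoc M.B, ← add_assoc, ← add_assoc]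
  exact this

variable (M η) in
/-- The smallest cost that the player C of a given type can achieve. -/
def optimalCost : ℝ :=
  delta0 M ω + ∑ k : Fin κ, (delta M ω k * crossMoment (law M η)
    (fun z => feedback M ω k *ᵥ estimateError M η k z)
    (fun z => feedback M ω k *ᵥ estimateError M η k z)).trace

/-- u + Kx is the deviation plus K times the estimation error; the deviation is observable, so the
two are orthogonal. This is certainty equivalence. -/
lemma FiniteEnergy.crossMoment_residual (h : FiniteEnergy M η γ) (k : Fin κ) :
    crossMoment (law M η)
        (fun z => controlInput M η γ z k + feedback M ω k *ᵥ stateAt M η γ k z)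
        (fun z => controlInput M η γ z k + feedback M ω k *ᵥ stateAt M η γ k z)
      = crossMoment (law M η) (deviation M ω η γ k) (deviation M ω η γ k)
        + crossMoment (law M η) (fun z => feedback M ω k *ᵥ estimateError M η k z)
          (fun z => feedback M ω k *ᵥ estimateError M η k z) := by
  have hv := h.squareIntegrable_deviation ω k
  have he := squareIntegrable_estimateError M η k
  have hsplit : (fun z => controlInput M η γ z k + feedback M ω k *ᵥ stateAt M η γ k z)
      = fun z => deviation M ω η γ k z + feedback M ω k *ᵥ estimateError M η k z := by
    funext z
    rw [stateAt_eq, deviation, estimateError, add_assoc, ← Matrix.mulVec_add]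
    congr 2
    abel
  have hev : crossMoment (law M η) (estimateError M η k) (deviation M ω η γ k) = 0 :=
    crossMoment_estimateError M η hv (measurable_deviation M ω η γ k)
  rw [hsplit, crossMoment_add_left hv (he.mulVec _) (hv.add (he.mulVec _)),
    crossMoment_add_right hv hv (he.mulVec _), crossMoment_add_right (he.mulVec _) hv (he.mulVec _),
    crossMoment_mulVec_right hv he, crossMoment_mulVec_left he hv, hev,
    ← crossMoment_transpose (estimateError M η k), hev]
  simp

/-- The stage identities telescope: replacing the Riccati weight by Q leaves differences of
consecutive values of one sequence. -/
lemma FiniteEnergy.sum_cost (h : FiniteEnergy M η γ) :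
    ∑ k : Fin κ, ((M.Q ω * crossMoment (law M η) (fun z => nextState M η γ z k)
        (fun z => nextState M η γ z k)).trace
      + (M.R ω * crossMoment (law M η) (fun z => controlInput M η γ z k)
        (fun z => controlInput M η γ z k)).trace)
    = optimalCost M ω η + ∑ k : Fin κ, (delta M ω k * crossMoment (law M η)
      (deviation M ω η γ k) (deviation M ω η γ k)).trace := by
  -- Extended by 0 beyond the horizon only to have a sequence on all of ℕ. At κ it vanishes because
  -- the terminal Riccati matrix is Q.
  set f : ℕ → ℝ := fun n => if hn : n ≤ κ then ((riccati M ω n - M.Q ω) * crossMoment (law M η)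
    (fun z => state M η γ z n hn) (fun z => state M η γ z n hn)).trace else 0 with hf
  have htel : ∑ k : Fin κ, (f (k.val + 1) - f k.val) = f κ - f 0 := by
    rw [Fin.sum_univ_eq_sum_range (fun k => f (k + 1) - f k) κ, Finset.sum_range_sub]
  have hlast : f κ = 0 := by simp [hf, riccati_last]
  have hfirst : f 0 = ((riccati M ω 0 - M.Q ω) * M.covInit).trace := by
    simp only [hf, Nat.zero_le, dif_pos]
    rw [← crossMoment_initial M η]
    congr 3 <;> funext z <;> rw [state]
  have hstage : ∀ k : Fin κ, (M.Q ω * crossMoment (law M η) (fun z => nextState M η γ z k)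
        (fun z => nextState M η γ z k)).trace
      + (M.R ω * crossMoment (law M η) (fun z => controlInput M η γ z k)
        (fun z => controlInput M η γ z k)).trace
      = (delta M ω k * crossMoment (law M η) (deviation M ω η γ k) (deviation M ω η γ k)).trace
        + (delta M ω k * crossMoment (law M η) (fun z => feedback M ω k *ᵥ estimateError M η k z)
          (fun z => feedback M ω k *ᵥ estimateError M η k z)).trace
        + (riccati M ω (k.val + 1) * M.covNoise).trace - (f (k.val + 1) - f k.val) := by
    intro k
    have h1 := h.stage_identity ω k
    rw [h.crossMoment_residual, Matrix.mul_add, Matrix.trace_add] at h1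
    have h2 : f (k.val + 1) = (riccati M ω (k.val + 1) * crossMoment (law M η)
          (fun z => nextState M η γ z k) (fun z => nextState M η γ z k)).trace
        - (M.Q ω * crossMoment (law M η)
          (fun z => nextState M η γ z k) (fun z => nextState M η γ z k)).trace := by
      have hk : k.val + 1 ≤ κ := k.isLt
      simp only [hf, hk, dif_pos]
      rw [Matrix.sub_mul, Matrix.trace_sub]
      rfl
    have h3 : f k.val = ((riccati M ω k.val - M.Q ω)
        * crossMoment (law M η) (stateAt M η γ k) (stateAt M η γ k)).trace := by
      have hk : k.val ≤ κ := k.isLt.le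
      simp only [hf, hk, dif_pos]
      rfl
    rw [h2, h3]
    linarith
  rw [Finset.sum_congr rfl fun k _ => hstage k, Finset.sum_sub_distrib, htel, hlast, hfirst,
    optimalCost, delta0]
  simp only [Finset.sum_add_distrib]
  ring

lemma FiniteEnergy.followerCost_eq (h : FiniteEnergy M η γ) :
    followerCost M ω η γ = ENNReal.ofReal (optimalCost M ω η + ∑ k : Fin κ,
      (delta M ω k * crossMoment (law M η) (deviation M ω η γ k) (deviation M ω η γ k)).trace) := by
  have hx := fun k => PosSemidef.trace_mul_nonneg (M.Q_posSemidef ω)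
    (crossMoment_self_posSemidef (h.squareIntegrable_nextState k))
  have hu := fun k => PosSemidef.trace_mul_nonneg (M.R_posDef ω).posSemidef
    (crossMoment_self_posSemidef (h k))
  rw [← h.sum_cost ω, followerCost,
    ENNReal.ofReal_sum_of_nonneg fun k _ => add_nonneg (hx k) (hu k)]
  refine Finset.sum_congr rfl fun k _ => ?_
  rw [meanQuad_eq (M.Q_posSemidef ω) (h.squareIntegrable_nextState k),
    meanQuad_eq (M.R_posDef ω).posSemidef (h k), ENNReal.ofReal_add (hx k) (hu k)]

lemma trace_deviation_nonneg (h : FiniteEnergy M η γ) (k : Fin κ) :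
    0 ≤ (delta M ω k * crossMoment (law M η) (deviation M ω η γ k)
      (deviation M ω η γ k)).trace :=
  PosSemidef.trace_mul_nonneg (posDef_delta M ω k).posSemidef
    (crossMoment_self_posSemidef (h.squareIntegrable_deviation ω k))

/-- R is positive definite, so a finite cost already bounds the second moments of all inputs.
Policies without finite energy cost ∞ and never compete. -/
lemma FiniteEnergy.of_followerCost_ne_top (h : followerCost M ω η γ ≠ ⊤) :
    FiniteEnergy M η γ := by
  intro k
  refine SquareIntegrable.of_meanQuad_ne_top (M.R_posDef ω)
    ((measurable_controlInput_openAlg M η γ (le_refl k)).mono (openAlg_le M η k) le_rfl)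
    fun htop => h ?_
  rw [followerCost, ENNReal.sum_eq_top]
  exact ⟨k, Finset.mem_univ k, by rw [htop, add_top]⟩

/-- Causality: a signal depends on the policy only through the stages strictly before it. -/
lemma signal_congr {γ γ' : ControlPolicy m r κ} {n : Fin κ}
    (h : ∀ k < n, γ.act k = γ'.act k) {k : Fin κ} (hk : k ≤ n) (z : Sample m κ) :
    signal M η γ z k = signal M η γ' z k := by
  induction k using WellFoundedLT.induction with
  | ind k ih =>
    rw [signal_eq, signal_eq]
    congr 1
    refine Finset.sum_congr rfl fun j _ => ?_
    congr 1
    refine Finset.sum_congr rfl fun l hl => ?_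
    have hlk : l < k := (Finset.mem_Iio.mp hl).trans_le (Nat.le_of_lt_succ j.isLt)
    congr 1
    rw [controlInput, controlInput, h l (hlk.trans_le hk)]
    congr 1
    funext i
    exact ih _ ((show (⟨i.val, _⟩ : Fin κ) ≤ l from Nat.le_of_lt_succ i.isLt).trans_lt hlk)
      (((show (⟨i.val, _⟩ : Fin κ) ≤ l from Nat.le_of_lt_succ i.isLt).trans hlk.le).trans hk)

lemma signalHistory_congr {γ γ' : ControlPolicy m r κ} {n : Fin κ}
    (h : ∀ k < n, γ.act k = γ'.act k) {k : Fin κ} (hk : k ≤ n) (z : Sample m κ) :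
    signalHistory M η γ k z = signalHistory M η γ' k z :=
  funext fun i => signal_congr h
    ((show (⟨i.val, _⟩ : Fin κ) ≤ k from Nat.le_of_lt_succ i.isLt).trans hk) z

variable (M η) in
/-- Certainty-equivalent linear feedback is an admissible policy. -/
lemma exists_deviation_eq_zero :
    ∃ γ : ControlPolicy m r κ, ∀ k z, deviation M ω η γ k z = 0 := by
  -- The policy is built stage by stage: the feedback at stage n refers to inputs already fixed, and
  -- altering the action there leaves earlier stages untouched.
  suffices H : ∀ n : ℕ, ∃ γ : ControlPolicy m r κ, ∀ k : Fin κ, k.val < n →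
      ∀ z, deviation M ω η γ k z = 0 by
    obtain ⟨γ, hγ⟩ := H κ
    exact ⟨γ, fun k => hγ k k.isLt⟩
  intro n
  induction n with
  | zero => exact ⟨⟨fun _ _ => 0, fun _ => measurable_const⟩, fun k hk => absurd hk (by simp)⟩
  | succ n ih =>
    obtain ⟨γ, hγ⟩ := ih
    by_cases hn : n < κ
    · set N : Fin κ := ⟨n, hn⟩
      have hmeas : Measurable[MeasurableSpace.comap (signalHistory M η γ N) inferInstance]
          (fun z => -(feedback M ω N *ᵥ
            (estimate M η N z + forcedState M (controlInput M η γ z) N))) := by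
        rw [comap_signalHistory]
        exact (measurable_mulVec _ ((measurable_estimate M η le_rfl).add
          (measurable_forcedState_openAlg M η γ N))).neg
      -- The desired input is measurable for the signals seen so far, so by Doob–Dynkin it is a
      -- Borel function φ of them; φ becomes the action.
      obtain ⟨φ, hφ, hφeq⟩ := hmeas.exists_eq_measurable_comp
      classical
      refine ⟨⟨Function.update γ.act N φ, fun k => ?_⟩, ?_⟩
      · by_cases hk : k = N
        · subst hk
          rwa [Function.update_self]
        · rw [Function.update_of_ne hk]
          exact γ.measurable_act k
      · set γ' : ControlPolicy m r κ := ⟨Function.update γ.act N φ, _⟩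
        have hact : ∀ k < N, γ.act k = γ'.act k := fun k hk =>
          (Function.update_of_ne hk.ne _ _).symm
        have hu : ∀ k < N, ∀ z, controlInput M η γ' z k = controlInput M η γ z k := by
          intro k hk z
          rw [controlInput, controlInput, hact k hk, signalHistory_congr hact hk.le]
        have hforced : ∀ k ≤ N, ∀ z, forcedState M (controlInput M η γ' z) k
            = forcedState M (controlInput M η γ z) k := by
          intro k hk z
          refine Finset.sum_congr rfl fun l hl => ?_
          rw [hu l ((Finset.mem_Iio.mp hl).trans_le hk)]
        intro k hk z
        rcases Nat.lt_succ_iff_lt_or_eq.mp hk with hk' | hk'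
        · have hkN : k < N := hk'
          rw [deviation, hu k hkN, hforced k hkN.le]
          exact hγ k hk' z
        · have hkN : k = N := Fin.ext hk'
          rw [hkN]
          have h1 : controlInput M η γ' z N = φ (signalHistory M η γ N z) := by
            rw [controlInput, ← signalHistory_congr hact le_rfl]
            exact congrFun (Function.update_self _ _ _) _
          rw [deviation, hforced N le_rfl, h1, ← Function.comp_apply (f := φ), ← hφeq,
            neg_add_cancel]
    · exact ⟨γ, fun k _ => hγ k (k.isLt.trans_le (not_lt.mp hn))⟩

lemma FiniteEnergy.of_deviation_eq_zero (h : ∀ k z, deviation M ω η γ k z = 0) :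
    FiniteEnergy M η γ := by
  intro k
  induction k using WellFoundedLT.induction with
  | ind k ih =>
    have hf : SquareIntegrable (law M η) (fun z => forcedState M (controlInput M η γ z) k) :=
      SquareIntegrable.sum fun l hl => (ih l (Finset.mem_Iio.mp hl)).mulVec _
    have hu : (fun z => controlInput M η γ z k) = fun z => -(feedback M ω k *ᵥ
        (estimate M η k z + forcedState M (controlInput M η γ z) k)) := by
      funext z
      exact eq_neg_of_add_eq_zero_left (h k z)
    rw [hu]
    exact (((squareIntegrable_estimate M η k).add hf).mulVec _).neg

/-- Needed because `ENNReal.ofReal` truncates: inequalities between costs descend to the reals only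
when the upper bound is nonnegative. -/
lemma optimalCost_nonneg : 0 ≤ optimalCost M ω η := by
  refine add_nonneg (add_nonneg ?_ (Finset.sum_nonneg fun k _ => ?_))
    (Finset.sum_nonneg fun k _ => ?_)
  · have hsub : ∀ n, (riccatiAux M ω n - M.Q ω).PosSemidef := by
      rintro (_ | j)
      · rw [riccatiAux, sub_self]
        exact Matrix.PosSemidef.zero
      · rw [riccatiAux]
        have h := (posSemidef_riccati_step (posSemidef_riccatiAux M ω j) M.B
          (M.R_posDef ω)).conjTranspose_mul_mul_same M.A
        rw [Matrix.conjTranspose_eq_transpose_of_trivial] at h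
        simpa using h
    exact PosSemidef.trace_mul_nonneg (hsub _) M.covInit_posSemidef
  · exact PosSemidef.trace_mul_nonneg (posSemidef_riccati M ω _) M.covNoise_posSemidef
  · exact PosSemidef.trace_mul_nonneg (posDef_delta M ω k).posSemidef
      (crossMoment_self_posSemidef ((squareIntegrable_estimateError M η k).mulVec _))

lemma followerCost_of_deviation_ae_eq_zero (hu : FiniteEnergy M η γ)
    (h : ∀ k, deviation M ω η γ k =ᵐ[law M η] fun _ => 0) :
    followerCost M ω η γ = ENNReal.ofReal (optimalCost M ω η) := by
  have h0 : ∀ k, crossMoment (law M η) (deviation M ω η γ k) (deviation M ω η γ k) = 0 := by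
    intro k
    rw [crossMoment_congr (h k) (h k)]
    ext i j
    simp [crossMoment_apply]
  rw [hu.followerCost_eq]
  simp [h0]

lemma isBestResponse_of_deviation_eq_zero (h : ∀ k z, deviation M ω η γ k z = 0) :
    IsBestResponse M ω η γ := by
  intro γ'
  rw [followerCost_of_deviation_ae_eq_zero ω (FiniteEnergy.of_deviation_eq_zero ω h)
    fun k => Filter.Eventually.of_forall (h k)]
  by_cases htop : followerCost M ω η γ' = ⊤
  · rw [htop]
    exact le_top
  · have hu := FiniteEnergy.of_followerCost_ne_top ω htop
    rw [hu.followerCost_eq]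
    exact ENNReal.ofReal_le_ofReal (le_add_of_nonneg_right
      (Finset.sum_nonneg fun k _ => trace_deviation_nonneg ω hu k))

/-- Comparison with a policy of zero deviation makes the sum of the nonnegative penalties vanish,
and positive definiteness of Δ turns this into almost sure vanishing. Best responses are thus unique
in effect. -/
lemma IsBestResponse.finiteEnergy_and_deviation (h : IsBestResponse M ω η γ) :
    FiniteEnergy M η γ ∧ ∀ k, deviation M ω η γ k =ᵐ[law M η] fun _ => 0 := by
  obtain ⟨γ₀, hγ₀⟩ := exists_deviation_eq_zero M ω η
  have hle := h γ₀
  rw [followerCost_of_deviation_ae_eq_zero ω (FiniteEnergy.of_deviation_eq_zero ω hγ₀)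
    fun k => Filter.Eventually.of_forall (hγ₀ k)] at hle
  have hu := FiniteEnergy.of_followerCost_ne_top ω (ne_top_of_le_ne_top ENNReal.ofReal_ne_top hle)
  refine ⟨hu, fun k => ae_eq_zero_of_trace_eq_zero (posDef_delta M ω k)
    (hu.squareIntegrable_deviation ω k) ?_⟩
  rw [hu.followerCost_eq, ENNReal.ofReal_le_ofReal_iff (optimalCost_nonneg ω)] at hle
  have hsum := (Finset.sum_eq_zero_iff_of_nonneg
    fun k (_ : k ∈ Finset.univ) => trace_deviation_nonneg ω hu k).mp
    (le_antisymm (by linarith) (Finset.sum_nonneg fun k _ => trace_deviation_nonneg ω hu k))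
  exact hsum k (Finset.mem_univ k)

variable (M) in
lemma exists_isReaction : ∃ g : SignalRule m κ → Option Ω → ControlPolicy m r κ,
    IsReaction M g := by
  choose g hg using fun (η : SignalRule m κ) (ω : Option Ω) => exists_deviation_eq_zero M ω η
  exact ⟨g, fun η ω => isBestResponse_of_deviation_eq_zero ω (hg η ω)⟩

end cost

/-! ### Vectors of the whole horizon and the matrices Φ, Z, T, V -/

section augmented

variable {m r κ : ℕ} {Ω : Type*} (M : Model m r κ Ω) (ω : Option Ω) (η : SignalRule m κ)

/-- The augmented vector of a sequence of random vectors. -/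
def augment {S : Type*} {n : ℕ} (X : Fin κ → S → Vec n) (z : S) (a : Fin κ × Fin n) : ℝ :=
  X a.1 z a.2

lemma SquareIntegrable.augment {S : Type*} [MeasurableSpace S] {P : Measure S} {n : ℕ}
    {X : Fin κ → S → Vec n} (h : ∀ k, SquareIntegrable P (X k)) :
    SquareIntegrable P (augment X) := fun a => h a.1 a.2

/-- A trace against a product of augmented vectors is the sum of the traces of the blocks. -/
lemma trace_mul_augment {S : Type*} [MeasurableSpace S] {P : Measure S} {n p : ℕ}
    (V : Matrix (Fin κ × Fin n) (Fin κ × Fin p) ℝ) (X : Fin κ → S → Vec p)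
    (Y : Fin κ → S → Vec n) :
    (V * crossMoment P (augment X) (augment Y)).trace
      = ∑ k, ∑ l, ((Matrix.of fun i j => V (k, i) (l, j)) * crossMoment P (X l) (Y k)).trace := by
  simp only [Matrix.trace, Matrix.diag_apply, Matrix.mul_apply, Fintype.sum_prod_type,
    Matrix.of_apply]
  refine Finset.sum_congr rfl fun k _ => ?_
  rw [Finset.sum_comm]
  rfl

lemma trace_blockDiagonal_mul_augment {S : Type*} [MeasurableSpace S] {P : Measure S} {n p : ℕ}
    {V : Matrix (Fin κ × Fin n) (Fin κ × Fin p) ℝ} {W : Fin κ → Matrix (Fin n) (Fin p) ℝ}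
    (hV : ∀ a b, V a b = if a.1 = b.1 then W a.1 a.2 b.2 else 0) (X : Fin κ → S → Vec p)
    (Y : Fin κ → S → Vec n) :
    (V * crossMoment P (augment X) (augment Y)).trace
      = ∑ k, (W k * crossMoment P (X k) (Y k)).trace := by
  rw [trace_mul_augment]
  refine Finset.sum_congr rfl fun k _ => ?_
  rw [Finset.sum_eq_single k]
  · congr 2
    ext i j
    simp [hV]
  · intro l _ hl
    have : (Matrix.of fun i j => V (k, i) (l, j)) = 0 := by
      ext i j
      simp [hV, hl.symm]
    rw [this, Matrix.zero_mul, Matrix.trace_zero]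
  · simp

lemma blockDiagonal_mulVec_augment {S : Type*} {n p : ℕ}
    {V : Matrix (Fin κ × Fin n) (Fin κ × Fin p) ℝ} {W : Fin κ → Matrix (Fin n) (Fin p) ℝ}
    (hV : ∀ a b, V a b = if a.1 = b.1 then W a.1 a.2 b.2 else 0) (X : Fin κ → S → Vec p) (z : S) :
    V *ᵥ augment X z = augment (fun k z => W k *ᵥ X k z) z := by
  ext ⟨k, i⟩
  simp only [Matrix.mulVec, dotProduct, Fintype.sum_prod_type, augment, hV]
  rw [Finset.sum_eq_single k]
  · simp
  · intro l _ hl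
    simp [hl.symm]
  · simp

lemma bigDiag_apply (X : Mat m) (a b : Fin κ × Fin m) :
    bigDiag (κ := κ) X a b = if a.1 = b.1 then X a.2 b.2 else 0 := by
  simp [bigDiag, Matrix.one_apply]

lemma bigSigma_eq_augment : bigSigma M = crossMoment (law M η)
    (augment fun k z => freeState M z.1 k) (augment fun k z => freeState M z.1 k) :=
  bigSigma_eq M η

/-- Each off-diagonal pair is assigned to its smaller index, which is the shape of Ξ_k. -/
lemma sum_sum_eq_sum_diag_add (g : Fin κ → Fin κ → ℝ) :
    ∑ k, ∑ l, g k l = ∑ k, (g k k + ∑ l ∈ Finset.Ioi k, (g k l + g l k)) := by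
  have h1 : ∀ k, ∑ l, g k l = g k k + (∑ l ∈ Finset.Ioi k, g k l + ∑ l ∈ Finset.Iio k, g k l) := by
    intro k
    have : (Finset.univ : Finset (Fin κ)) = insert k (Finset.Ioi k ∪ Finset.Iio k) := by
      ext l
      simp only [Finset.mem_univ, Finset.mem_insert, Finset.mem_union, Finset.mem_Ioi,
        Finset.mem_Iio, true_iff]
      rcases lt_trichotomy k l with h | h | h
      · exact Or.inr (Or.inl h)
      · exact Or.inl h.symm
      · exact Or.inr (Or.inr h)
    rw [this, Finset.sum_insert (by simp), Finset.sum_union]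
    exact Finset.disjoint_left.mpr fun l h1 h2 =>
      lt_asymm (Finset.mem_Ioi.mp h1) (Finset.mem_Iio.mp h2)
  have h2 : ∑ k, ∑ l ∈ Finset.Iio k, g k l = ∑ k, ∑ l ∈ Finset.Ioi k, g l k :=
    Finset.sum_comm' fun k l => by simp
  simp only [h1, Finset.sum_add_distrib, h2]

/-- The quadratic forms in the augmented posterior are linear in the posterior covariances. -/
lemma trace_bigV_mul_estimate :
    (bigV M ω * crossMoment (law M η) (augment (estimate M η)) (augment (estimate M η))).trace
      = ∑ k, (crossMoment (law M η) (estimate M η k) (estimate M η k) * Xi M ω k).trace := by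
  rw [trace_mul_augment, sum_sum_eq_sum_diag_add]
  refine Finset.sum_congr rfl fun k _ => ?_
  rw [Matrix.trace_mul_comm _ (Xi M ω k), Xi, Matrix.add_mul, Matrix.trace_add,
    Finset.sum_mul, Matrix.trace_sum]
  congr 1
  refine Finset.sum_congr rfl fun l hl => ?_
  have hkl := (Finset.mem_Ioi.mp hl).le
  have h := crossMoment_estimate_of_le M η hkl
  -- Both off-diagonal blocks are A^{l-k} H_k and its transpose, so only H_k survives.
  rw [h, ← crossMoment_transpose (estimate M η l) (estimate M η k), h, Matrix.transpose_mul,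
    crossMoment_transpose, Matrix.add_mul, Matrix.trace_add]
  congr 1
  · rw [Matrix.mul_assoc]
    rfl
  · rw [← Matrix.mul_assoc, Matrix.trace_mul_comm, Matrix.mul_assoc]
    rfl

/-- Makes zero deviation at all stages a single linear system, Φu = -K x̂. -/
lemma bigPhi_mulVec_augment {S : Type*} (u : Fin κ → S → Vec r) (z : S) :
    bigPhi M ω *ᵥ augment u z
      = augment (fun k z => u k z + feedback M ω k *ᵥ forcedState M (fun l => u l z) k) z := by
  ext ⟨k, i⟩
  have hrow : ∀ l, ∑ j, bigPhi M ω (k, i) (l, j) * u l z j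
      = (if k = l then u l z i else 0) + (if l < k then (feedback M ω k *ᵥ
        ((M.A ^ (k.val - l.val - 1) * M.B) *ᵥ u l z)) i else 0) := by
    intro l
    simp only [bigPhi, Matrix.of_apply]
    rcases lt_trichotomy k l with h | h | h
    · simp [h.ne, h.not_gt]
    · subst h
      simp [Matrix.one_apply]
    · simp only [h.ne', h, if_true, if_false, zero_add]
      rw [Matrix.mulVec_mulVec, ← Matrix.mul_assoc]
      rfl
  simp only [Matrix.mulVec, dotProduct, Fintype.sum_prod_type, augment]
  refine (Finset.sum_congr rfl fun l _ => hrow l).trans ?_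
  rw [Finset.sum_add_distrib, Finset.sum_ite_eq, if_pos (Finset.mem_univ k), Pi.add_apply]
  congr 1
  rw [← Finset.sum_filter, show (Finset.univ.filter fun l => l < k) = Finset.Iio k by ext; simp]
  rw [forcedState, Matrix.mulVec_sum, Finset.sum_apply]

/-- Zu collects the contributions of the inputs to the next states; unlike the forced state, it
includes the input of the present stage. -/
lemma bigZ_mulVec_augment {S : Type*} (u : Fin κ → S → Vec r) (z : S) :
    bigZ M *ᵥ augment u z
      = augment (fun k z => M.A *ᵥ forcedState M (fun l => u l z) k + M.B *ᵥ u k z) z := by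
  ext ⟨k, i⟩
  have hrow : ∀ l, ∑ j, bigZ M (k, i) (l, j) * u l z j
      = (if k = l then (M.B *ᵥ u l z) i else 0) + (if l < k then (M.A *ᵥ
        ((M.A ^ (k.val - l.val - 1) * M.B) *ᵥ u l z)) i else 0) := by
    intro l
    simp only [bigZ, Matrix.of_apply]
    rcases lt_trichotomy k l with h | h | h
    · simp [h.ne, h.not_gt, h.not_ge]
    · subst h
      simp only [le_refl, if_true, lt_irrefl, if_false, add_zero, Nat.sub_self, pow_zero,
        Matrix.one_mul]
      rfl
    · simp only [h.ne', h, h.le, if_true, if_false, zero_add]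
      have h' : l.val < k.val := h
      rw [Matrix.mulVec_mulVec, ← Matrix.mul_assoc, ← pow_succ',
        show k.val - l.val - 1 + 1 = k.val - l.val by omega]
      rfl
  simp only [Matrix.mulVec, dotProduct, Fintype.sum_prod_type, augment]
  refine (Finset.sum_congr rfl fun l _ => hrow l).trans ?_
  rw [Finset.sum_add_distrib, Finset.sum_ite_eq, if_pos (Finset.mem_univ k), Pi.add_apply, add_comm]
  congr 1
  rw [← Finset.sum_filter, show (Finset.univ.filter fun l => l < k) = Finset.Iio k by ext; simp]
  rw [forcedState, Matrix.mulVec_sum, Finset.sum_apply]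

/-- Φ is block lower triangular with identity diagonal blocks; the kernel is shown trivial by
forward substitution. -/
lemma isUnit_bigPhi : IsUnit (bigPhi M ω) := by
  rw [← Matrix.mulVec_injective_iff_isUnit]
  refine (injective_iff_map_eq_zero (bigPhi M ω).mulVecLin).mpr fun v hv => ?_
  -- A one-point sample space turns the deterministic vector v into an augmented one.
  set u : Fin κ → Unit → Vec r := fun k _ i => v (k, i) with hu
  have hvu : v = augment u () := rfl
  rw [Matrix.mulVecLin_apply, hvu, bigPhi_mulVec_augment] at hv
  have hk : ∀ k, u k () = 0 := by
    intro k
    induction k using WellFoundedLT.induction with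
    | ind k ih =>
      have hf : forcedState M (fun l => u l ()) k = 0 :=
        Finset.sum_eq_zero fun l hl => by
          simp only [ih l (Finset.mem_Iio.mp hl), Matrix.mulVec_zero]
      ext i
      have := congrFun hv (k, i)
      simpa [augment, hf] using this
  rw [hvu]
  ext ⟨k, i⟩
  exact congrFun (hk k) i

variable {M η} {γ : ControlPolicy m r κ}

lemma augment_controlInput_eq (h : ∀ k, deviation M ω η γ k =ᵐ[law M η] fun _ => 0) :
    augment (fun k z => controlInput M η γ z k)
      =ᵐ[law M η] fun z => -(((bigPhi M ω)⁻¹ * bigK M ω) *ᵥ augment (estimate M η) z) := by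
  filter_upwards [ae_all_iff.mpr h] with z hz
  have h1 : bigPhi M ω *ᵥ augment (fun k z => controlInput M η γ z k) z
      = -(bigK M ω *ᵥ augment (estimate M η) z) := by
    rw [bigPhi_mulVec_augment, blockDiagonal_mulVec_augment (W := feedback M ω)
      (fun a b => by simp [bigK])]
    ext ⟨k, i⟩
    have := congrFun (hz k) i
    rw [deviation, Matrix.mulVec_add] at this
    simp only [augment, Pi.neg_apply, Pi.add_apply, Pi.zero_apply] at this ⊢
    change controlInput M η γ z k i
      + (feedback M ω k *ᵥ forcedState M (controlInput M η γ z) k) i = _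
    linarith
  have h2 := congrArg (fun v => (bigPhi M ω)⁻¹ *ᵥ v) h1
  simp only [Matrix.mulVec_mulVec, Matrix.mulVec_neg] at h2
  rwa [Matrix.nonsing_inv_mul _ ((Matrix.isUnit_iff_isUnit_det _).mp (isUnit_bigPhi M ω)),
    Matrix.one_mulVec] at h2

lemma augment_forced_eq (h : ∀ k, deviation M ω η γ k =ᵐ[law M η] fun _ => 0) :
    augment (fun k z => M.A *ᵥ forcedState M (controlInput M η γ z) k
        + M.B *ᵥ controlInput M η γ z k)
      =ᵐ[law M η] fun z => -(bigT M ω *ᵥ augment (estimate M η) z) := by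
  filter_upwards [augment_controlInput_eq ω h] with z hz
  have h1 := bigZ_mulVec_augment M (fun k z => controlInput M η γ z k) z
  rw [hz, Matrix.mulVec_neg, Matrix.mulVec_mulVec, ← Matrix.mul_assoc] at h1
  rw [bigT, h1]

end augmented

/-! ### Cost of the sensor as the value of the program -/

section sensor

variable {m r κ : ℕ} {Ω : Type*} (M : Model m r κ Ω) (η : SignalRule m κ)

/-- The contribution of a type to the objective of the program. -/
def typeValue (S : Fin κ → Mat m) (ω : Option Ω) : ℝ := xi M ω + ∑ k, (S k * Xi M ω k).trace

variable (γ₀ : ControlPolicy m r κ)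

/-- The error covariance is Σ^o_k - H_k by orthogonality. In the loss Tr{ΔK(Σ^o - H)K'} the first
part goes into ξ and the second is the form of V at the posterior. -/
lemma optimalCost_none : optimalCost M none η = typeValue M (posteriorCov M η γ₀) none := by
  have hx := squareIntegrable_freeState M η
  have he := squareIntegrable_estimate M η
  have hxe : ∀ k, crossMoment (law M η) (estimateError M η k) (estimateError M η k)
      = crossMoment (law M η) (fun z => freeState M z.1 k) (fun z => freeState M z.1 k)
        - crossMoment (law M η) (estimate M η k) (estimate M η k) := by
    intro k
    have h1 : crossMoment (law M η) (estimateError M η k) (estimate M η k) = 0 :=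
      crossMoment_estimateError M η (he k) (measurable_estimate M η le_rfl)
    have h2 : crossMoment (law M η) (fun z => freeState M z.1 k) (estimate M η k)
        = crossMoment (law M η) (estimate M η k) (estimate M η k) :=
      (crossMoment_estimate_left M η (he k) (measurable_estimate M η le_rfl)).symm
    have h3 : crossMoment (law M η) (estimate M η k) (fun z => freeState M z.1 k)
        = crossMoment (law M η) (estimate M η k) (estimate M η k) := by
      rw [← crossMoment_transpose (fun z : Sample m κ => freeState M z.1 k), h2,
        crossMoment_transpose]
    calc crossMoment (law M η) (estimateError M η k) (estimateError M η k)
        = crossMoment (law M η) (estimateError M η k)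
            (fun z => freeState M z.1 k - estimate M η k z) := rfl
      _ = crossMoment (law M η) (fun z => freeState M z.1 k - estimate M η k z)
            (fun z => freeState M z.1 k) := by
          rw [crossMoment_sub_right (squareIntegrable_estimateError M η k) (hx k) (he k), h1,
            sub_zero]
          rfl
      _ = _ := by rw [crossMoment_sub_left (hx k) (he k) (hx k), h3]
  have hquad : ∀ X : Fin κ → Sample m κ → Vec m, (∀ k, SquareIntegrable (law M η) (X k)) →
      (bigV M none * crossMoment (law M η) (augment X) (augment X)).trace
        = - ∑ k, (delta M none k * (feedback M none k * crossMoment (law M η) (X k) (X k)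
            * (feedback M none k)ᵀ)).trace := by
    intro X hX
    have h1 : (fun z => bigK M none *ᵥ augment X z)
        = augment (fun k z => feedback M none k *ᵥ X k z) :=
      funext (blockDiagonal_mulVec_augment (W := feedback M none) (fun a b => by simp [bigK]) X)
    have h2 := crossMoment_mulVec_self (SquareIntegrable.augment hX) (bigK M none)
    have h3 := trace_blockDiagonal_mul_augment (P := law M η) (V := bigDelta M none)
      (W := delta M none)
      (fun a b => by simp [bigDelta]) (fun k z => feedback M none k *ᵥ X k z)
      (fun k z => feedback M none k *ᵥ X k z)
    rw [← h1, h2] at h3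
    simp only [fun k => crossMoment_mulVec_self (hX k) (feedback M none k)] at h3
    rw [← h3, bigV, Matrix.neg_mul, Matrix.trace_neg, ← Matrix.mul_assoc, ← Matrix.mul_assoc,
      Matrix.trace_mul_comm _ (bigK M none)ᵀ]
    simp only [Matrix.mul_assoc]
  have h1 := hquad _ hx
  have h2 := hquad _ he
  rw [trace_bigV_mul_estimate] at h2
  rw [← bigSigma_eq_augment, Matrix.trace_mul_comm] at h1
  simp only [typeValue, xi, posteriorCov_eq, h1, h2, optimalCost,
    fun k => crossMoment_mulVec_self (squareIntegrable_estimateError M η k) (feedback M none k),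
    hxe, Matrix.mul_sub, Matrix.sub_mul, Matrix.trace_sub, Finset.sum_sub_distrib]
  ring

variable {M η} {γ : ControlPolicy m r κ}

/-- The next state is A x^o + F + w with F = -T x̂ almost surely. The square of A x^o and the noise
give ξ; the square of F and the mixed terms give the three summands of V. -/
lemma attackerCost (ω : Ω) (hu : FiniteEnergy M η γ)
    (h : ∀ k, deviation M (some ω) η γ k =ᵐ[law M η] fun _ => 0) :
    ∑ k : Fin κ, (M.Q none * crossMoment (law M η) (fun z => nextState M η γ z k)
        (fun z => nextState M η γ z k)).trace
      = typeValue M (posteriorCov M η γ₀) (some ω) := by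
  have hx := squareIntegrable_freeState M η
  have he := squareIntegrable_estimate M η
  set X : Fin κ → Sample m κ → Vec m := fun k z => M.A *ᵥ freeState M z.1 k with hX
  set F : Fin κ → Sample m κ → Vec m := fun k z =>
    M.A *ᵥ forcedState M (controlInput M η γ z) k + M.B *ᵥ controlInput M η γ z k with hF
  have hXs : ∀ k, SquareIntegrable (law M η) (X k) := fun k => (hx k).mulVec _
  have hFs : ∀ k, SquareIntegrable (law M η) (F k) := fun k =>
    ((hu.squareIntegrable_forcedState k).mulVec _).add ((hu k).mulVec _)
  have hFm : ∀ k, Measurable[openAlg M η k] (F k) := fun k =>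
    (measurable_mulVec _ (measurable_forcedState_openAlg M η γ k)).add
      (measurable_mulVec _ (measurable_controlInput_openAlg M η γ le_rfl))
  have hea := SquareIntegrable.augment he
  have hxa := SquareIntegrable.augment hx
  set E := crossMoment (law M η) (augment (estimate M η)) (augment (estimate M η)) with hE
  set T := bigT M (some ω) with hT
  set A' : Matrix (Fin κ × Fin m) (Fin κ × Fin m) ℝ := bigDiag M.A with hA'
  set Q' : Matrix (Fin κ × Fin m) (Fin κ × Fin m) ℝ := bigDiag (M.Q none) with hQ'
  have hQt : Q'ᵀ = Q' := by
    ext a b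
    simp only [hQ', Matrix.transpose_apply, bigDiag_apply, eq_comm (a := b.1)]
    rw [← Matrix.transpose_apply (M.Q none), PosSemidef.transpose_eq (M.Q_posSemidef none)]
  have hFT : augment F =ᵐ[law M η] fun z => (-T) *ᵥ augment (estimate M η) z := by
    simpa only [Matrix.neg_mulVec] using augment_forced_eq (some ω) h
  have hXA : (augment X) = fun z => A' *ᵥ augment (fun k z => freeState M z.1 k) z :=
    (funext (blockDiagonal_mulVec_augment (W := fun _ => M.A) (bigDiag_apply M.A) _)).symm
  have hstage : ∀ k, (M.Q none * crossMoment (law M η) (fun z => nextState M η γ z k)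
        (fun z => nextState M η γ z k)).trace
      = (M.Q none * crossMoment (law M η) (X k) (X k)).trace
        + 2 * (M.Q none * crossMoment (law M η) (X k) (F k)).trace
        + (M.Q none * crossMoment (law M η) (F k) (F k)).trace
        + (M.covNoise * M.Q none).trace := by
    intro k
    have hy : (fun z => M.A *ᵥ stateAt M η γ k z + M.B *ᵥ controlInput M η γ z k)
        = fun z => X k z + F k z := by
      funext z
      simp only [stateAt_eq, hX, hF, Matrix.mulVec_add]
      abel
    have hsymm : (M.Q none * crossMoment (law M η) (F k) (X k)).trace
        = (M.Q none * crossMoment (law M η) (X k) (F k)).trace := by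
      rw [← Matrix.trace_transpose, Matrix.transpose_mul, crossMoment_transpose,
        PosSemidef.transpose_eq (M.Q_posSemidef none), Matrix.trace_mul_comm]
    rw [hu.crossMoment_nextState, hy,
      crossMoment_add_left (hXs k) (hFs k) ((hXs k).add (hFs k)),
      crossMoment_add_right (hXs k) (hXs k) (hFs k), crossMoment_add_right (hFs k) (hXs k) (hFs k)]
    simp only [Matrix.mul_add, Matrix.trace_add]
    rw [hsymm, Matrix.trace_mul_comm M.covNoise]
    ring
  have hblock : ∀ Y Y' : Fin κ → Sample m κ → Vec m,
      ∑ k, (M.Q none * crossMoment (law M η) (Y k) (Y' k)).trace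
        = (Q' * crossMoment (law M η) (augment Y) (augment Y')).trace := fun Y Y' =>
    (trace_blockDiagonal_mul_augment (W := fun _ => M.Q none) (bigDiag_apply (M.Q none)) Y Y').symm
  have hXX : ∑ k, (M.Q none * crossMoment (law M η) (X k) (X k)).trace
      = (bigSigma M * A'ᵀ * Q' * A').trace := by
    rw [hblock, hXA, crossMoment_mulVec_self hxa, ← bigSigma_eq_augment, ← Matrix.mul_assoc,
      Matrix.trace_mul_comm, ← Matrix.mul_assoc, Matrix.trace_mul_comm, Matrix.mul_assoc,
      Matrix.trace_mul_comm A']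
    simp only [Matrix.mul_assoc]
  have hXF : ∑ k, (M.Q none * crossMoment (law M η) (X k) (F k)).trace
      = - (A'ᵀ * Q' * T * E).trace := by
    -- F is observable, so in the mixed moment the control-free state may be replaced by its
    -- posterior; this makes the mixed term a form in x̂ alone.
    have h1 : ∀ k, crossMoment (law M η) (X k) (F k)
        = crossMoment (law M η) (fun z => M.A *ᵥ estimate M η k z) (F k) := by
      intro k
      rw [hX, crossMoment_mulVec_left (hx k) (hFs k), crossMoment_mulVec_left (he k) (hFs k),
        crossMoment_estimate_left M η (hFs k) (hFm k)]
    have h2 : augment (fun k z => M.A *ᵥ estimate M η k z)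
        = fun z => A' *ᵥ augment (estimate M η) z :=
      (funext (blockDiagonal_mulVec_augment (W := fun _ => M.A) (bigDiag_apply M.A) _)).symm
    simp only [h1]
    rw [hblock, h2, crossMoment_congr Filter.EventuallyEq.rfl hFT,
      crossMoment_mulVec_left hea (hea.mulVec _), crossMoment_mulVec_right hea hea, ← hE,
      ← Matrix.trace_transpose]
    have hEt : Eᵀ = E := crossMoment_transpose _ _
    simp only [Matrix.transpose_mul, Matrix.transpose_transpose, Matrix.transpose_neg, hEt, hQt,
      Matrix.mul_neg, Matrix.trace_neg]
    rw [Matrix.mul_assoc, Matrix.trace_mul_comm]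
    simp only [Matrix.mul_assoc]
  have hFF : ∑ k, (M.Q none * crossMoment (law M η) (F k) (F k)).trace
      = (Tᵀ * Q' * T * E).trace := by
    rw [hblock, crossMoment_congr hFT hFT, crossMoment_mulVec_self hea, ← hE, ← Matrix.mul_assoc,
      Matrix.trace_mul_comm, Matrix.transpose_neg]
    simp only [Matrix.mul_assoc, Matrix.neg_mul, Matrix.mul_neg, neg_neg]
  have hsymm : (Tᵀ * Q' * A' * E).trace = (A'ᵀ * Q' * T * E).trace := by
    have hEt : Eᵀ = E := crossMoment_transpose _ _
    rw [← Matrix.trace_transpose]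
    simp only [Matrix.transpose_mul, Matrix.transpose_transpose, hEt, hQt]
    rw [Matrix.trace_mul_comm]
    simp only [Matrix.mul_assoc]
  have hV := trace_bigV_mul_estimate M (some ω) η
  simp only [bigV] at hV
  rw [← hE, ← hT, ← hQ', ← hA', Matrix.sub_mul, Matrix.sub_mul, Matrix.trace_sub,
    Matrix.trace_sub, hsymm] at hV
  simp only [hstage, Finset.sum_add_distrib, ← Finset.mul_sum, hXX, hXF, hFF, typeValue, xi,
    posteriorCov_eq]
  rw [← hV, Finset.sum_const, Finset.card_univ, Fintype.card_fin, nsmul_eq_mul]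
  ring

/-- The nonnegativity is carried along because `ENNReal.ofReal` loses negative values; it holds as
the value is an actual cost. -/
theorem sensorTypeCost_eq {ω : Option Ω} (h : IsBestResponse M ω η γ) :
    sensorTypeCost M η γ ω = ENNReal.ofReal (typeValue M (posteriorCov M η γ₀) ω)
      ∧ 0 ≤ typeValue M (posteriorCov M η γ₀) ω := by
  obtain ⟨hu, hdev⟩ := h.finiteEnergy_and_deviation
  cases ω with
  | none =>
    rw [sensorTypeCost, followerCost_of_deviation_ae_eq_zero none hu hdev,
      ← optimalCost_none M η γ₀]
    exact ⟨rfl, optimalCost_nonneg none⟩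
  | some ω =>
    have hx := fun k => PosSemidef.trace_mul_nonneg (M.Q_posSemidef none)
      (crossMoment_self_posSemidef (hu.squareIntegrable_nextState k))
    rw [sensorTypeCost, ← attackerCost γ₀ ω hu hdev,
      ENNReal.ofReal_sum_of_nonneg fun k _ => hx k]
    exact ⟨Finset.sum_congr rfl fun k _ =>
      meanQuad_eq (M.Q_posSemidef none) (hu.squareIntegrable_nextState k),
      Finset.sum_nonneg fun k _ => hx k⟩

/-- The value of the program at the posterior covariances is the cost of the sensor. -/
theorem sensorCost_eq [Fintype Ω] {g : Option Ω → ControlPolicy m r κ}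
    (h : ∀ ω, IsBestResponse M ω η (g ω)) :
    ((sensorCost M η g : ℝ≥0∞) : EReal) = (programValue M (posteriorCov M η γ₀) : EReal) := by
  set c : Option Ω → ℝ := typeValue M (posteriorCov M η γ₀)
  have hc : ∀ ω, sensorTypeCost M η (g ω) ω = ENNReal.ofReal (c ω) ∧ 0 ≤ c ω := fun ω =>
    sensorTypeCost_eq γ₀ (h ω)
  have hp0 : ∀ (p : stdSimplex ℝ (Option Ω)) ω, 0 ≤ p.1 ω := fun p ω => p.2.1 ω
  have hp1 : ∀ (p : stdSimplex ℝ (Option Ω)) ω, p.1 ω ≤ 1 := fun p ω =>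
    (Finset.single_le_sum (fun ω _ => hp0 p ω) (Finset.mem_univ ω)).trans p.2.2.le
  have hnonneg : ∀ p : stdSimplex ℝ (Option Ω), 0 ≤ ∑ ω, p.1 ω * c ω := fun p =>
    Finset.sum_nonneg fun ω _ => mul_nonneg (hp0 p ω) (hc ω).2
  have hbdd : BddAbove (Set.range fun p : stdSimplex ℝ (Option Ω) => ∑ ω, p.1 ω * c ω) := by
    refine ⟨∑ ω, c ω, ?_⟩
    rintro _ ⟨p, rfl⟩
    exact Finset.sum_le_sum fun ω _ => mul_le_of_le_one_left (hc ω).2 (hp1 p ω)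
  have hcost : sensorCost M η g
      = ⨆ p : stdSimplex ℝ (Option Ω), ENNReal.ofReal (∑ ω, p.1 ω * c ω) := by
    refine iSup_congr fun p => ?_
    rw [ENNReal.ofReal_sum_of_nonneg fun ω _ => mul_nonneg (hp0 p ω) (hc ω).2]
    exact Finset.sum_congr rfl fun ω _ => by rw [(hc ω).1, ENNReal.ofReal_mul (hp0 p ω)]
  have hval : programValue M (posteriorCov M η γ₀)
      = ⨆ p : stdSimplex ℝ (Option Ω), ∑ ω, p.1 ω * c ω := rfl
  have hsup : sensorCost M η g = ENNReal.ofReal (programValue M (posteriorCov M η γ₀)) := by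
    rw [hcost, hval]
    -- A monotone continuous map commutes with the supremum of a bounded family.
    exact (ENNReal.ofReal_mono.map_ciSup_of_continuousAt
      ENNReal.continuous_ofReal.continuousAt hbdd).symm
  rw [hsup, EReal.coe_ennreal_ofReal, max_eq_left]
  rw [hval]
  exact Real.iSup_nonneg hnonneg

end sensor

/-! ### The explicit one-stage construction -/

section construction

variable {t q m : ℕ} (h : t + q = m)

lemma pad_mul (X Y : Mat t) : pad h X * pad h Y = pad h (X * Y) := by
  simp only [pad, Matrix.reindex_apply]
  rw [Matrix.submatrix_mul_equiv, Matrix.fromBlocks_multiply]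
  simp

lemma pad_transpose (X : Mat t) : (pad h X)ᵀ = pad h Xᵀ := by
  simp [pad, Matrix.reindex_apply, Matrix.transpose_submatrix, Matrix.fromBlocks_transpose]

lemma pad_add (X Y : Mat t) : pad h X + pad h Y = pad h (X + Y) := by
  have h1 := Matrix.fromBlocks_add X (0 : Matrix (Fin t) (Fin q) ℝ)
    (0 : Matrix (Fin q) (Fin t) ℝ) (0 : Matrix (Fin q) (Fin q) ℝ) Y 0 0 0
  simp only [add_zero] at h1
  simp only [pad, Matrix.reindex_apply, ← h1]
  rfl

lemma topLeft_pad (X : Mat t) : topLeft h (pad h X) = X := by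
  ext i j
  simp [topLeft, pad, Matrix.toBlocks₁₁]

lemma topLeft_sub (X Y : Mat m) : topLeft h (X - Y) = topLeft h X - topLeft h Y := rfl

lemma posSemidef_topLeft {X : Mat m} (hX : X.PosSemidef) : (topLeft h X).PosSemidef :=
  (hX.submatrix (splitIndex h)).submatrix Sum.inl

lemma pad_inr_apply (X : Mat t) (i : Fin q) (j : Fin m) :
    pad h X (splitIndex h (Sum.inr i)) j = 0 := by
  obtain ⟨j, rfl⟩ := (splitIndex h).surjective j
  simp only [pad, Matrix.reindex_apply, Matrix.submatrix_apply, Equiv.symm_apply_apply]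
  cases j <;> simp

/-- A positive semi-definite matrix that is dominated by a padded one is padded itself. -/
lemma pad_topLeft {F : Mat m} {X : Mat t} (hF : F.PosSemidef) (hX : (pad h X - F).PosSemidef) :
    pad h (topLeft h F) = F := by
  have hcol : ∀ (i : Fin q) (j : Fin m), F j (splitIndex h (Sum.inr i)) = 0 := by
    intro i j
    set a := splitIndex h (Sum.inr i)
    have h1 : 0 ≤ F a a := hF.diag_nonneg
    have h2 : 0 ≤ (pad h X - F) a a := hX.diag_nonneg
    rw [Matrix.sub_apply, pad_inr_apply] at h2
    have h3 : F a a = 0 := le_antisymm (by linarith) h1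
    -- For a positive semidefinite matrix a vanishing quadratic form forces a null vector, so a zero
    -- diagonal entry kills its column.
    have h4 := (hF.dotProduct_mulVec_zero_iff (Pi.single a 1)).mp (by simp [h3])
    simpa using congrFun h4 j
  have hrow : ∀ (i : Fin q) (j : Fin m), F (splitIndex h (Sum.inr i)) j = 0 := by
    intro i j
    rw [← PosSemidef.transpose_eq hF, Matrix.transpose_apply, hcol]
  ext a b
  obtain ⟨a, rfl⟩ := (splitIndex h).surjective a
  obtain ⟨b, rfl⟩ := (splitIndex h).surjective b
  simp only [pad, Matrix.reindex_apply, Matrix.submatrix_apply, Equiv.symm_apply_apply]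
  rcases a with a | a
  · rcases b with b | b
    · rfl
    · simp [hcol]
  · rw [hrow]
    cases b <;> simp

lemma diagonal_inv_sqrt_mul_self {v : Fin t → ℝ} (hv : ∀ i, 0 < v i) :
    Matrix.diagonal v * Matrix.diagonal (fun i => (√(v i))⁻¹)
      * Matrix.diagonal (fun i => (√(v i))⁻¹) = 1 := by
  rw [Matrix.diagonal_mul_diagonal, Matrix.diagonal_mul_diagonal, ← Matrix.diagonal_one]
  congr 1
  ext i
  have h1 := Real.mul_self_sqrt (hv i).le
  have h2 := (Real.sqrt_pos.mpr (hv i)).ne'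
  field_simp
  linarith [sq (√(v i))]

/-- The gain of the constructed signal satisfies the normal equations, and it reduces the error
covariance by the prescribed amount. -/
lemma IsStageSignal.exists_gain {D E L Th : Mat m} (hs : IsStageSignal D E L Th)
    (hE : E.PosSemidef) (hDE : (D - E).PosSemidef) :
    ∃ G : Mat m, G * (Lᵀ * D * L + Th) = D * L ∧ G * (Lᵀ * D * L + Th) * Gᵀ = E := by
  obtain ⟨t, q, h, Ub, lb, U, lam, lamO, θ, -, hUb, hlb, hD, hU, hT, hlam, hL, hTh⟩ := hs
  rw [Matrix.mem_orthogonalGroup_iff'] at hUb hU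
  have hUb' : Ub * Ubᵀ = 1 := mul_eq_one_comm.mp hUb
  set s : Mat t := Matrix.diagonal (fun i => (√(lb i))⁻¹) with hsdef
  set Lb : Mat t := Matrix.diagonal lb with hLb
  set Lo : Mat t := Matrix.diagonal lamO with hLo
  set c : Fin t → ℝ := fun i => lamO i ^ 2 + θ i ^ 2 with hc
  set Ci : Mat t := Matrix.diagonal (fun i => (c i)⁻¹) with hCi
  set F := Ubᵀ * E * Ub with hF
  have hst : sᵀ = s := Matrix.diagonal_transpose _
  have hLbt : Lbᵀ = Lb := Matrix.diagonal_transpose _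
  have hLot : Loᵀ = Lo := Matrix.diagonal_transpose _
  have hCit : Ciᵀ = Ci := Matrix.diagonal_transpose _
  have hLss : Lb * s * s = 1 := diagonal_inv_sqrt_mul_self hlb
  have hcomm : s * Lb = Lb * s := by
    simp only [hsdef, hLb, Matrix.diagonal_mul_diagonal, mul_comm]
  have hsLs : s * Lb * s = 1 := by rw [hcomm, hLss]
  have hssL : s * s * Lb = 1 := by rw [Matrix.mul_assoc, hcomm, ← Matrix.mul_assoc, hsLs]
  have hlamd : Lo * Ci * Lo = Matrix.diagonal lam := by
    simp only [hLo, hCi, Matrix.diagonal_mul_diagonal]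
    congr 1
    ext i
    rw [← (hlam i).2, div_eq_mul_inv]
    ring
  have hcCi : Ci * Matrix.diagonal c = 1 := by
    rw [hCi, Matrix.diagonal_mul_diagonal, ← Matrix.diagonal_one]
    congr 1
    ext i
    exact inv_mul_cancel₀ (hlam i).1
  have hDL : D * L = Ub * pad h (Lb * (s * U * Lo)) := by
    rw [hD, hL, ← pad_mul h Lb]
    calc Ub * pad h Lb * Ubᵀ * (Ub * pad h (s * U * Lo))
        = Ub * pad h Lb * (Ubᵀ * Ub) * pad h (s * U * Lo) := by simp only [Matrix.mul_assoc]
      _ = _ := by rw [hUb, Matrix.mul_one, Matrix.mul_assoc]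
  have hN : Lᵀ * D * L + Th = pad h (Matrix.diagonal c) := by
    have h1 : Lᵀ * D * L = pad h (Lo * Lo) := by
      rw [Matrix.mul_assoc, hDL, hL, Matrix.transpose_mul, pad_transpose]
      calc pad h (s * U * Lo)ᵀ * Ubᵀ * (Ub * pad h (Lb * (s * U * Lo)))
          = pad h (s * U * Lo)ᵀ * (Ubᵀ * Ub) * pad h (Lb * (s * U * Lo)) := by
            simp only [Matrix.mul_assoc]
        _ = pad h (Lo * (Uᵀ * (s * Lb * s) * U) * Lo) := by
            rw [hUb, Matrix.mul_one, pad_mul]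
            simp only [Matrix.transpose_mul, hst, hLot, Matrix.mul_assoc]
        _ = pad h (Lo * Lo) := by rw [hsLs, Matrix.mul_one, hU, Matrix.mul_one]
    rw [h1, hTh, pad_add, hLo, Matrix.diagonal_mul_diagonal, Matrix.diagonal_add]
    simp only [hc, sq]
  -- The innovation covariance is diagonal but singular when t < m. The gain is DL times its
  -- pseudo-inverse, which inverts the nonzero block only.
  have hGN : Ub * pad h (Lb * (s * U * Lo) * Ci) * (Lᵀ * D * L + Th) = D * L := by
    rw [hN, hDL, Matrix.mul_assoc, pad_mul, Matrix.mul_assoc _ Ci, hcCi, Matrix.mul_one]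
  refine ⟨Ub * pad h (Lb * (s * U * Lo) * Ci), hGN, ?_⟩
  -- E is dominated by D, so in the eigenbasis of D it has no entries outside the block where D is
  -- positive.
  have hFp : pad h (topLeft h F) = F := by
    refine pad_topLeft h (X := Lb) ?_ ?_
    · have := hE.conjTranspose_mul_mul_same Ub
      rwa [Matrix.conjTranspose_eq_transpose_of_trivial] at this
    · have h1 := hDE.conjTranspose_mul_mul_same Ub
      rw [Matrix.conjTranspose_eq_transpose_of_trivial, Matrix.mul_sub, Matrix.sub_mul, ← hF] at h1
      have h2 : Ubᵀ * D * Ub = pad h Lb := by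
        rw [hD]
        calc Ubᵀ * (Ub * pad h Lb * Ubᵀ) * Ub = (Ubᵀ * Ub) * pad h Lb * (Ubᵀ * Ub) := by
              simp only [Matrix.mul_assoc]
          _ = pad h Lb := by rw [hUb, Matrix.one_mul, Matrix.mul_one]
      rwa [h2] at h1
  rw [hGN, hDL, Matrix.transpose_mul, pad_transpose]
  -- Λ° diag(c)⁻¹ Λ° = Λ is the condition on λ° and θ; then UΛU' = T, and the whitening factors
  -- cancel against Λ̄.
  have hin : Lb * (s * U * Lo) * (Lb * (s * U * Lo) * Ci)ᵀ = topLeft h F := by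
    simp only [Matrix.transpose_mul, hst, hLbt, hLot, hCit]
    calc Lb * (s * U * Lo) * (Ci * (Lo * (Uᵀ * s) * Lb))
        = Lb * s * (U * (Lo * Ci * Lo) * Uᵀ) * (s * Lb) := by simp only [Matrix.mul_assoc]
      _ = Lb * s * s * topLeft h F * (s * s * Lb) := by
          rw [hlamd, ← hT]
          simp only [Matrix.mul_assoc]
      _ = topLeft h F := by rw [hLss, hssL, Matrix.one_mul, Matrix.mul_one]
  calc Ub * pad h (Lb * (s * U * Lo)) * (pad h (Lb * (s * U * Lo) * Ci)ᵀ * Ubᵀ)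
      = Ub * (pad h (Lb * (s * U * Lo)) * pad h (Lb * (s * U * Lo) * Ci)ᵀ) * Ubᵀ := by
        simp only [Matrix.mul_assoc]
    _ = Ub * (Ubᵀ * E * Ub) * Ubᵀ := by rw [pad_mul, hin, hFp]
    _ = (Ub * Ubᵀ) * E * (Ub * Ubᵀ) := by simp only [Matrix.mul_assoc]
    _ = E := by rw [hUb', Matrix.one_mul, Matrix.mul_one]

lemma exists_diagonalization {n : ℕ} {X : Mat n} (hX : X.PosSemidef) :
    ∃ U : Mat n, ∃ v : Fin n → ℝ, U ∈ Matrix.orthogonalGroup (Fin n) ℝ ∧ (∀ i, 0 ≤ v i) ∧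
      X = U * Matrix.diagonal v * Uᵀ ∧ X.rank = Fintype.card {i // v i ≠ 0} := by
  refine ⟨hX.isHermitian.eigenvectorUnitary, hX.isHermitian.eigenvalues,
    hX.isHermitian.eigenvectorUnitary.2, hX.eigenvalues_nonneg, ?_,
    hX.isHermitian.rank_eq_card_non_zero_eigs⟩
  exact hX.isHermitian.spectral_theorem

/-- An eigen-decomposition with the positive eigenvalues in front. -/
lemma exists_sorted_diagonalization {D : Mat m} (hD : D.PosSemidef) :
    ∃ (q : ℕ) (h : D.rank + q = m) (Ub : Mat m) (lb : Fin D.rank → ℝ),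
      Ub ∈ Matrix.orthogonalGroup (Fin m) ℝ ∧ (∀ i, 0 < lb i) ∧
      D = Ub * pad h (Matrix.diagonal lb) * Ubᵀ := by
  classical
  obtain ⟨U, v, hU, hv, hDU, hrank⟩ := exists_diagonalization hD
  set q := Fintype.card {i // ¬ v i ≠ 0} with hq
  have hcard : D.rank + q = m := by
    rw [hrank, hq, ← Fintype.card_sum, Fintype.card_congr (Equiv.sumCompl fun i => v i ≠ 0),
      Fintype.card_fin]
  let e₁ : Fin D.rank ≃ {i // v i ≠ 0} := (finCongr hrank).trans (Fintype.equivFin _).symm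
  let e₂ : Fin q ≃ {i // ¬ v i ≠ 0} := (Fintype.equivFin _).symm
  -- Permutation that lists the nonzero eigenvalues first; their number is the rank.
  let π : Fin m ≃ Fin m := (splitIndex hcard).symm.trans
    ((Equiv.sumCongr e₁ e₂).trans (Equiv.sumCompl fun i => v i ≠ 0))
  have hdiag : Matrix.diagonal (v ∘ π) = pad hcard (Matrix.diagonal fun i => v (e₁ i)) := by
    ext a b
    obtain ⟨a, rfl⟩ := (splitIndex hcard).surjective a
    obtain ⟨b, rfl⟩ := (splitIndex hcard).surjective b
    simp only [pad, Matrix.reindex_apply, Matrix.submatrix_apply, Equiv.symm_apply_apply,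
      Matrix.diagonal_apply, EmbeddingLike.apply_eq_iff_eq]
    rcases a with a | a <;> rcases b with b | b
    · simp [π, Matrix.diagonal_apply]
    · simp
    · simp
    · have h0 : v (e₂ a) = 0 := not_not.mp (e₂ a).2
      simp [π, h0]
  refine ⟨q, hcard, U.submatrix id π, fun i => v (e₁ i), ?_,
    fun i => lt_of_le_of_ne (hv _) (e₁ i).2.symm, ?_⟩
  · rw [Matrix.mem_orthogonalGroup_iff] at hU ⊢
    rw [Matrix.transpose_submatrix, Matrix.submatrix_mul_equiv, hU, Matrix.submatrix_id_id]
  · rw [← hdiag, ← Matrix.submatrix_diagonal_equiv, Matrix.transpose_submatrix,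
      Matrix.submatrix_mul_equiv, Matrix.submatrix_mul_equiv, Matrix.submatrix_id_id]
    exact hDU

/-- The explicit construction can be carried out. -/
lemma exists_isStageSignal {D E : Mat m} (hE : E.PosSemidef) (hDE : (D - E).PosSemidef) :
    ∃ L Th : Mat m, Th.PosSemidef ∧ IsStageSignal D E L Th := by
  have hD : D.PosSemidef := by
    have := hDE.add hE
    rwa [sub_add_cancel] at this
  obtain ⟨q, h, Ub, lb, hUb, hlb, hDU⟩ := exists_sorted_diagonalization hD
  have hUb1 := (Matrix.mem_orthogonalGroup_iff' (Fin m) ℝ).mp hUb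
  set s : Mat D.rank := Matrix.diagonal (fun i => (√(lb i))⁻¹) with hs
  set T := s * topLeft h (Ubᵀ * E * Ub) * s with hT
  have hst : sᵀ = s := Matrix.diagonal_transpose _
  have hconj : ∀ X : Mat m, X.PosSemidef → (s * topLeft h (Ubᵀ * X * Ub) * s).PosSemidef := by
    intro X hX
    have h1 := hX.conjTranspose_mul_mul_same Ub
    rw [Matrix.conjTranspose_eq_transpose_of_trivial] at h1
    have h2 := (posSemidef_topLeft h h1).conjTranspose_mul_mul_same s
    rwa [Matrix.conjTranspose_eq_transpose_of_trivial, hst] at h2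
  have hTpos : T.PosSemidef := hconj E hE
  -- The same transformation takes D to the identity, so E ⪯ D becomes T ⪯ I and the eigenvalues of
  -- T lie in [0, 1].
  have hone : s * topLeft h (Ubᵀ * D * Ub) * s = 1 := by
    have h1 : Ubᵀ * D * Ub = pad h (Matrix.diagonal lb) := by
      conv_lhs => rw [hDU]
      calc Ubᵀ * (Ub * pad h (Matrix.diagonal lb) * Ubᵀ) * Ub
          = (Ubᵀ * Ub) * pad h (Matrix.diagonal lb) * (Ubᵀ * Ub) := by
            simp only [Matrix.mul_assoc]
        _ = _ := by rw [hUb1, Matrix.one_mul, Matrix.mul_one]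
    have hcomm : s * Matrix.diagonal lb = Matrix.diagonal lb * s := by
      simp only [hs, Matrix.diagonal_mul_diagonal, mul_comm]
    rw [h1, topLeft_pad, hcomm, hs]
    exact diagonal_inv_sqrt_mul_self hlb
  have hTle : (1 - T).PosSemidef := by
    have h1 := hconj (D - E) hDE
    rwa [Matrix.mul_sub, Matrix.sub_mul, topLeft_sub, Matrix.mul_sub, Matrix.sub_mul, hone] at h1
  obtain ⟨U, lam, hU, hlam, hTU, -⟩ := exists_diagonalization hTpos
  have hU1 := (Matrix.mem_orthogonalGroup_iff' (Fin D.rank) ℝ).mp hU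
  have hlam1 : ∀ i, lam i ≤ 1 := by
    intro i
    have h1 := hTle.conjTranspose_mul_mul_same U
    rw [Matrix.conjTranspose_eq_transpose_of_trivial, hTU, Matrix.mul_sub, Matrix.sub_mul,
      Matrix.mul_one, hU1] at h1
    have h2 : Uᵀ * (U * Matrix.diagonal lam * Uᵀ) * U = Matrix.diagonal lam := by
      calc Uᵀ * (U * Matrix.diagonal lam * Uᵀ) * U
          = (Uᵀ * U) * Matrix.diagonal lam * (Uᵀ * U) := by simp only [Matrix.mul_assoc]
        _ = _ := by rw [hU1, Matrix.one_mul, Matrix.mul_one]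
    rw [h2] at h1
    have h3 : 0 ≤ (1 - Matrix.diagonal lam : Mat D.rank) i i := h1.diag_nonneg
    simp only [Matrix.sub_apply, Matrix.one_apply_eq, Matrix.diagonal_apply_eq] at h3
    linarith
  -- One admissible choice is λ° = √λ and θ = √(1 - λ): the denominator is 1, hence nonzero even for
  -- λ = 0.
  have hsum : ∀ i, √(lam i) ^ 2 + √(1 - lam i) ^ 2 = 1 := fun i => by
    rw [Real.sq_sqrt (hlam i), Real.sq_sqrt (by linarith [hlam1 i])]
    ring
  refine ⟨_, pad h (Matrix.diagonal fun i => √(1 - lam i) ^ 2), ?_, D.rank, q, h, Ub, lb, U, lam,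
    fun i => √(lam i), fun i => √(1 - lam i), rfl, hUb, hlb, hDU, hU, hTU, fun i => ?_, rfl, rfl⟩
  · have h1 : (pad h (Matrix.diagonal fun i => √(1 - lam i) ^ 2))
        = (pad h (Matrix.diagonal fun i => √(1 - lam i)))ᵀ
          * pad h (Matrix.diagonal fun i => √(1 - lam i)) := by
      rw [pad_transpose, pad_mul, Matrix.diagonal_transpose, Matrix.diagonal_mul_diagonal]
      simp only [sq]
    rw [h1, ← Matrix.conjTranspose_eq_transpose_of_trivial]
    exact Matrix.posSemidef_conjTranspose_mul_self _
  · rw [hsum, div_one, Real.sq_sqrt (hlam i)]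
    exact ⟨one_ne_zero, rfl⟩

lemma exists_isAssociatedRule {r κ : ℕ} {Ω : Type*} (M : Model m r κ Ω) {S : Fin κ → Mat m}
    (hS : S ∈ Feasible M) : ∃ η, IsAssociatedRule M S η := by
  have h : ∀ k, ∃ L Th : Mat m, Th.PosSemidef ∧
      IsStageSignal (freeCov M k - predicted M S k) (S k - predicted M S k) L Th := fun k =>
    exists_isStageSignal (hS k).2.2 (by rw [sub_sub_sub_cancel_right]; exact (hS k).2.1)
  choose L Th hTh hs using h
  refine ⟨⟨fun k j => if j = Fin.last k.val then L k else 0, Th, hTh⟩, fun k => ⟨fun j hj => ?_, ?_⟩⟩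
  · simp [hj]
  · simpa using hs k

end construction

/-! ### Kalman filter for the associated rules -/

section filter

variable {m r κ : ℕ} {Ω : Type*} (M : Model m r κ Ω) (η : SignalRule m κ)

/-- Independent Gaussian vectors are jointly Gaussian. -/
lemma isGaussian_pi_gaussian (S : Fin κ → Mat m) :
    IsGaussian (Measure.pi fun k => gaussian (S k)) := by
  have h1 : iIndepFun (fun k (x : Fin κ → Vec m) => x k) (Measure.pi fun k => gaussian (S k)) :=
    iIndepFun_pi (X := fun _ x => x) fun _ => aemeasurable_id
  have h2 : ∀ k, HasGaussianLaw (fun x : Fin κ → Vec m => x k)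
      (Measure.pi fun k => gaussian (S k)) := fun k =>
    ⟨by rw [(measurePreserving_eval (fun k => gaussian (S k)) k).map_eq]; infer_instance⟩
  have h3 := (iIndepFun.hasGaussianLaw h2 h1).isGaussian_map
  have h4 : (Measure.pi fun k => gaussian (S k)).map (fun x k => x k)
      = Measure.pi fun k => gaussian (S k) := Measure.map_id
  rwa [h4] at h3

instance : IsGaussian (law M η) := by
  have h1 := isGaussian_pi_gaussian (κ := κ) fun _ => M.covNoise
  have h2 := isGaussian_pi_gaussian η.noiseCov
  unfold law baseLaw
  infer_instance

/-- A random vector that depends linearly on the initial state and the noises. -/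
def IsLinear {n : ℕ} (X : Sample m κ → Vec n) : Prop :=
  ∃ L : Sample m κ →L[ℝ] Vec n, ∀ z, L z = X z

namespace IsLinear

variable {n p : ℕ} {X Y : Sample m κ → Vec n}

lemma add (hX : IsLinear X) (hY : IsLinear Y) : IsLinear (fun z => X z + Y z) := by
  obtain ⟨L, hL⟩ := hX
  obtain ⟨L', hL'⟩ := hY
  exact ⟨L + L', fun z => by simp [hL, hL']⟩

lemma sub (hX : IsLinear X) (hY : IsLinear Y) : IsLinear (fun z => X z - Y z) := by
  obtain ⟨L, hL⟩ := hX
  obtain ⟨L', hL'⟩ := hY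
  exact ⟨L - L', fun z => by simp [hL, hL']⟩

lemma mulVec (hX : IsLinear X) (A : Matrix (Fin p) (Fin n) ℝ) :
    IsLinear (fun z => A *ᵥ X z) := by
  obtain ⟨L, hL⟩ := hX
  exact ⟨(Matrix.mulVecLin A).toContinuousLinearMap.comp L, fun z => by simp [hL]⟩

lemma zero : IsLinear (fun _ : Sample m κ => (0 : Vec n)) := ⟨0, fun _ => rfl⟩

lemma sum {α : Type*} {s : Finset α} {X : α → Sample m κ → Vec n} (h : ∀ a, IsLinear (X a)) :
    IsLinear (fun z => ∑ a ∈ s, X a z) := by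
  choose L hL using h
  exact ⟨∑ a ∈ s, L a, fun z => by simp [hL]⟩

lemma squareIntegrable (hX : IsLinear X) : SquareIntegrable (law M η) X := by
  obtain ⟨L, hL⟩ := hX
  intro i
  rw [show (fun z => X z i) = ⇑((ContinuousLinearMap.proj (R := ℝ) i).comp L) from
    funext fun z => (congrFun (hL z) i).symm]
  exact IsGaussian.memLp_dual (law M η) _ 2 (by simp)

lemma measurable (hX : IsLinear X) : Measurable X := by
  obtain ⟨L, hL⟩ := hX
  rw [← show (fun z => L z) = X from funext hL]
  exact L.continuous.measurable

lemma integral_eq_zero (hX : IsLinear X) (i : Fin n) : ∫ z, X z i ∂(law M η) = 0 := by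
  have h := crossMoment_eq_zero_of_flip (P := law M η) (X := X)
    (Y := fun (_ : Sample m κ) (_ : Unit) => (1 : ℝ))
    (measurePreserving_changeSigns M η (a := -1) (b := -1) (c := -1) (Or.inr rfl)
      (fun _ => Or.inr rfl) (fun _ => Or.inr rfl))
    (hX.squareIntegrable M η) (fun _ => memLp_const _)
    (fun z => by
      obtain ⟨L, hL⟩ := hX
      rw [← hL, ← hL, ← map_neg]
      congr 1
      ext <;> simp [changeSigns])
    (fun _ => rfl)
  have := congrFun (congrFun h i) ()
  simpa [crossMoment_apply] using this

end IsLinear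

lemma isLinear_signalNoise (k : Fin κ) : IsLinear (fun z : Sample m κ => z.2 k) :=
  ⟨(ContinuousLinearMap.proj k).comp (ContinuousLinearMap.snd ℝ _ _), fun _ => rfl⟩

lemma isLinear_freeState (k : Fin κ) : IsLinear (fun z : Sample m κ => freeState M z.1 k) := by
  obtain ⟨k, hk⟩ := k
  induction k with
  | zero =>
    simp only [freeState_zero]
    exact ⟨(ContinuousLinearMap.fst ℝ _ _).comp (ContinuousLinearMap.fst ℝ _ _), fun _ => rfl⟩
  | succ k ih =>
    simp only [freeState_succ]
    exact ((ih _).mulVec _).add ⟨(ContinuousLinearMap.proj (R := ℝ) (φ := fun _ : Fin κ => Vec m)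
      ⟨k, Nat.lt_of_succ_lt hk⟩).comp ((ContinuousLinearMap.snd ℝ (Vec m) (Fin κ → Vec m)).comp
        (ContinuousLinearMap.fst ℝ (Base m κ) (Fin κ → Vec m))), fun _ => rfl⟩

lemma isLinear_openSignal (k : Fin κ) : IsLinear (openSignal M η k) := by
  unfold openSignal encode
  exact (IsLinear.sum fun j => (isLinear_freeState M _).mulVec _).add (isLinear_signalNoise k)

/-- Uncorrelated linear random vectors are independent, so that the best linear estimate is the
posterior. -/
lemma estimate_ae_eq_of_uncorrelated {k : Fin κ} {T : Sample m κ → Vec m} (hT : IsLinear T)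
    (hTm : Measurable[openAlg M η k] T)
    (h : ∀ j ≤ k, crossMoment (law M η) (fun z => freeState M z.1 k - T z)
      (openSignal M η j) = 0) :
    estimate M η k =ᵐ[law M η] T := by
  have hε : IsLinear (fun z => freeState M z.1 k - T z) := (isLinear_freeState M k).sub hT
  set ε : Sample m κ → Vec m := fun z => freeState M z.1 k - T z with hεdef
  have hbound : ∀ j : Fin (k.val + 1), j.val < κ := fun j =>
    (Nat.le_of_lt_succ j.isLt).trans_lt k.isLt
  -- The history is flattened to scalars, since the Gaussian independence criterion is stated for
  -- covariances of coordinates.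
  let Y : Sample m κ → (Fin (k.val + 1) × Fin m) → ℝ := fun z a =>
    openSignal M η ⟨a.1.val, hbound a.1⟩ z a.2
  have hgauss : HasGaussianLaw (fun z => (fun i => ε z i, fun a => Y z a)) (law M η) := by
    obtain ⟨Lε, hLε⟩ := hε
    choose LY hLY using fun j => isLinear_openSignal M η j
    let LYa : Sample m κ →L[ℝ] ((Fin (k.val + 1) × Fin m) → ℝ) :=
      ContinuousLinearMap.pi fun a => (ContinuousLinearMap.proj a.2).comp (LY ⟨a.1.val, hbound a.1⟩)
    have h1 : HasGaussianLaw (fun z : Sample m κ => (Lε.prod LYa) z) (law M η) :=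
      (IsGaussian.hasGaussianLaw_id (μ := law M η)).map_fun (Lε.prod LYa)
    have h2 : (fun z : Sample m κ => (Lε.prod LYa) z) = fun z => (fun i => ε z i, fun a => Y z a) := by
      funext z
      refine Prod.ext (hLε z) ?_
      funext a
      exact congrFun (hLY _ z) a.2
    rwa [h2] at h1
  have hindep : IndepFun (fun z i => ε z i) (fun z a => Y z a) (law M η) := by
    refine hgauss.indepFun_of_covariance_eval (X := fun i z => ε z i) (Y := fun a z => Y z a)
      fun i a => ?_
    have h1 := isLinear_openSignal M η ⟨a.1.val, hbound a.1⟩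
    rw [covariance_eq_sub (hε.squareIntegrable M η i) (h1.squareIntegrable M η a.2),
      hε.integral_eq_zero M η i, zero_mul, sub_zero]
    exact congrFun (congrFun (h ⟨a.1.val, hbound a.1⟩ (Nat.le_of_lt_succ a.1.isLt)) i) a.2
  have hindep' : IndepFun ε (openHistory M η k) (law M η) :=
    hindep.comp measurable_id
      (ψ := fun y : (Fin (k.val + 1) × Fin m) → ℝ => fun j i => y (j, i)) (by fun_prop)
  have hcond : ∀ i, (law M η)[fun z => freeState M z.1 k i | openAlg M η k]
      =ᵐ[law M η] fun z => T z i := by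
    intro i
    have hle := openAlg_le M η k
    have hi : (fun z => freeState M z.1 k i) = (fun z => ε z i) + fun z => T z i := by
      funext z
      simp [ε]
    have hTi : StronglyMeasurable[openAlg M η k] (fun z => T z i) :=
      ((measurable_pi_apply i).comp hTm).stronglyMeasurable
    have hTint : Integrable (fun z => T z i) (law M η) :=
      (hT.squareIntegrable M η i).integrable (by norm_num)
    have hεint : Integrable (fun z => ε z i) (law M η) :=
      (hε.squareIntegrable M η i).integrable (by norm_num)
    have hεm := hε.measurable
    -- The residual is independent of the history and centered, so its conditional expectation
    -- vanishes.
    have h1 : (law M η)[fun z => ε z i | openAlg M η k] =ᵐ[law M η] fun _ => 0 := by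
      have h2 := condExp_indep_eq (μ := law M η) (f := fun z => ε z i) hεm.comap_le hle
        ((measurable_pi_apply i).comp (comap_measurable ε)).stronglyMeasurable
        ((IndepFun_iff_Indep _ _ _).mp hindep')
      rwa [hε.integral_eq_zero M η i] at h2
    rw [hi]
    refine (condExp_add hεint hTint _).trans ?_
    rw [condExp_of_stronglyMeasurable hle hTi hTint]
    filter_upwards [h1] with z hz
    simp [hz]
  filter_upwards [ae_all_iff.mpr hcond] with z hz
  exact funext hz

/-- One step of the filter for a signal that satisfies the normal equations. -/
lemma filter_step {k : Fin κ} (hgain : ∀ j : Fin (k.val + 1), j ≠ Fin.last k.val → η.gain k j = 0)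
    {p : Sample m κ → Vec m} (hp : IsLinear p) (hpm : Measurable[openAlg M η k] p)
    (hps : ∀ j < k, crossMoment (law M η) (fun z => freeState M z.1 k - p z)
      (openSignal M η j) = 0)
    (hpp : crossMoment (law M η) (fun z => freeState M z.1 k - p z) p = 0)
    (hpθ : crossMoment (law M η) (fun z => z.2 k) p = 0)
    {D E : Mat m} (hD : D = freeCov M k - crossMoment (law M η) p p)
    {G : Mat m} (hG : G * ((η.gain k (Fin.last k.val))ᵀ * D * η.gain k (Fin.last k.val)
      + η.noiseCov k) = D * η.gain k (Fin.last k.val))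
    (hGE : G * ((η.gain k (Fin.last k.val))ᵀ * D * η.gain k (Fin.last k.val) + η.noiseCov k) * Gᵀ
      = E) :
    crossMoment (law M η) (estimate M η k) (estimate M η k) = crossMoment (law M η) p p + E ∧
    ∃ T : Sample m κ → Vec m, IsLinear T ∧ Measurable[openAlg M η k] T ∧
      estimate M η k =ᵐ[law M η] T := by
  set L := η.gain k (Fin.last k.val) with hL
  have hx := isLinear_freeState M k
  have hθ := isLinear_signalNoise (m := m) k
  have he : IsLinear (fun z => freeState M z.1 k - p z) := hx.sub hp
  set e : Sample m κ → Vec m := fun z => freeState M z.1 k - p z with hedef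
  have hν : IsLinear (fun z => Lᵀ *ᵥ e z + z.2 k) := (he.mulVec _).add hθ
  -- The innovation: the signal minus the part L'p that the prediction p already determines.
  set ν : Sample m κ → Vec m := fun z => Lᵀ *ᵥ e z + z.2 k with hνdef
  have hxs := hx.squareIntegrable M η
  have hps' := hp.squareIntegrable M η
  have hes := he.squareIntegrable M η
  have hνs := hν.squareIntegrable M η
  have hθs := hθ.squareIntegrable M η
  have hsig : ∀ z, openSignal M η k z = ν z + Lᵀ *ᵥ p z := by
    intro z
    rw [openSignal, encode, Finset.sum_eq_single (Fin.last k.val)]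
    · simp only [hνdef, hedef, Matrix.mulVec_sub]
      simp only [Fin.val_last, Fin.eta, ← hL]
      abel
    · intro j _ hj
      rw [hgain j hj, Matrix.transpose_zero, Matrix.zero_mulVec]
    · simp
  have hee : crossMoment (law M η) e e = D := by
    have h1 : crossMoment (law M η) e e = crossMoment (law M η) e (fun z => freeState M z.1 k) := by
      rw [show crossMoment (law M η) e e
        = crossMoment (law M η) e (fun z => freeState M z.1 k - p z) from rfl,
        crossMoment_sub_right hes hxs hps', hpp, sub_zero]
    have h2 : crossMoment (law M η) p (fun z => freeState M z.1 k)
        = crossMoment (law M η) p p := by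
      rw [← crossMoment_transpose (fun z : Sample m κ => freeState M z.1 k)]
      rw [crossMoment_sub_left hxs hps' hps', sub_eq_zero] at hpp
      rw [hpp, crossMoment_transpose]
    rw [h1, crossMoment_sub_left hxs hps' hxs, h2, hD, freeCov_eq M η]
  have hθe : crossMoment (law M η) (fun z => z.2 k) e = 0 := by
    rw [crossMoment_sub_right hθs hxs hps', crossMoment_signalNoise_freeState, hpθ, sub_zero]
  have heθ : crossMoment (law M η) e (fun z => z.2 k) = 0 := by
    rw [← crossMoment_transpose (fun z : Sample m κ => z.2 k), hθe, Matrix.transpose_zero]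
  have heν : crossMoment (law M η) e ν = D * L := by
    rw [crossMoment_add_right hes (hes.mulVec _) hθs, crossMoment_mulVec_right hes hes, heθ, hee,
      Matrix.transpose_transpose, add_zero]
  have hνν : crossMoment (law M η) ν ν = Lᵀ * D * L + η.noiseCov k := by
    have h1 : crossMoment (law M η) (fun z => z.2 k) ν = η.noiseCov k := by
      rw [crossMoment_add_right hθs (hes.mulVec _) hθs, crossMoment_mulVec_right hθs hes, hθe,
        crossMoment_signalNoise, Matrix.zero_mul, zero_add]
    rw [crossMoment_add_left (hes.mulVec _) hθs hνs, crossMoment_mulVec_left hes hνs, heν, h1,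
      Matrix.mul_assoc]
  have hνp : crossMoment (law M η) ν p = 0 := by
    rw [crossMoment_add_left (hes.mulVec _) hθs hps', crossMoment_mulVec_left hes hps', hpp, hpθ,
      Matrix.mul_zero, add_zero]
  have hT : IsLinear (fun z => p z + G *ᵥ ν z) := hp.add (hν.mulVec _)
  have hνm : Measurable[openAlg M η k] ν := by
    have h1 : ν = fun z => openSignal M η k z - Lᵀ *ᵥ p z := by
      funext z
      rw [hsig, add_sub_cancel_right]
    rw [h1]
    exact (measurable_openSignal_openAlg M η le_rfl).sub (measurable_mulVec _ hpm)
  have hTm : Measurable[openAlg M η k] (fun z => p z + G *ᵥ ν z) :=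
    hpm.add (measurable_mulVec _ hνm)
  have herr : (fun z => freeState M z.1 k - (p z + G *ᵥ ν z)) = fun z => e z - G *ᵥ ν z := by
    funext z
    simp only [hedef]
    abel
  -- Prediction plus gain times innovation. Its error is uncorrelated with earlier signals because e
  -- and ν are, and with the present one by the normal equations.
  have hest : estimate M η k =ᵐ[law M η] fun z => p z + G *ᵥ ν z := by
    refine estimate_ae_eq_of_uncorrelated M η hT hTm fun j hj => ?_
    rw [herr]
    rcases eq_or_lt_of_le hj with rfl | hj'
    · have h1 : openSignal M η j = fun z => ν z + Lᵀ *ᵥ p z := funext hsig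
      rw [h1, crossMoment_add_right (hes.sub (hνs.mulVec _)) hνs (hps'.mulVec _),
        crossMoment_mulVec_right (hes.sub (hνs.mulVec _)) hps',
        crossMoment_sub_left hes (hνs.mulVec _) hνs, crossMoment_sub_left hes (hνs.mulVec _) hps',
        crossMoment_mulVec_left hνs hνs, crossMoment_mulVec_left hνs hps', heν, hνν, hG, hνp, hpp]
      simp
    · have hs := squareIntegrable_openSignal M η j
      have hθj : crossMoment (law M η) (fun z => z.2 k) (openSignal M η j) = 0 :=
        crossMoment_signalNoise_openAlg M η hj' hs (measurable_openSignal_openAlg M η le_rfl)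
      have hνj : crossMoment (law M η) ν (openSignal M η j) = 0 := by
        rw [crossMoment_add_left (hes.mulVec _) hθs hs, crossMoment_mulVec_left hes hs, hps j hj',
          hθj, Matrix.mul_zero, add_zero]
      rw [crossMoment_sub_left hes (hνs.mulVec _) hs, crossMoment_mulVec_left hνs hs, hνj,
        hps j hj', Matrix.mul_zero, sub_zero]
  refine ⟨?_, _, hT, hTm, hest⟩
  have hpν : crossMoment (law M η) p ν = 0 := by
    rw [← crossMoment_transpose ν, hνp, Matrix.transpose_zero]
  rw [crossMoment_congr hest hest, crossMoment_add_left hps' (hνs.mulVec _) (hT.squareIntegrable M η),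
    crossMoment_add_right hps' hps' (hνs.mulVec _), crossMoment_add_right (hνs.mulVec _) hps'
      (hνs.mulVec _), crossMoment_mulVec_right hps' hνs, crossMoment_mulVec_left hνs hps',
    crossMoment_mulVec_self hνs, hpν, hνp, hνν, hGE]
  simp

/-- Induction along the filter: A times the last posterior is the prediction, its covariance is the
predicted part of S, and the gain adds exactly the difference prescribed by S. -/
theorem posteriorCov_of_isAssociatedRule {S : Fin κ → Mat m} (hS : S ∈ Feasible M)
    (hη : IsAssociatedRule M S η) (γ : ControlPolicy m r κ) : posteriorCov M η γ = S := by
  -- The posterior is linear only up to null sets, so a genuinely linear observable version T is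
  -- carried along as the next predictor.
  suffices H : ∀ k : Fin κ,
      crossMoment (law M η) (estimate M η k) (estimate M η k) = S k ∧
      ∃ T : Sample m κ → Vec m, IsLinear T ∧ Measurable[openAlg M η k] T ∧
        estimate M η k =ᵐ[law M η] T by
    funext k
    rw [posteriorCov_eq]
    exact (H k).1
  rintro ⟨k, hk⟩
  have hgain : ∀ k : Fin κ, ∃ G : Mat m,
      G * ((η.gain k (Fin.last k.val))ᵀ * (freeCov M k - predicted M S k)
        * η.gain k (Fin.last k.val) + η.noiseCov k)
        = (freeCov M k - predicted M S k) * η.gain k (Fin.last k.val) ∧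
      G * ((η.gain k (Fin.last k.val))ᵀ * (freeCov M k - predicted M S k)
        * η.gain k (Fin.last k.val) + η.noiseCov k) * Gᵀ = S k - predicted M S k := fun k =>
    (hη k).2.exists_gain (hS k).2.2 (by rw [sub_sub_sub_cancel_right]; exact (hS k).2.1)
  induction k with
  | zero =>
    obtain ⟨G, hG, hGE⟩ := hgain ⟨0, hk⟩
    have hz : ∀ {ι : Type} (X : Sample m κ → ι → ℝ),
        crossMoment (law M η) X (fun _ => (0 : Vec m)) = 0 := fun X => by
      ext i j
      simp [crossMoment_apply]
    have hpred : predicted M S ⟨0, hk⟩ = crossMoment (law M η) (fun _ => (0 : Vec m))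
        (fun _ => (0 : Vec m)) := by
      rw [hz, predicted, if_pos rfl]
    -- At the first stage the prediction is 0, matching the convention for the predicted matrix.
    have h := filter_step M η (k := ⟨0, hk⟩) (hη _).1 IsLinear.zero measurable_const
      (fun j hj => absurd hj (Nat.not_lt_zero _)) (hz _) (hz _) (by rw [hpred]) hG hGE
    rwa [← hpred, add_sub_cancel] at h
  | succ k ih =>
    obtain ⟨G, hG, hGE⟩ := hgain ⟨k + 1, hk⟩
    set j : Fin κ := ⟨k, Nat.lt_of_succ_lt hk⟩ with hj
    have hjk : j < ⟨k + 1, hk⟩ := Nat.lt_succ_self k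
    obtain ⟨hcov, T, hT, hTm, hTe⟩ := ih (Nat.lt_of_succ_lt hk)
    have hTs := hT.squareIntegrable M η
    have hAT := hT.mulVec M.A
    have hATs := hAT.squareIntegrable M η
    have hATm : Measurable[openAlg M η j] (fun z => M.A *ᵥ T z) := measurable_mulVec _ hTm
    have horth : ∀ Y : Sample m κ → Vec m, SquareIntegrable (law M η) Y →
        Measurable[openAlg M η j] Y →
        crossMoment (law M η) (fun z => freeState M z.1 ⟨k + 1, hk⟩ - M.A *ᵥ T z) Y = 0 := by
      intro Y hY hYm
      rw [crossMoment_sub_left (squareIntegrable_freeState M η _) hATs hY,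
        crossMoment_freeState_succ M η hk hY hYm, crossMoment_mulVec_left hTs hY,
        crossMoment_congr hTe Filter.EventuallyEq.rfl, sub_self]
    have hpred : predicted M S ⟨k + 1, hk⟩ = crossMoment (law M η) (fun z => M.A *ᵥ T z)
        (fun z => M.A *ᵥ T z) := by
      rw [crossMoment_mulVec_self hTs, ← crossMoment_congr hTe hTe, hcov, predicted,
        if_neg (Nat.succ_ne_zero k)]
      rfl
    have h := filter_step M η (k := ⟨k + 1, hk⟩) (hη _).1 hAT
      (hATm.mono (openAlg_mono M η hjk.le) le_rfl)
      (fun i hi => horth _ (squareIntegrable_openSignal M η i)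
        (measurable_openSignal_openAlg M η (Nat.le_of_lt_succ hi)))
      (horth _ hATs hATm) (crossMoment_signalNoise_openAlg M η hjk hATs hATm)
      (by rw [hpred]) hG hGE
    rwa [← hpred, add_sub_cancel] at h

end filter

/-! ### Existence of a solution, and its correspondence with equilibria -/

section program

variable {m r κ : ℕ} {Ω : Type*} (M : Model m r κ Ω)

lemma isClosed_posSemidef {n : ℕ} : IsClosed {X : Mat n | X.PosSemidef} := by
  have h : {X : Mat n | X.PosSemidef}
      = {X | Xᵀ = X} ∩ ⋂ v : Vec n, {X | 0 ≤ v ⬝ᵥ X *ᵥ v} := by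
    ext X
    simp only [Set.mem_ofPred_eq, Set.mem_inter_iff, Set.mem_iInter]
    constructor
    · intro hX
      exact ⟨PosSemidef.transpose_eq hX, fun v => by simpa using hX.dotProduct_mulVec_nonneg v⟩
    · rintro ⟨h1, h2⟩
      refine Matrix.PosSemidef.of_dotProduct_mulVec_nonneg ?_ fun v => by simpa using h2 v
      rwa [Matrix.IsHermitian, Matrix.conjTranspose_eq_transpose_of_trivial]
  rw [h]
  refine IsClosed.inter (isClosed_eq continuous_id.matrix_transpose continuous_id)
    (isClosed_iInter fun v => isClosed_le continuous_const ?_)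
  exact continuous_const.dotProduct (continuous_id.matrix_mulVec continuous_const)

lemma continuous_predicted (k : Fin κ) : Continuous fun S => predicted M S k := by
  unfold predicted
  split_ifs
  · exact continuous_const
  · exact (continuous_const.matrix_mul (continuous_apply _)).matrix_mul continuous_const

lemma isClosed_feasible : IsClosed (Feasible M) := by
  have h : Feasible M = ⋂ k, ({S | (S k).PosSemidef} ∩ {S | (freeCov M k - S k).PosSemidef}
      ∩ {S | (S k - predicted M S k).PosSemidef}) := by
    ext S
    simp only [Feasible, Set.mem_ofPred_eq, Set.mem_iInter, Set.mem_inter_iff, and_assoc]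
  rw [h]
  refine isClosed_iInter fun k => ?_
  have hc : Continuous fun S : Fin κ → Mat m => S k := continuous_apply k
  have h1 : Continuous fun S : Fin κ → Mat m => freeCov M k - S k := continuous_const.sub hc
  have h2 : Continuous fun S : Fin κ → Mat m => S k - predicted M S k :=
    hc.sub (continuous_predicted M k)
  exact ((isClosed_posSemidef.preimage hc).inter (isClosed_posSemidef.preimage h1)).inter
    (isClosed_posSemidef.preimage h2)

/-- The quadratic form of X at e_i ± e_j bounds |X_ij| by diagonal entries of X, which are at most
those of Y. The factor 1/2 is given away. -/
lemma PosSemidef.abs_apply_le {n : ℕ} {X Y : Mat n} (hX : X.PosSemidef)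
    (hXY : (Y - X).PosSemidef) (i j : Fin n) : |X i j| ≤ Y i i + Y j j := by
  have hq : ∀ c : ℝ, 0 ≤ X i i + 2 * c * X i j + c ^ 2 * X j j := by
    intro c
    have h1 := hX.dotProduct_mulVec_nonneg (Pi.single i 1 + c • Pi.single j 1)
    have hij : X j i = X i j := congrFun (congrFun (PosSemidef.transpose_eq hX) i) j
    simp only [star_trivial, Matrix.mulVec_add, Matrix.mulVec_smul, dotProduct_add, add_dotProduct,
      smul_dotProduct, dotProduct_smul, Matrix.mulVec_single_one, single_one_dotProduct,
      Matrix.col_apply, smul_eq_mul, hij] at h1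
    linarith
  have hd : ∀ a, 0 ≤ X a a ∧ X a a ≤ Y a a := fun a => by
    have h1 : 0 ≤ (Y - X) a a := hXY.diag_nonneg
    rw [Matrix.sub_apply] at h1
    exact ⟨hX.diag_nonneg, by linarith⟩
  have h1 := hq 1
  have h2 := hq (-1)
  have h3 := hd i
  have h4 := hd j
  rw [abs_le]
  constructor <;> linarith

lemma isCompact_feasible : IsCompact (Feasible M) := by
  have hK : IsCompact (Set.univ.pi fun k : Fin κ => Set.univ.pi fun i : Fin m =>
      Set.univ.pi fun j : Fin m => Set.Icc (-(freeCov M k i i + freeCov M k j j))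
        (freeCov M k i i + freeCov M k j j)) :=
    isCompact_univ_pi fun k => isCompact_univ_pi fun i => isCompact_univ_pi fun j => isCompact_Icc
  refine hK.of_isClosed_subset (isClosed_feasible M) fun S hS => ?_
  simp only [Set.mem_pi, Set.mem_univ, true_imp_iff, Set.mem_Icc, ← abs_le]
  exact fun k i j => PosSemidef.abs_apply_le (hS k).1 (hS k).2.1 i j

/-- A pointwise bounded supremum of continuous functions of S. -/
lemma lowerSemicontinuous_programValue [Fintype Ω] :
    LowerSemicontinuous (programValue M : (Fin κ → Mat m) → ℝ) := by
  refine lowerSemicontinuous_ciSup (fun S => ?_) fun p => Continuous.lowerSemicontinuous ?_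
  · refine ⟨∑ ω, |xi M ω + ∑ k, (S k * Xi M ω k).trace|, ?_⟩
    rintro _ ⟨p, rfl⟩
    refine Finset.sum_le_sum fun ω _ => (le_abs_self _).trans ?_
    rw [abs_mul, abs_of_nonneg (p.2.1 ω)]
    exact mul_le_of_le_one_left (abs_nonneg _)
      ((Finset.single_le_sum (fun ω _ => p.2.1 ω) (Finset.mem_univ ω)).trans p.2.2.le)
  · refine continuous_finsetSum _ fun ω _ => continuous_const.mul (continuous_const.add
      (continuous_finsetSum _ fun k _ => Continuous.matrix_trace ?_))
    exact (continuous_apply k).matrix_mul continuous_const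

/-- A rule that reveals nothing. -/
def silentRule (m κ : ℕ) : SignalRule m κ :=
  ⟨fun _ _ => 0, fun _ => 0, fun _ => Matrix.PosSemidef.zero⟩

/-- The posterior covariances of the uninformative rule show that the compact feasible set is
nonempty. -/
lemma exists_isSolution [Fintype Ω] : ∃ S, IsSolution M S := by
  have hne : (Feasible M).Nonempty :=
    ⟨_, posteriorCov_mem_feasible M (silentRule m κ) ⟨fun _ _ => 0, fun _ => measurable_const⟩⟩
  obtain ⟨S, hS, hmin⟩ := LowerSemicontinuousOn.exists_isMinOn
    hne (isCompact_feasible M) ((lowerSemicontinuous_programValue M).lowerSemicontinuousOn _)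
  exact ⟨S, hS, fun S' hS' => hmin hS'⟩

variable {M} in
/-- Equilibria and solutions of the program correspond to each other. -/
lemma isEquilibrium_iff_isSolution [Fintype Ω]
    {g : SignalRule m κ → Option Ω → ControlPolicy m r κ} (hg : IsReaction M g)
    (η : SignalRule m κ) (γ : ControlPolicy m r κ) :
    IsEquilibrium M η g ↔ IsSolution M (posteriorCov M η γ) := by
  have hle : ∀ η', sensorCost M η (g η) ≤ sensorCost M η' (g η') ↔
      programValue M (posteriorCov M η γ) ≤ programValue M (posteriorCov M η' γ) := fun η' => by
    rw [← EReal.coe_ennreal_le_coe_ennreal_iff, sensorCost_eq γ (hg η), sensorCost_eq γ (hg η'),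
      EReal.coe_le_coe_iff]
  constructor
  · rintro ⟨-, h⟩
    refine ⟨posteriorCov_mem_feasible M η γ, fun S hS => ?_⟩
    -- Every competitor of the program is realized by a rule, so optimality among rules is
    -- optimality over the whole feasible set.
    obtain ⟨η', hη'⟩ := exists_isAssociatedRule M hS
    have := (hle η').mp (h η')
    rwa [posteriorCov_of_isAssociatedRule M η' hS hη'] at this
  · rintro ⟨-, h⟩
    exact ⟨hg, fun η' => (hle η').mpr (h _ (posteriorCov_mem_feasible M η' γ))⟩

end program

end RobustSensor
end

/-! ### Assembly of the main theorem -/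

theorem corollary1 {m r κ : ℕ} {Ω : Type*} [Fintype Ω] (M : RobustSensor.Model m r κ Ω) :
    (∃ g, RobustSensor.IsReaction M g) ∧
    ∀ g : RobustSensor.SignalRule m κ → Option Ω → RobustSensor.ControlPolicy m r κ,
      RobustSensor.IsReaction M g →
      -- every signaling rule yields a feasible point of the program, with the same value
      (∀ (η : RobustSensor.SignalRule m κ) (γ : RobustSensor.ControlPolicy m r κ),
        RobustSensor.posteriorCov M η γ ∈ RobustSensor.Feasible M ∧
        ((RobustSensor.sensorCost M η (g η) : ENNReal) : EReal) =
          ((RobustSensor.programValue M (RobustSensor.posteriorCov M η γ) : ℝ) : EReal)) ∧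
      -- every feasible point comes from a signaling rule, by the explicit construction
      (∀ S ∈ RobustSensor.Feasible M,
        (∃ η, RobustSensor.IsAssociatedRule M S η) ∧
        ∀ η, RobustSensor.IsAssociatedRule M S η → ∀ γ, RobustSensor.posteriorCov M η γ = S) ∧
      -- both minima are attained and they are equal
      (∃ v : ℝ,
        IsLeast (Set.range fun η => ((RobustSensor.sensorCost M η (g η) : ENNReal) : EReal))
          (v : EReal) ∧
        IsLeast (RobustSensor.programValue M '' RobustSensor.Feasible M) v) ∧
      -- the solutions correspond to each other
      (∀ (η : RobustSensor.SignalRule m κ) (γ : RobustSensor.ControlPolicy m r κ),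
        RobustSensor.IsEquilibrium M η g ↔
          RobustSensor.IsSolution M (RobustSensor.posteriorCov M η γ)) ∧
      -- a solution of the program yields optimal signaling rules by the explicit construction
      (∀ S, RobustSensor.IsSolution M S →
        (∃ η, RobustSensor.IsAssociatedRule M S η) ∧
        ∀ η, RobustSensor.IsAssociatedRule M S η → RobustSensor.IsEquilibrium M η g) := by
  refine ⟨RobustSensor.exists_isReaction M, fun g hg => ?_⟩
  have hcost := fun η γ => RobustSensor.sensorCost_eq γ (hg η)
  have hassoc : ∀ S ∈ RobustSensor.Feasible M, ∃ η, RobustSensor.IsAssociatedRule M S η :=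
    fun S hS => RobustSensor.exists_isAssociatedRule M hS
  have hcov := fun S hS η hη γ =>
    RobustSensor.posteriorCov_of_isAssociatedRule (S := S) M η hS hη γ
  refine ⟨fun η γ => ⟨RobustSensor.posteriorCov_mem_feasible M η γ, hcost η γ⟩,
    fun S hS => ⟨hassoc S hS, hcov S hS⟩, ?_,
    RobustSensor.isEquilibrium_iff_isSolution hg, fun S hS => ⟨hassoc S hS.1, fun η hη => ?_⟩⟩
  · obtain ⟨S, hS, hmin⟩ := RobustSensor.exists_isSolution M
    obtain ⟨η, hη⟩ := hassoc S hS
    -- Any policy will do: the posterior covariances do not depend on it.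
    have γ := g η none
    refine ⟨RobustSensor.programValue M S, ⟨⟨η, ?_⟩, ?_⟩, ⟨⟨S, hS, rfl⟩, ?_⟩⟩
    · simp only [hcost η γ, hcov S hS η hη γ]
    · rintro _ ⟨η', rfl⟩
      simp only [hcost η' γ, EReal.coe_le_coe_iff]
      exact hmin _ (RobustSensor.posteriorCov_mem_feasible M η' γ)
    · rintro _ ⟨S', hS', rfl⟩
      exact hmin S' hS'
  · rw [RobustSensor.isEquilibrium_iff_isSolution hg η (g η none), hcov S hS.1 η hη]
    exact hS
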